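/- Let $\mathcal H_A,\mathcal H_B$ be Hilbert spaces of finite dimensions $d_A,d_B$, let $|\Psi\rangle\in\mathcal H_A\otimes\mathcal H_B$ be a unit vector with Schmidt decomposition $|\Psi\rangle=\sum_i\sqrt{\lambda_i}\,|i\rangle\otimes|i\rangle$, and let $\rho_{mix}=I/(d_Ad_B)$ be the completely mixed state. Put $H_1(\Psi)=-\sum_i\lambda_i\log\lambda_i$ and $V(\Psi)=\sum_i\lambda_i(\log\lambda_i+H_1(\Psi))^2$ (with terms for $\lambda_i=0$ equal to $0$), and assume $V(\Psi)>0$, i.e. the non-zero Schmidt coefficients are not all equal. Let $\Phi(x)=\int_{-\infty}^x\frac{1}{\sqrt{2\pi}}e^{-y^2/2}\,dy$. For a class $C$ of two-valued POVMs $\{T,I-T\}$ on the bipartite system $\mathcal H_A^{\otimes n}\otimes\mathcal H_B^{\otimes n}$ and $0\le\epsilon\le 1$, let $$\beta_{n,C}(\epsilon|\Psi\|\rho_{mix})=\inf\bigl\{\operatorname{Tr}\rho_{mix}^{\otimes n}(I-T)\ :\ \{T,I-T\}\in C,\ \langle\Psi|^{\otimes n}T|\Psi\rangle^{\otimes n}\le\epsilon\bigr\}$$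 be the optimal type-2 error at type-1 level $\epsilon$. The classes are: $(\leftrightarrow,k)$, the POVMs realized by LOCC protocols with $k$ rounds of classical communication (that is, $k+1$ local steps, performed alternately by Alice and Bob and started by Alice, each step being chosen according to the outcomes sent before); $\rightarrow$, the one-way LOCC POVMs, i.e. $(\leftrightarrow,1)$; $\leftrightarrow$, the two-way LOCC POVMs, i.e. the closure of $\bigcup_k(\leftrightarrow,k)$; and $sep$, the separable POVMs, both of whose elements are finite sums of tensor products of positive semidefinite operators on $\mathcal H_A^{\otimes n}$ and $\mathcal H_B^{\otimes n}$. Then for every fixed $\epsilon\in(0,1)$, as $n\to\infty$, $$\log\beta_{n,\rightarrow}(\epsilon|\Psi\|\rho_{mix})=-n\bigl(\log d_Ad_B-H_1(\Psi)\bigr)-\sqrt n\,\sqrt{V(\Psi)}\,\Phi^{-1}(\epsilon)-\tfrac12\log n+O(1),$$ and $$\begin{aligned}\log\beta_{n,\leftrightarrow,2}(\epsilon|\Psi\|\rho_{mix})&=\log\beta_{n,\leftrightarrow}(\epsilon|\Psi\|\rho_{mix})+O(1)=\log\beta_{n,sep}(\epsilon|\Psi\|\rho_{mix})+O(1)\\&=-n\bigl(\log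 d_Ad_B-H_1(\Psi)\bigr)-\sqrt n\,\sqrt{V(\Psi)}\,\Phi^{-1}(\epsilon)-\log n+O(1).\end{aligned}$$ The constants in $O(1)$ may depend on $\Psi$ and $\epsilon$. -/

import Mathlib

open scoped ComplexOrder Kronecker
open Filter Asymptotics

noncomputable section

namespace LocalTest

/-! ### Measurements on a bipartite system

A finite-dimensional system is `ℂ^A` for a finite index type `A`, and a bipartite one is `ℂ^(A × B)`.
A POVM with outcomes in `X` is a family `X → Matrix`. -/

/-- `M` is a POVM: positive semidefinite elements that sum to the identity. -/
def IsPOVM {X S : Type} [Fintype X] [Fintype S] [DecidableEq S]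
    (M : X → Matrix S S ℂ) : Prop :=
  (∀ x, (M x).PosSemidef) ∧ ∑ x, M x = 1

/-- The swap `ℂ^B ⊗ ℂ^A → ℂ^A ⊗ ℂ^B` applied to an operator. -/
def swapOp {A B : Type} (R : Matrix (B × A) (B × A) ℂ) : Matrix (A × B) (A × B) ℂ :=
  R.submatrix Prod.swap Prod.swap

/-- `IsLOCC X k A B M`: the POVM `M` on `ℂ^A ⊗ ℂ^B` is realized by an LOCC protocol with `k` rounds
of classical communication (hence `k + 1` local steps), in which the party holding `A` acts first
and the parties alternate.

* With no communication, the party holding `A` performs a POVM `E` and announces its outcome.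
* With `k + 1` rounds, the party holding `A` applies a quantum instrument to its system: on the
  outcome `i`, which is sent to the other party, it acts by the completely positive map with Kraus
  operators `K i j : ℂ^A → ℂ^(a i)`. Then the parties run a `k`-round protocol, chosen according to
  `i`, which is started by the other party. The POVM of the whole protocol is the pull back
  (Heisenberg picture) of the POVMs `R i` of these protocols. -/
def IsLOCC (X : Type) [Fintype X] : ℕ → ∀ (A B : Type) [Fintype A] [DecidableEq A]
    [Fintype B] [DecidableEq B], (X → Matrix (A × B) (A × B) ℂ) → Prop
  | 0, A, B, _, _, _, _, M =>
      ∃ E : X → Matrix A A ℂ, IsPOVM E ∧ ∀ x, M x = E x ⊗ₖ (1 : Matrix B B ℂ)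
  | k + 1, A, B, _, _, _, _, M =>
      ∃ (m r : ℕ) (a : Fin m → ℕ) (K : ∀ i : Fin m, Fin r → Matrix (Fin (a i)) A ℂ)
        (R : ∀ i : Fin m, X → Matrix (B × Fin (a i)) (B × Fin (a i)) ℂ),
        ∑ i, ∑ j, (K i j).conjTranspose * K i j = 1 ∧
        (∀ i, IsLOCC X k B (Fin (a i)) (R i)) ∧
        ∀ x, M x = ∑ i, ∑ j, (K i j ⊗ₖ (1 : Matrix B B ℂ)).conjTranspose * swapOp (R i x) *
          (K i j ⊗ₖ (1 : Matrix B B ℂ))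

/-- A separable positive operator: a finite sum of tensor products of positive operators. -/
def IsSeparableOp {A B : Type} [Fintype A] [Fintype B]
    (S : Matrix (A × B) (A × B) ℂ) : Prop :=
  ∃ (m : ℕ) (E : Fin m → Matrix A A ℂ) (F : Fin m → Matrix B B ℂ),
    (∀ i, (E i).PosSemidef) ∧ (∀ i, (F i).PosSemidef) ∧ S = ∑ i, E i ⊗ₖ F i

section Classes

variable (A B : Type) [Fintype A] [DecidableEq A] [Fintype B] [DecidableEq B]

/-- Two-valued POVMs realized by LOCC with `k` rounds of classical communication, Alice (who holds
`A`) acting first. -/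
def loccRounds (k : ℕ) : Set (Fin 2 → Matrix (A × B) (A × B) ℂ) :=
  {M | IsLOCC (Fin 2) k A B M}

/-- Two-valued one-way LOCC POVMs: one round of communication, from Alice to Bob. -/
def oneWayLOCC : Set (Fin 2 → Matrix (A × B) (A × B) ℂ) := loccRounds A B 1

/-- Two-valued two-way LOCC POVMs: the closure of the set of all two-valued POVMs realized by LOCC
with some finite number of rounds. -/
def twoWayLOCC : Set (Fin 2 → Matrix (A × B) (A × B) ℂ) := closure (⋃ k : ℕ, loccRounds A B k)

/-- Two-valued separable POVMs. -/
def separablePOVM : Set (Fin 2 → Matrix (A × B) (A × B) ℂ) :=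
  {M | IsPOVM M ∧ ∀ x, IsSeparableOp (M x)}

end Classes

/-! ### States and errors -/

/-- The `n`-fold tensor power of an operator on `ℂ^A ⊗ ℂ^B`, as an operator on
`(ℂ^A)^{⊗ n} ⊗ (ℂ^B)^{⊗ n}`. -/
def copies {A B : Type} (n : ℕ) (ρ : Matrix (A × B) (A × B) ℂ) :
    Matrix ((Fin n → A) × (Fin n → B)) ((Fin n → A) × (Fin n → B)) ℂ :=
  fun p q => ∏ i, ρ (p.1 i, p.2 i) (q.1 i, q.2 i)

/-- The rank-one operator `|Ψ⟩⟨Ψ|`. -/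
def pureState {A B : Type} (Ψ : EuclideanSpace ℂ (A × B)) : Matrix (A × B) (A × B) ℂ :=
  Matrix.vecMulVec (fun p => Ψ p) (fun p => star (Ψ p))

/-- The completely mixed state `I / (d_A d_B)`. -/
def mixedState (A B : Type) [Fintype A] [DecidableEq A] [Fintype B] [DecidableEq B] :
    Matrix (A × B) (A × B) ℂ :=
  ((Fintype.card A : ℂ) * (Fintype.card B : ℂ))⁻¹ • 1

/-- The optimal type-2 error for the null hypothesis `ρ` and the alternative `σ`, under the
constraint that the type-1 error is at most `α` and that the test belongs to the class `C`. The
null hypothesis is rejected on the outcome that belongs to `T`. -/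
def optType2 {S : Type} [Fintype S] [DecidableEq S] (C : Set (Fin 2 → Matrix S S ℂ)) (α : ℝ)
    (ρ σ : Matrix S S ℂ) : ℝ :=
  sInf {b : ℝ | ∃ T : Matrix S S ℂ, ![T, 1 - T] ∈ C ∧ (ρ * T).trace.re ≤ α ∧
    b = (σ * (1 - T)).trace.re}

/-- `β_{n,C}(α | Ψ ‖ ρ_mix)`: testing `n` copies of `|Ψ⟩` against `n` copies of the completely mixed
state by two-valued POVMs of the class `C` with respect to the bipartition of
`(ℂ^A)^{⊗ n} ⊗ (ℂ^B)^{⊗ n}`. -/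
def betaErr {A B : Type} [Fintype A] [DecidableEq A] [Fintype B] [DecidableEq B] (n : ℕ)
    (C : Set (Fin 2 → Matrix ((Fin n → A) × (Fin n → B)) ((Fin n → A) × (Fin n → B)) ℂ))
    (α : ℝ) (Ψ : EuclideanSpace ℂ (A × B)) : ℝ :=
  optType2 C α (copies n (pureState Ψ)) (copies n (mixedState A B))

/-! ### Entropic quantities -/

/-- The reduced density operator of `|Ψ⟩` on `ℂ^A`. -/
def reducedState {A B : Type} [Fintype B] (Ψ : EuclideanSpace ℂ (A × B)) : Matrix A A ℂ :=
  fun x x' => ∑ y, pureState Ψ (x, y) (x', y)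

theorem reducedState_isHermitian {A B : Type} [Fintype B] (Ψ : EuclideanSpace ℂ (A × B)) :
    (reducedState Ψ).IsHermitian := by
  ext x x'
  simp [reducedState, pureState, Matrix.vecMulVec_apply, mul_comm]

/-- The squares `λ_i` of the coefficients of the Schmidt decomposition
`Ψ = ∑ i, √λ_i |i⟩ ⊗ |i⟩`, which are the eigenvalues of the reduced density operator. The list is
padded by zeros to length `d_A`; these do not contribute to the sums below. -/
def schmidt {A B : Type} [Fintype A] [DecidableEq A] [Fintype B]
    (Ψ : EuclideanSpace ℂ (A × B)) : A → ℝ :=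
  (reducedState_isHermitian Ψ).eigenvalues

/-- `H_1(Ψ) = - ∑ λ_i log λ_i`, the entropy of entanglement, which is the limit as `s → 0` of the
Rényi entropy `H_{1-s}(Ψ) = s⁻¹ log ∑ λ_i^{1-s}`. -/
def entropyH1 {A B : Type} [Fintype A] [DecidableEq A] [Fintype B]
    (Ψ : EuclideanSpace ℂ (A × B)) : ℝ :=
  ∑ i, Real.negMulLog (schmidt Ψ i)

/-- For a probability vector, the Rényi entropies `H_{1-s}` tend to the expression that defines
`entropyH1` as `s → 0`. -/
theorem renyi_tendsto {ι : Type} [Fintype ι] (p : ι → ℝ) (h0 : ∀ i, 0 ≤ p i)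
    (h1 : ∑ i, p i = 1) :
    Tendsto (fun s : ℝ => Real.log (∑ i, p i ^ (1 - s)) / s) (nhdsWithin 0 {0}ᶜ)
      (nhds (∑ i, Real.negMulLog (p i))) := by
  have hd : HasDerivAt (fun s : ℝ => ∑ i, p i ^ (1 - s)) (∑ i, Real.negMulLog (p i)) 0 := by
    refine HasDerivAt.fun_sum fun i _ => ?_
    rcases (h0 i).eq_or_lt with h | h
    · rw [← h]
      refine HasDerivAt.congr_of_eventuallyEq (f := fun _ => (0 : ℝ)) ?_ ?_
      · simpa using hasDerivAt_const (0 : ℝ) (0 : ℝ)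
      · filter_upwards [Iio_mem_nhds (zero_lt_one' ℝ)] with s hs
        rw [Real.zero_rpow]
        have : s < 1 := hs
        linarith
    · have := ((hasDerivAt_id (0 : ℝ)).const_sub 1).const_rpow h
      simpa [Real.negMulLog, mul_comm] using this
  have hl := hd.log (by simp [h1])
  have ht := hl.tendsto_slope
  simp only [sub_zero, Real.rpow_one, h1, div_one] at ht
  refine ht.congr fun s => ?_
  simp [slope_def_field, h1]

/-- `V(Ψ) = ∑ λ_i (log λ_i + H_1(Ψ))²`. -/
def varianceV {A B : Type} [Fintype A] [DecidableEq A] [Fintype B]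
    (Ψ : EuclideanSpace ℂ (A × B)) : ℝ :=
  ∑ i, schmidt Ψ i * (Real.log (schmidt Ψ i) + entropyH1 Ψ) ^ 2

/-- `Φ⁻¹`, the inverse of the cumulative distribution function `Φ` of the standard normal
distribution. -/
def normalQuantile (ε : ℝ) : ℝ :=
  sInf {x : ℝ | ε ≤ ProbabilityTheory.cdf (ProbabilityTheory.gaussianReal 0 1) x}

/-- `-n (log d_A d_B - H_1(Ψ)) - √n √V(Ψ) Φ⁻¹(ε)`. -/
def secondOrder {A B : Type} [Fintype A] [DecidableEq A] [Fintype B]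
    (Ψ : EuclideanSpace ℂ (A × B)) (ε : ℝ) (n : ℕ) : ℝ :=
  -(n : ℝ) * (Real.log ((Fintype.card A : ℝ) * (Fintype.card B : ℝ)) - entropyH1 Ψ)
    - √(n : ℝ) * √(varianceV Ψ) * normalQuantile ε

end LocalTest

end

open LocalTest

noncomputable section

namespace LocalTest

/-! ### The standard normal distribution -/

/-! For an acceptance operator `S = I - T` the type-2 error is `(d_A d_B)⁻ⁿ Tr S`, so the question
is how small `Tr S` can be when `S` has expectation at least `1 - ε` in `Ψ^{⊗n}`. The squared
Schmidt coefficients of `Ψ^{⊗n}` form a product law, and `τ = logThreshold` is the second order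
approximation to the `ε`-quantile of its logarithm. A Berry–Esseen bound (`berryEsseen`, by Stein's
method) shows that a constant shift of `τ` moves the mass above `e^τ` past `1 - ε` with a margin of
order `1/√n` (`exists_mass_le`, `exists_le_mass`). It also shows that every bounded window of the
log-spectrum has mass `O(1/√n)`. Hence at most `O(e^{-τ}/√n)` coefficients exceed `e^τ`, and their
square roots sum to `O(e^{-τ/2}/√n)` (`card_prodLaw_le`, `sum_sqrt_prodLaw_le`).

Converse. Since `E ⊗ F ≤ (Tr F) E ⊗ 1`, a separable `S` has expectation at most `c Tr S` in a vector
whose squared Schmidt coefficients are at most `c` (`IsSeparableOp.quadForm_le`). Take `c =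
e^{τ+K}`. A one-way test is dominated by a measurement of Alice alone, for which large and small
coefficients contribute additively; the small ones must supply a probability of order `1/√n`, so `Tr
S` is at least of order `e^{-τ}/√n` (`IsLOCC.trace_ge_of_oneWay`). For a general separable test the
two parts of `Ψ^{⊗n}` may interfere, and an expectation of order only `1/n` in the small part can
make up the missing `1/√n`. This leaves the order `e^{-τ}/n` (`trace_ge_of_quadForm_le`), and is
where `-½ log n` turns into `-log n`.

Attainment. Comparing the outcomes of local Schmidt measurements costs one unit of trace per
accepted index, which gives `e^{-τ}/√n` (`exists_oneWay_test`). With two rounds a coherent test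
costs about `(∑ √λ)²`, the square of a quantity of order `e^{-τ/2}/√n`, so the order is `e^{-τ}/n`
(`exists_twoRound_test`). As two-round tests are two-way and separable, the bounds for these three
classes coincide. -/

/-- The standard normal density. -/
def stdPDF (x : ℝ) : ℝ := ProbabilityTheory.gaussianPDFReal 0 1 x

/-- The standard normal cumulative distribution function. -/
def stdCDF (x : ℝ) : ℝ := ProbabilityTheory.cdf (ProbabilityTheory.gaussianReal 0 1) x

theorem stdPDF_eq (x : ℝ) : stdPDF x = (√(2 * Real.pi))⁻¹ * Real.exp (-x ^ 2 / 2) := by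
  simp [stdPDF, ProbabilityTheory.gaussianPDFReal]

theorem stdPDF_pos (x : ℝ) : 0 < stdPDF x :=
  ProbabilityTheory.gaussianPDFReal_pos 0 1 x one_ne_zero

theorem hasDerivAt_stdPDF (x : ℝ) : HasDerivAt stdPDF (-x * stdPDF x) x := by
  have h : HasDerivAt (fun y : ℝ => (√(2 * Real.pi))⁻¹ * Real.exp (-y ^ 2 / 2))
      ((√(2 * Real.pi))⁻¹ * (Real.exp (-x ^ 2 / 2) * (-(2 * x) / 2))) x := by
    refine HasDerivAt.const_mul _ (HasDerivAt.exp ?_)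
    simpa using ((hasDerivAt_pow 2 x).neg.div_const 2)
  have e : stdPDF = fun y : ℝ => (√(2 * Real.pi))⁻¹ * Real.exp (-y ^ 2 / 2) := funext stdPDF_eq
  rw [e]
  convert h using 1
  ring

theorem continuous_stdPDF : Continuous stdPDF :=
  continuous_iff_continuousAt.2 fun x => (hasDerivAt_stdPDF x).continuousAt

theorem integrable_stdPDF : MeasureTheory.Integrable stdPDF :=
  ProbabilityTheory.integrable_gaussianPDFReal 0 1

theorem stdPDF_neg (x : ℝ) : stdPDF (-x) = stdPDF x := by simp [stdPDF_eq]

theorem stdPDF_le_of_sq_le {x y : ℝ} (h : x ^ 2 ≤ y ^ 2) : stdPDF y ≤ stdPDF x := by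
  rw [stdPDF_eq, stdPDF_eq]
  gcongr

theorem stdPDF_le_one (x : ℝ) : stdPDF x ≤ 1 := by
  rw [stdPDF_eq]
  refine mul_le_one₀ ?_ (Real.exp_pos _).le (Real.exp_le_one_iff.2 (by nlinarith [sq_nonneg x]))
  refine inv_le_one_of_one_le₀ (Real.one_le_sqrt.2 ?_)
  nlinarith [Real.pi_gt_three]

theorem stdCDF_eq_integral (x : ℝ) : stdCDF x = ∫ t in Set.Iic x, stdPDF t := by
  rw [stdCDF, ProbabilityTheory.cdf_eq_real, MeasureTheory.measureReal_def,
    ProbabilityTheory.gaussianReal_apply_eq_integral 0 one_ne_zero]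
  exact ENNReal.toReal_ofReal (MeasureTheory.integral_nonneg fun t => (stdPDF_pos t).le)

theorem stdCDF_sub (x y : ℝ) : stdCDF y - stdCDF x = ∫ t in x..y, stdPDF t := by
  rw [stdCDF_eq_integral, stdCDF_eq_integral,
    intervalIntegral.integral_Iic_sub_Iic integrable_stdPDF.integrableOn
      integrable_stdPDF.integrableOn]

theorem hasDerivAt_stdCDF (x : ℝ) : HasDerivAt stdCDF (stdPDF x) x := by
  have e : stdCDF = fun y => stdCDF 0 + ∫ t in (0 : ℝ)..y, stdPDF t := by
    funext y
    rw [← stdCDF_sub]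
    ring
  rw [e]
  refine HasDerivAt.const_add _ ?_
  exact intervalIntegral.integral_hasDerivAt_right (continuous_stdPDF.intervalIntegrable _ _)
    (continuous_stdPDF.stronglyMeasurableAtFilter _ _) continuous_stdPDF.continuousAt

theorem continuous_stdCDF : Continuous stdCDF :=
  continuous_iff_continuousAt.2 fun x => (hasDerivAt_stdCDF x).continuousAt

theorem stdCDF_nonneg (x : ℝ) : 0 ≤ stdCDF x := ProbabilityTheory.cdf_nonneg _ x

theorem stdCDF_le_one (x : ℝ) : stdCDF x ≤ 1 := ProbabilityTheory.cdf_le_one _ x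

theorem monotone_stdCDF : Monotone stdCDF := ProbabilityTheory.monotone_cdf _

theorem stdCDF_neg (x : ℝ) : stdCDF (-x) = 1 - stdCDF x := by
  have h1 : stdCDF (-x) = ∫ t in Set.Ioi x, stdPDF t := by
    rw [stdCDF_eq_integral, ← integral_comp_neg_Ioi]
    simp [stdPDF_neg]
  have h2 : (∫ t in Set.Iic x, stdPDF t) + ∫ t in Set.Ioi x, stdPDF t = 1 := by
    rw [intervalIntegral.integral_Iic_add_Ioi integrable_stdPDF.integrableOn
      integrable_stdPDF.integrableOn]
    exact ProbabilityTheory.integral_gaussianPDFReal_eq_one 0 one_ne_zero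
  rw [h1, stdCDF_eq_integral]
  linarith

theorem stdCDF_sub_le {x y : ℝ} (h : x ≤ y) : stdCDF y - stdCDF x ≤ y - x := by
  have := Convex.norm_image_sub_le_of_norm_hasDerivWithin_le (C := 1) (s := Set.univ)
    (f := stdCDF) (f' := stdPDF) (x := x) (y := y)
    (fun x _ => (hasDerivAt_stdCDF x).hasDerivWithinAt)
    (fun x _ => by rw [Real.norm_eq_abs, abs_of_pos (stdPDF_pos x)]; exact stdPDF_le_one x)
    convex_univ trivial trivial
  rw [Real.norm_eq_abs, Real.norm_eq_abs, abs_of_nonneg (sub_nonneg.2 h), one_mul] at this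
  exact (le_abs_self _).trans this

/-- Mills' bound for the lower tail. -/
theorem neg_mul_stdCDF_le (x : ℝ) : -x * stdCDF x ≤ stdPDF x := by
  have htend : Tendsto stdPDF atBot (nhds 0) := by
    have : Tendsto (fun y : ℝ => (√(2 * Real.pi))⁻¹ * Real.exp (-y ^ 2 / 2)) atBot
        (nhds ((√(2 * Real.pi))⁻¹ * 0)) := by
      refine Tendsto.const_mul _ (Real.tendsto_exp_atBot.comp ?_)
      have h1 : Tendsto (fun y : ℝ => y ^ 2) atBot atTop := by
        have h0 := (tendsto_pow_atTop (α := ℝ) two_ne_zero).comp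
          (tendsto_abs_atBot_atTop (G := ℝ))
        exact h0.congr fun y => sq_abs y
      have h2 : Tendsto (fun y : ℝ => y ^ 2 / 2) atBot atTop := h1.atTop_div_const two_pos
      refine (tendsto_neg_atTop_atBot.comp h2).congr fun y => ?_
      simp [neg_div]
    rw [mul_zero] at this
    exact this.congr fun y => (stdPDF_eq y).symm
  rcases le_or_gt 0 x with hx | hx
  · nlinarith [stdCDF_nonneg x, (stdPDF_pos x).le, mul_nonneg hx (stdCDF_nonneg x)]
  -- For `t ≤ x` the function `φ(t) + x Φ(t)` has derivative `(x - t) φ(t) ≥ 0`. The limit `y → -∞`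
  -- of the resulting inequality is the claim.
  have key : ∀ y ≤ x, -x * (stdCDF x - stdCDF y) ≤ stdPDF x - stdPDF y := by
    intro y hy
    have hm : MonotoneOn (fun t => stdPDF t + x * stdCDF t) (Set.Icc y x) := by
      refine monotoneOn_of_deriv_nonneg (convex_Icc _ _) ?_ ?_ ?_
      · exact (continuous_stdPDF.add (continuous_const.mul continuous_stdCDF)).continuousOn
      · intro t _
        exact ((hasDerivAt_stdPDF t).add
          ((hasDerivAt_stdCDF t).const_mul x)).differentiableAt.differentiableWithinAt
      · intro t ht
        rw [interior_Icc] at ht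
        have hd := ((hasDerivAt_stdPDF t).add ((hasDerivAt_stdCDF t).const_mul x)).deriv
        change 0 ≤ deriv (stdPDF + fun t => x * stdCDF t) t
        rw [hd]
        nlinarith [stdPDF_pos t, ht.2]
    have := hm (Set.left_mem_Icc.2 hy) (Set.right_mem_Icc.2 hy) hy
    simp only at this
    linarith
  have ht : Tendsto stdCDF atBot (nhds 0) := ProbabilityTheory.tendsto_cdf_atBot _
  have hl := le_of_tendsto_of_tendsto ((ht.const_sub (stdCDF x)).const_mul (-x))
    (htend.const_sub (stdPDF x)) ((eventually_le_atBot x).mono key)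
  simpa using hl

/-- Mills' bound for the upper tail. -/
theorem mul_one_sub_stdCDF_le (x : ℝ) : x * (1 - stdCDF x) ≤ stdPDF x := by
  have := neg_mul_stdCDF_le (-x)
  rwa [stdCDF_neg, stdPDF_neg, neg_neg] at this

/-- A value in `(0, 1)` is attained by the normal distribution function at its quantile. -/
theorem stdCDF_normalQuantile {ε : ℝ} (h0 : 0 < ε) (h1 : ε < 1) :
    stdCDF (normalQuantile ε) = ε := by
  have hb : Tendsto stdCDF atBot (nhds 0) := ProbabilityTheory.tendsto_cdf_atBot _
  have ht : Tendsto stdCDF atTop (nhds 1) := ProbabilityTheory.tendsto_cdf_atTop _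
  obtain ⟨a, ha⟩ := (hb.eventually (gt_mem_nhds h0)).exists
  obtain ⟨b, hb'⟩ := (ht.eventually (lt_mem_nhds h1)).exists
  have hbdd : BddBelow {x : ℝ | ε ≤ stdCDF x} := by
    refine ⟨a, fun x hx => ?_⟩
    by_contra hlt
    push Not at hlt
    exact absurd (hx.trans (monotone_stdCDF hlt.le)) (not_le.2 ha)
  have hcl : IsClosed {x : ℝ | ε ≤ stdCDF x} := isClosed_le continuous_const continuous_stdCDF
  have hmem : normalQuantile ε ∈ {x : ℝ | ε ≤ stdCDF x} := hcl.csInf_mem ⟨b, hb'.le⟩ hbdd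
  refine le_antisymm ?_ hmem
  by_contra hlt
  push Not at hlt
  have hn : ∀ᶠ y in nhds (normalQuantile ε), ε < stdCDF y :=
    continuous_stdCDF.continuousAt.eventually (lt_mem_nhds hlt)
  obtain ⟨y, hy, hy'⟩ := ((hn.filter_mono nhdsWithin_le_nhds).and
    (self_mem_nhdsWithin (s := Set.Iio (normalQuantile ε)))).exists
  exact absurd (csInf_le hbdd (show y ∈ {x : ℝ | ε ≤ stdCDF x} from hy.le)) (not_le.2 hy')

/-- Lower bound for the increment of the normal distribution function over a short interval. -/
theorem stdCDF_sub_ge (q : ℝ) {x y : ℝ} (hx : q - 1 ≤ x) (hy : y ≤ q + 1) (hxy : x ≤ y) :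
    stdPDF (|q| + 1) * (y - x) ≤ stdCDF y - stdCDF x := by
  rw [stdCDF_sub, ← smul_eq_mul, smul_eq_mul, mul_comm, ← smul_eq_mul,
    ← intervalIntegral.integral_const]
  -- The density decreases in `|t|`, and `|t| ≤ |q| + 1` on the whole interval.
  refine intervalIntegral.integral_mono_on hxy (by simp)
    (continuous_stdPDF.intervalIntegrable _ _) fun t ht => stdPDF_le_of_sq_le ?_
  refine sq_le_sq.2 ?_
  rw [abs_of_nonneg (by positivity : 0 ≤ |q| + 1)]
  refine abs_le.2 ⟨?_, ?_⟩
  · linarith [neg_abs_le q, ht.1]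
  · linarith [le_abs_self q, ht.2]

/-! ### Stein's equation -/

/-- The bounded solution of Stein's equation `f' w - w f w = 1{w ≤ z} - Φ z`. -/
def steinSol (z w : ℝ) : ℝ := (stdCDF (min w z) - stdCDF w * stdCDF z) / stdPDF w

/-- The indicator of `(-∞, z]`. -/
def indIic (z w : ℝ) : ℝ := if w ≤ z then 1 else 0

theorem indIic_nonneg (z w : ℝ) : 0 ≤ indIic z w := by unfold indIic; split_ifs <;> norm_num

theorem indIic_le_one (z w : ℝ) : indIic z w ≤ 1 := by unfold indIic; split_ifs <;> norm_num

theorem indIic_le_indIic {z z' w w' : ℝ} (h : w ≤ z → w' ≤ z') : indIic z w ≤ indIic z' w' := by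
  unfold indIic
  split_ifs with h1 h2
  · exact le_rfl
  · exact absurd (h h1) h2
  · exact zero_le_one
  · exact le_rfl

/-- The numerator of the solution of Stein's equation lies between `0` and both tails. -/
theorem steinSol_num (z w : ℝ) :
    0 ≤ stdCDF (min w z) - stdCDF w * stdCDF z ∧
      stdCDF (min w z) - stdCDF w * stdCDF z ≤ stdCDF w ∧
      stdCDF (min w z) - stdCDF w * stdCDF z ≤ 1 - stdCDF w := by
  have a := stdCDF_nonneg w
  have b := stdCDF_nonneg z
  have a1 := stdCDF_le_one w
  have b1 := stdCDF_le_one z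
  rcases le_total w z with h | h
  · have := monotone_stdCDF h
    rw [min_eq_left h]
    refine ⟨by nlinarith, by nlinarith, by nlinarith⟩
  · have := monotone_stdCDF h
    rw [min_eq_right h]
    refine ⟨by nlinarith, by nlinarith, by nlinarith⟩

theorem steinSol_nonneg (z w : ℝ) : 0 ≤ steinSol z w :=
  div_nonneg (steinSol_num z w).1 (stdPDF_pos w).le

/-- The numerator is below both tails at `w`; Mills' bound for the tail on the side of `w` cancels
the density in the denominator. -/
theorem abs_mul_steinSol_le (z w : ℝ) : |w * steinSol z w| ≤ 1 := by
  obtain ⟨h0, h1, h2⟩ := steinSol_num z w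
  have hp := stdPDF_pos w
  rw [abs_mul, abs_of_nonneg (steinSol_nonneg z w), steinSol, ← mul_div_assoc, div_le_one hp]
  rcases le_total 0 w with h | h
  · rw [abs_of_nonneg h]
    exact (mul_le_mul_of_nonneg_left h2 h).trans (mul_one_sub_stdCDF_le w)
  · rw [abs_of_nonpos h]
    exact (mul_le_mul_of_nonneg_left h1 (by linarith)).trans (neg_mul_stdCDF_le w)

/-- For `|w| ≥ 1` the bound on `w f(w)` is enough; for `|w| ≤ 1` the denominator is at least `φ(1)`.
-/
theorem abs_steinSol_le (z w : ℝ) : |steinSol z w| ≤ (stdPDF 1)⁻¹ := by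
  rcases le_total 1 |w| with h | h
  · have h1 := abs_mul_steinSol_le z w
    rw [abs_mul] at h1
    have h2 : |steinSol z w| ≤ 1 := by nlinarith [abs_nonneg (steinSol z w)]
    exact h2.trans ((one_le_inv₀ (stdPDF_pos 1)).2 (stdPDF_le_one 1))
  · obtain ⟨h0, h1, _⟩ := steinSol_num z w
    have hle : stdPDF 1 ≤ stdPDF w := stdPDF_le_of_sq_le (sq_le_sq.2 (by simpa using h))
    rw [abs_of_nonneg (steinSol_nonneg z w), steinSol, div_eq_mul_inv]
    calc _ ≤ 1 * (stdPDF w)⁻¹ :=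
          mul_le_mul_of_nonneg_right (h1.trans (stdCDF_le_one w)) (inv_nonneg.2 (stdPDF_pos w).le)
      _ ≤ (stdPDF 1)⁻¹ := by
          rw [one_mul]
          exact inv_anti₀ (stdPDF_pos 1) hle

theorem continuous_steinSol (z : ℝ) : Continuous (steinSol z) := by
  refine Continuous.div ?_ continuous_stdPDF fun w => (stdPDF_pos w).ne'
  exact (continuous_stdCDF.comp (continuous_id.min continuous_const)).sub
    (continuous_stdCDF.mul continuous_const)

/-- This is Stein's equation. The point `z` is excluded because of the kink of `min w z`; one point
does not affect integrals. -/
theorem hasDerivAt_steinSol {z w : ℝ} (h : w ≠ z) :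
    HasDerivAt (steinSol z) (w * steinSol z w + indIic z w - stdCDF z) w := by
  have hp := stdPDF_pos w
  have hnum : HasDerivAt (fun w => stdCDF (min w z) - stdCDF w * stdCDF z)
      (indIic z w * stdPDF w - stdPDF w * stdCDF z) w := by
    refine HasDerivAt.sub ?_ ((hasDerivAt_stdCDF w).mul_const _)
    rcases lt_or_gt_of_ne h with hlt | hlt
    · rw [indIic, if_pos hlt.le, one_mul]
      refine (hasDerivAt_stdCDF w).congr_of_eventuallyEq ?_
      filter_upwards [Iio_mem_nhds hlt] with y hy
      rw [min_eq_left (le_of_lt hy)]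
    · rw [indIic, if_neg (not_le.2 hlt), zero_mul]
      refine (hasDerivAt_const w (stdCDF z)).congr_of_eventuallyEq ?_
      filter_upwards [Ioi_mem_nhds hlt] with y hy
      rw [min_eq_right (le_of_lt hy)]
  have := hnum.div (hasDerivAt_stdPDF w) hp.ne'
  refine this.congr_deriv ?_
  rw [steinSol]
  field_simp
  ring

/-- The right hand side of Stein's equation. -/
def steinDer (z w : ℝ) : ℝ := w * steinSol z w + indIic z w - stdCDF z

theorem intervalIntegrable_steinDer (z a b : ℝ) :
    IntervalIntegrable (steinDer z) MeasureTheory.volume a b := by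
  refine (IntervalIntegrable.add ?_ ?_).sub (by simp)
  · exact (continuous_id.mul (continuous_steinSol z)).intervalIntegrable _ _
  · have : Antitone (indIic z) := fun x y h => indIic_le_indIic fun h' => h.trans h'
    exact this.intervalIntegrable

theorem steinSol_sub (z a b : ℝ) : ∫ t in a..b, steinDer z t = steinSol z b - steinSol z a :=
  MeasureTheory.integral_eq_of_hasDerivAt_off_countable (steinSol z) (steinDer z)
    (Set.countable_singleton z) (continuous_steinSol z).continuousOn
    (fun _ hx => hasDerivAt_steinSol hx.2) (intervalIntegrable_steinDer z a b)

theorem abs_steinDer_le (z w : ℝ) : |steinDer z w| ≤ 2 := by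
  have h1 := abs_le.1 (abs_mul_steinSol_le z w)
  have h2 := indIic_nonneg z w
  have h3 := indIic_le_one z w
  have h4 := stdCDF_nonneg z
  have h5 := stdCDF_le_one z
  exact abs_le.2 ⟨by unfold steinDer; linarith, by unfold steinDer; linarith⟩

theorem abs_steinSol_sub_le (z a b : ℝ) : |steinSol z b - steinSol z a| ≤ 2 * |b - a| := by
  rw [← steinSol_sub, ← Real.norm_eq_abs]
  refine intervalIntegral.norm_integral_le_of_norm_le_const fun t _ => ?_
  rw [Real.norm_eq_abs]
  exact abs_steinDer_le z t

/-- A local modulus of continuity for the term `w f(w)` of Stein's equation. Its linear growth in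
`|w|` is harmless because only a first absolute moment is needed to integrate it. -/
theorem abs_mul_steinSol_sub_le (z w t : ℝ) {b : ℝ} (h : |t - w| ≤ b) :
    |t * steinSol z t - w * steinSol z w| ≤ b * ((stdPDF 1)⁻¹ + 2 * |w|) := by
  have e : t * steinSol z t - w * steinSol z w =
      (t - w) * steinSol z t + w * (steinSol z t - steinSol z w) := by ring
  rw [e]
  refine (abs_add_le _ _).trans ?_
  rw [abs_mul, abs_mul]
  have h1 := abs_steinSol_le z t
  have h2 := abs_steinSol_sub_le z w t
  have h3 : |t - w| * |steinSol z t| ≤ b * (stdPDF 1)⁻¹ :=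
    mul_le_mul h h1 (abs_nonneg _) ((abs_nonneg _).trans h)
  have h4 : |w| * |steinSol z t - steinSol z w| ≤ |w| * (2 * b) :=
    mul_le_mul_of_nonneg_left (h2.trans (by linarith)) (abs_nonneg _)
  linarith

/-- Averages over an interval starting at `w`, weighted by its signed length, lie between the
extreme values. -/
theorem mul_integral_ge {h : ℝ → ℝ} {w a m : ℝ}
    (hi : IntervalIntegrable h MeasureTheory.volume w (w + a))
    (hm : ∀ t, |t - w| ≤ |a| → m ≤ h t) :
    a ^ 2 * m ≤ a * ∫ t in w..(w + a), h t := by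
  rcases le_total 0 a with ha | ha
  · have h1 : ∫ t in w..(w + a), m ≤ ∫ t in w..(w + a), h t := by
      refine intervalIntegral.integral_mono_on (by linarith) (by simp) hi fun t ht => hm t ?_
      rw [abs_of_nonneg ha]
      exact abs_le.2 ⟨by linarith [ht.1], by linarith [ht.2]⟩
    rw [intervalIntegral.integral_const, smul_eq_mul] at h1
    nlinarith
  · have h1 : ∫ t in (w + a)..w, m ≤ ∫ t in (w + a)..w, h t := by
      refine intervalIntegral.integral_mono_on (by linarith) (by simp) hi.symm fun t ht => hm t ?_
      rw [abs_of_nonpos ha]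
      exact abs_le.2 ⟨by linarith [ht.1], by linarith [ht.2]⟩
    rw [intervalIntegral.integral_const, smul_eq_mul] at h1
    rw [intervalIntegral.integral_symm]
    nlinarith

/-! ### Sums of independent identically distributed variables -/

section IID

variable {ι : Type} [Fintype ι]

/-- The expectation of `h (x s₁ + ⋯ + x sₙ)` for independent `s₁, …, sₙ` with the law `p`. -/
def iidExp (p x : ι → ℝ) (n : ℕ) (h : ℝ → ℝ) : ℝ :=
  ∑ s : Fin n → ι, (∏ k, p (s k)) * h (∑ k, x (s k))

variable {p x : ι → ℝ}

theorem iidExp_zero (h : ℝ → ℝ) : iidExp p x 0 h = h 0 := by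
  simp [iidExp]

theorem iidExp_succ (n : ℕ) (h : ℝ → ℝ) :
    iidExp p x (n + 1) h = ∑ a, p a * iidExp p x n fun w => h (w + x a) := by
  rw [iidExp, ← (Fin.consEquiv fun _ => ι).sum_comp, Fintype.sum_prod_type]
  refine Finset.sum_congr rfl fun a _ => ?_
  rw [iidExp, Finset.mul_sum]
  refine Finset.sum_congr rfl fun s _ => ?_
  simp [Fin.consEquiv, Fin.prod_univ_succ, Fin.sum_univ_succ, mul_assoc, add_comm]

theorem iidExp_mono (hp : ∀ a, 0 ≤ p a) (n : ℕ) {h h' : ℝ → ℝ} (hh : ∀ w, h w ≤ h' w) :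
    iidExp p x n h ≤ iidExp p x n h' :=
  Finset.sum_le_sum fun s _ =>
    mul_le_mul_of_nonneg_left (hh _) (Finset.prod_nonneg fun k _ => hp (s k))

theorem iidExp_add (n : ℕ) (h h' : ℝ → ℝ) :
    iidExp p x n (fun w => h w + h' w) = iidExp p x n h + iidExp p x n h' := by
  simp [iidExp, mul_add, Finset.sum_add_distrib]

theorem iidExp_sub (n : ℕ) (h h' : ℝ → ℝ) :
    iidExp p x n (fun w => h w - h' w) = iidExp p x n h - iidExp p x n h' := by
  simp [iidExp, mul_sub, Finset.sum_sub_distrib]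

theorem iidExp_const_mul (n : ℕ) (c : ℝ) (h : ℝ → ℝ) :
    iidExp p x n (fun w => c * h w) = c * iidExp p x n h := by
  simp only [iidExp, Finset.mul_sum]
  exact Finset.sum_congr rfl fun s _ => by ring

theorem iidExp_const (h1 : ∑ a, p a = 1) (n : ℕ) (c : ℝ) : iidExp p x n (fun _ => c) = c := by
  induction n with
  | zero => rw [iidExp_zero]
  | succ n ih => rw [iidExp_succ, ← Finset.sum_mul, ih, h1, one_mul]

/-- Exchangeability: in `E[W f(W)]` every summand of `W` contributes equally. -/
theorem iidExp_mul_succ (n : ℕ) (f : ℝ → ℝ) :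
    iidExp p x (n + 1) (fun w => w * f w) =
      (n + 1) * ∑ a, p a * (x a * iidExp p x n fun w => f (w + x a)) := by
  induction n generalizing f with
  | zero =>
    rw [iidExp_succ]
    simp [iidExp_zero]
  | succ n ih =>
    rw [iidExp_succ]
    -- With one variable fixed at `a`, the induction hypothesis handles the sum of the others,
    -- applied to the shifted function `f(· + x a)`.
    have e1 : ∀ a, (iidExp p x (n + 1) fun w => (w + x a) * f (w + x a)) =
        (n + 1) * (∑ b, p b * (x b * iidExp p x n fun w => f (w + x b + x a))) +
          x a * iidExp p x (n + 1) fun w => f (w + x a) := by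
      intro a
      rw [← ih fun w => f (w + x a), ← iidExp_const_mul, ← iidExp_add]
      simp only [add_mul]
    simp only [e1]
    have e2 : ∀ b, (iidExp p x (n + 1) fun w => f (w + x b)) =
        ∑ a, p a * iidExp p x n fun w => f (w + x b + x a) := by
      intro b
      rw [iidExp_succ]
      refine Finset.sum_congr rfl fun a _ => ?_
      congr 2
      funext w
      ring_nf
    -- Interchanging the two singled-out variables makes these `n + 1` contributions equal to the
    -- remaining one.
    have e3 : ∑ a, p a * ((n + 1 : ℝ) * ∑ b, p b * (x b * iidExp p x n fun w => f (w + x b + x a)))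
        = (n + 1) * ∑ b, p b * (x b * iidExp p x (n + 1) fun w => f (w + x b)) := by
      simp only [e2, Finset.mul_sum]
      rw [Finset.sum_comm]
      exact Finset.sum_congr rfl fun b _ => Finset.sum_congr rfl fun a _ => by ring
    simp only [mul_add, Finset.sum_add_distrib]
    rw [e3]
    push_cast
    ring

theorem iidExp_id (h1 : ∑ a, p a = 1) (hx : ∑ a, p a * x a = 0) (n : ℕ) :
    iidExp p x n (fun w => w) = 0 := by
  induction n with
  | zero => rw [iidExp_zero]
  | succ n ih =>
    rw [iidExp_succ]
    simp only [iidExp_add, ih, iidExp_const h1, zero_add, hx]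

theorem iidExp_sq (h1 : ∑ a, p a = 1) (hx : ∑ a, p a * x a = 0) (n : ℕ) :
    iidExp p x n (fun w => w * w) = n * ∑ a, p a * x a ^ 2 := by
  cases n with
  | zero => simp [iidExp_zero]
  | succ n =>
    rw [iidExp_mul_succ n fun w => w]
    simp only [iidExp_add, iidExp_id h1 hx, iidExp_const h1, zero_add]
    push_cast
    simp [pow_two]

theorem iidExp_abs_le_one (hp : ∀ a, 0 ≤ p a) (h1 : ∑ a, p a = 1) (hx : ∑ a, p a * x a = 0)
    (n : ℕ) (hv : n * ∑ a, p a * x a ^ 2 ≤ 1) : iidExp p x n (fun w => |w|) ≤ 1 := by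
  have h : iidExp p x n (fun w => |w|) ≤
      iidExp p x n (fun w => (1 / 2 : ℝ) + (1 / 2 : ℝ) * (w * w)) := by
    refine iidExp_mono hp n fun w => ?_
    nlinarith [sq_nonneg (|w| - 1), abs_mul_abs_self w]
  rw [iidExp_add n (fun _ => (1 / 2 : ℝ)) fun w => (1 / 2 : ℝ) * (w * w), iidExp_const h1,
    iidExp_const_mul n _ fun w => w * w, iidExp_sq h1 hx] at h
  linarith

/-- The constant of the Berry–Esseen bound. -/
def berryConst : ℝ := 2 * ((stdPDF 1)⁻¹ + 2) + 2

/-- The Berry–Esseen bound for bounded variables, by Stein's method. -/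
theorem berryEsseen (hp : ∀ a, 0 ≤ p a) (h1 : ∑ a, p a = 1) (hx : ∑ a, p a * x a = 0)
    {n : ℕ} (hn : 0 < n) (hv : n * ∑ a, p a * x a ^ 2 = 1) {b : ℝ} (hb : ∀ a, |x a| ≤ b) (z : ℝ) :
    |iidExp p x n (indIic z) - stdCDF z| ≤ berryConst * b := by
  -- From here on there are `n + 1` summands, and `iidExp p x n` refers to the sum with one of them
  -- left out.
  obtain ⟨n, rfl⟩ := Nat.exists_eq_add_of_lt hn
  rw [zero_add] at hv ⊢
  have hb0 : 0 ≤ b := by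
    by_contra hneg
    push Not at hneg
    have : ∑ a, p a = 0 := Finset.sum_eq_zero fun a _ =>
      absurd ((abs_nonneg _).trans (hb a)) (not_le.2 hneg)
    linarith
  set C : ℝ := (stdPDF 1)⁻¹ with hC
  set g : ℝ → ℝ → ℝ := fun z w => w * steinSol z w with hg
  have hσ : 0 ≤ ∑ a, p a * x a ^ 2 :=
    Finset.sum_nonneg fun a _ => mul_nonneg (hp a) (sq_nonneg _)
  push_cast at hv
  have habs : iidExp p x n (fun w => |w|) ≤ 1 :=
    iidExp_abs_le_one hp h1 hx n (by nlinarith)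
  have hrem : iidExp p x n (fun w => b * (C + 2 * |w|)) ≤ b * (C + 2) := by
    rw [iidExp_const_mul n b fun w => C + 2 * |w|, iidExp_add n (fun _ => C) fun w => 2 * |w|,
      iidExp_const h1, iidExp_const_mul n 2 fun w => |w|]
    exact mul_le_mul_of_nonneg_left (by linarith) hb0
  have hgu : ∀ z, iidExp p x (n + 1) (g z) ≤ iidExp p x n (g z) + b * (C + 2) ∧
      iidExp p x n (g z) - b * (C + 2) ≤ iidExp p x (n + 1) (g z) := by
    intro z
    have hpt : ∀ a w, |g z (w + x a) - g z w| ≤ b * (C + 2 * |w|) := fun a w =>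
      abs_mul_steinSol_sub_le z w (w + x a) (by simpa using hb a)
    have hs : ∀ c : ℝ, ∑ a, p a * c = c := fun c => by rw [← Finset.sum_mul, h1, one_mul]
    rw [iidExp_succ]
    constructor
    · rw [← hs (iidExp p x n (g z) + b * (C + 2))]
      refine Finset.sum_le_sum fun a _ => mul_le_mul_of_nonneg_left ?_ (hp a)
      have : iidExp p x n (fun w => g z (w + x a)) ≤
          iidExp p x n (fun w => g z w + b * (C + 2 * |w|)) :=
        iidExp_mono hp n fun w => by linarith [(abs_le.1 (hpt a w)).2]
      rw [iidExp_add n (g z)] at this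
      linarith
    · rw [← hs (iidExp p x n (g z) - b * (C + 2))]
      refine Finset.sum_le_sum fun a _ => mul_le_mul_of_nonneg_left ?_ (hp a)
      have : iidExp p x n (fun w => g z w - b * (C + 2 * |w|)) ≤
          iidExp p x n (fun w => g z (w + x a)) :=
        iidExp_mono hp n fun w => by linarith [(abs_le.1 (hpt a w)).1]
      rw [iidExp_sub n (g z)] at this
      linarith
  -- By exchangeability `E[W f(W)]` is `n + 1` times `E[x_a f(W' + x_a)]`, with `W'` the sum of the
  -- others. As `x_a` is centred and independent of `W'`, `f(W')` may be subtracted, which leaves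
  -- the integral of `f'`.
  have hstein : ∀ z, iidExp p x (n + 1) (g z) =
      (n + 1) * ∑ a, p a * iidExp p x n fun w => x a * ∫ t in w..(w + x a), steinDer z t := by
    intro z
    have e : ∀ a, (iidExp p x n fun w => x a * ∫ t in w..(w + x a), steinDer z t) =
        x a * (iidExp p x n fun w => steinSol z (w + x a)) - x a * iidExp p x n (steinSol z) := by
      intro a
      simp only [steinSol_sub]
      rw [iidExp_const_mul n (x a) fun w => steinSol z (w + x a) - steinSol z w,
        iidExp_sub n (fun w => steinSol z (w + x a)), mul_sub]
    have e0 : ∑ a, p a * (x a * iidExp p x n (steinSol z)) = 0 := by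
      simp only [← mul_assoc]
      rw [← Finset.sum_mul, hx, zero_mul]
    rw [iidExp_mul_succ n (steinSol z)]
    simp only [e, mul_sub, Finset.sum_sub_distrib, e0, sub_zero]
  have hav : ∀ c : ℝ, (n + 1 : ℝ) * ∑ a, p a * (x a ^ 2 * c) = c := by
    intro c
    simp only [← mul_assoc]
    rw [← Finset.sum_mul, ← mul_assoc, hv, one_mul]
  -- On the interval between `W'` and `W' + x_a`, of length at most `b`, the indicator at `z` is at
  -- least the indicator of `W' ≤ z - b`. Since `(n + 1) E[x_a²] = 1`, the `g` terms on the two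
  -- sides cancel up to `2b(C + 2)`. Keeping the distribution of `W'` avoids a separate
  -- concentration inequality.
  have hlow : ∀ z, iidExp p x n (indIic (z - b)) - stdCDF z ≤ 2 * (b * (C + 2)) := by
    intro z
    have : iidExp p x n (g z) - b * (C + 2) + iidExp p x n (indIic (z - b)) - stdCDF z ≤
        iidExp p x (n + 1) (g z) := by
      rw [hstein z, ← hav (iidExp p x n (g z) - b * (C + 2) + iidExp p x n (indIic (z - b))
        - stdCDF z)]
      refine mul_le_mul_of_nonneg_left ?_ (by positivity)
      refine Finset.sum_le_sum fun a _ => mul_le_mul_of_nonneg_left ?_ (hp a)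
      have hm : iidExp p x n (fun w => x a ^ 2 * (g z w - b * (C + 2 * |w|) + indIic (z - b) w
          - stdCDF z)) ≤ iidExp p x n fun w => x a * ∫ t in w..(w + x a), steinDer z t := by
        refine iidExp_mono hp n fun w => mul_integral_ge (intervalIntegrable_steinDer z _ _) ?_
        intro t ht
        have ht' := ht.trans (hb a)
        have i1 := (abs_le.1 (abs_mul_steinSol_sub_le z w t ht')).1
        have i2 : indIic (z - b) w ≤ indIic z t :=
          indIic_le_indIic fun h => by linarith [(abs_le.1 ht').2]
        simp only [hg, steinDer]
        linarith
      refine le_trans ?_ hm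
      rw [iidExp_const_mul n (x a ^ 2) fun w => g z w - b * (C + 2 * |w|) + indIic (z - b) w
        - stdCDF z, iidExp_sub n (fun w => g z w - b * (C + 2 * |w|) + indIic (z - b) w),
        iidExp_add n (fun w => g z w - b * (C + 2 * |w|)), iidExp_sub n (g z), iidExp_const h1]
      exact mul_le_mul_of_nonneg_left (by linarith) (sq_nonneg _)
    linarith [(hgu z).1]
  have hupp : ∀ z, stdCDF z - iidExp p x n (indIic (z + b)) ≤ 2 * (b * (C + 2)) := by
    intro z
    have : iidExp p x (n + 1) (g z) ≤
        iidExp p x n (g z) + b * (C + 2) + iidExp p x n (indIic (z + b)) - stdCDF z := by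
      rw [hstein z, ← hav (iidExp p x n (g z) + b * (C + 2) + iidExp p x n (indIic (z + b))
        - stdCDF z)]
      refine mul_le_mul_of_nonneg_left ?_ (by positivity)
      refine Finset.sum_le_sum fun a _ => mul_le_mul_of_nonneg_left ?_ (hp a)
      have hm : (iidExp p x n fun w => x a * ∫ t in w..(w + x a), steinDer z t) ≤
          iidExp p x n (fun w => x a ^ 2 * (g z w + b * (C + 2 * |w|) + indIic (z + b) w
            - stdCDF z)) := by
        refine iidExp_mono hp n fun w => ?_
        have := mul_integral_ge (w := w) (a := x a)
          (m := -(g z w + b * (C + 2 * |w|) + indIic (z + b) w - stdCDF z))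
          (intervalIntegrable_steinDer z w (w + x a)).neg ?_
        · simp only [Pi.neg_apply, intervalIntegral.integral_neg] at this
          linarith
        intro t ht
        have ht' := ht.trans (hb a)
        have i1 := (abs_le.1 (abs_mul_steinSol_sub_le z w t ht')).2
        have i2 : indIic z t ≤ indIic (z + b) w :=
          indIic_le_indIic fun h => by linarith [(abs_le.1 ht').1]
        simp only [hg, steinDer, Pi.neg_apply]
        linarith
      refine hm.trans ?_
      rw [iidExp_const_mul n (x a ^ 2) fun w => g z w + b * (C + 2 * |w|) + indIic (z + b) w
        - stdCDF z, iidExp_sub n (fun w => g z w + b * (C + 2 * |w|) + indIic (z + b) w),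
        iidExp_add n (fun w => g z w + b * (C + 2 * |w|)), iidExp_add n (g z), iidExp_const h1]
      exact mul_le_mul_of_nonneg_left (by linarith) (sq_nonneg _)
    linarith [(hgu z).2]
  have hs : ∀ c : ℝ, ∑ a, p a * c = c := fun c => by rw [← Finset.sum_mul, h1, one_mul]
  -- Restoring the omitted summand moves the threshold by another `b`. The total shift `2b` costs at
  -- most `2b` in `Φ`, the final `+ 2` in `berryConst`.
  have hstep1 : iidExp p x (n + 1) (indIic z) ≤ iidExp p x n (indIic (z + 2 * b - b)) := by
    rw [iidExp_succ, ← hs (iidExp p x n (indIic (z + 2 * b - b)))]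
    refine Finset.sum_le_sum fun a _ => mul_le_mul_of_nonneg_left ?_ (hp a)
    exact iidExp_mono hp n fun w => indIic_le_indIic fun h => by linarith [(abs_le.1 (hb a)).1]
  have hstep2 : iidExp p x n (indIic (z - 2 * b + b)) ≤ iidExp p x (n + 1) (indIic z) := by
    rw [iidExp_succ, ← hs (iidExp p x n (indIic (z - 2 * b + b)))]
    refine Finset.sum_le_sum fun a _ => mul_le_mul_of_nonneg_left ?_ (hp a)
    exact iidExp_mono hp n fun w => indIic_le_indIic fun h => by linarith [(abs_le.1 (hb a)).2]
  have l1 := hlow (z + 2 * b)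
  have l2 := hupp (z - 2 * b)
  have c1 := stdCDF_sub_le (x := z) (y := z + 2 * b) (by linarith)
  have c2 := stdCDF_sub_le (x := z - 2 * b) (y := z) (by linarith)
  rw [berryConst, ← hC]
  exact abs_le.2 ⟨by linarith, by linarith⟩

end IID

/-! ### Spectra of product distributions -/

section Spectrum

variable {ι : Type}

/-- The product distribution. -/
def prodLaw (p : ι → ℝ) {n : ℕ} (s : Fin n → ι) : ℝ := ∏ k, p (s k)

theorem prodLaw_nonneg {p : ι → ℝ} (hp : ∀ a, 0 ≤ p a) {n : ℕ} (s : Fin n → ι) :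
    0 ≤ prodLaw p s :=
  Finset.prod_nonneg fun k _ => hp (s k)

theorem log_prodLaw {p : ι → ℝ} {n : ℕ} {s : Fin n → ι} (hs : prodLaw p s ≠ 0) :
    ∑ k, Real.log (p (s k)) = Real.log (prodLaw p s) := by
  rw [prodLaw, Real.log_prod]
  intro k _ h0
  exact hs (Finset.prod_eq_zero (Finset.mem_univ k) h0)

variable [Fintype ι]

/-- The Shannon entropy. -/
def shannon (p : ι → ℝ) : ℝ := ∑ a, Real.negMulLog (p a)

/-- The varentropy. -/
def varentropy (p : ι → ℝ) : ℝ := ∑ a, p a * (Real.log (p a) + shannon p) ^ 2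

variable {p : ι → ℝ}

theorem sum_prodLaw (h1 : ∑ a, p a = 1) (n : ℕ) : ∑ s : Fin n → ι, prodLaw p s = 1 := by
  have := iidExp_const (x := p) h1 n 1
  simpa [iidExp, prodLaw] using this

/-- The central limit theorem with a rate for the logarithm of a product distribution. -/
theorem abs_iidExp_log_sub_le (hp : ∀ a, 0 ≤ p a) (h1 : ∑ a, p a = 1) (hV : 0 < varentropy p) :
    ∃ C : ℝ, 0 ≤ C ∧ ∀ n : ℕ, 0 < n → ∀ z : ℝ,
      |iidExp p (fun a => Real.log (p a)) n
        (indIic (-(n * shannon p) + √n * √(varentropy p) * z)) - stdCDF z| ≤ C / √n := by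
  set H := shannon p with hH
  set V := varentropy p with hVdef
  set B : ℝ := ∑ a, |Real.log (p a) + H| with hB
  have hB0 : 0 ≤ B := Finset.sum_nonneg fun a _ => abs_nonneg _
  have hsV : 0 < √V := Real.sqrt_pos.2 hV
  refine ⟨berryConst * (B / √V), ?_, fun n hn z => ?_⟩
  · have : 0 < berryConst := by
      have := inv_pos.2 (stdPDF_pos 1)
      unfold berryConst
      positivity
    positivity
  have hn' : (0 : ℝ) < n := by exact_mod_cast hn
  have hsn : 0 < √(n : ℝ) := Real.sqrt_pos.2 hn'
  have hlog : ∑ a, p a * Real.log (p a) = -H := by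
    rw [hH, shannon, ← Finset.sum_neg_distrib]
    exact Finset.sum_congr rfl fun a _ => by rw [Real.negMulLog]; ring
  set x : ι → ℝ := fun a => (Real.log (p a) + H) / (√n * √V) with hx
  have hmean : ∑ a, p a * x a = 0 := by
    simp only [hx, ← mul_div_assoc]
    rw [← Finset.sum_div]
    simp only [mul_add, Finset.sum_add_distrib]
    rw [hlog, ← Finset.sum_mul, h1]
    simp
  have hvar : n * ∑ a, p a * x a ^ 2 = 1 := by
    simp only [hx, div_pow, ← mul_div_assoc]
    rw [← Finset.sum_div, mul_pow, Real.sq_sqrt hn'.le, Real.sq_sqrt hV.le]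
    change n * (V / (n * V)) = 1
    field_simp
  have hbd : ∀ a, |x a| ≤ B / (√n * √V) := by
    intro a
    simp only [hx]
    rw [abs_div, abs_of_pos (mul_pos hsn hsV)]
    gcongr
    exact Finset.single_le_sum (f := fun a => |Real.log (p a) + H|) (fun a _ => abs_nonneg _)
      (Finset.mem_univ a)
  have hbe := berryEsseen hp h1 hmean hn hvar hbd z
  have he : iidExp p x n (indIic z) = iidExp p (fun a => Real.log (p a)) n
      (indIic (-(n * H) + √n * √V * z)) := by
    unfold iidExp
    refine Finset.sum_congr rfl fun s _ => ?_
    congr 1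
    have e : ∑ k, x (s k) = (∑ k, Real.log (p (s k)) + n * H) / (√n * √V) := by
      simp only [hx]
      rw [← Finset.sum_div, Finset.sum_add_distrib]
      simp
    rw [e]
    refine le_antisymm (indIic_le_indIic fun h => ?_) (indIic_le_indIic fun h => ?_)
    · rw [div_le_iff₀ (mul_pos hsn hsV)] at h
      linarith
    · rw [div_le_iff₀ (mul_pos hsn hsV)]
      linarith
  rw [← he]
  refine hbe.trans (le_of_eq ?_)
  field_simp

/-- The law of the logarithm of a product distribution has no large atoms: exponential moments
above a threshold are of the order `1/√n`. -/
theorem iidExp_exp_window_le (hp : ∀ a, 0 ≤ p a) (h1 : ∑ a, p a = 1) (hV : 0 < varentropy p)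
    {r : ℝ} (hr : 0 < r) :
    ∃ C : ℝ, 0 < C ∧ ∀ n : ℕ, 0 < n → ∀ τ : ℝ,
      iidExp p (fun a => Real.log (p a)) n
        (fun w => if τ ≤ w then Real.exp (-(r * (w - τ))) else 0) ≤ C / √n := by
  obtain ⟨C, hC0, hC⟩ := abs_iidExp_log_sub_le hp h1 hV
  set H := shannon p
  set V := varentropy p
  have hsV : 0 < √V := Real.sqrt_pos.2 hV
  -- Bounds the mass of a window of length `2`: the increment of `Φ` plus a Berry–Esseen error at
  -- each end.
  set D : ℝ := 2 / √V + 2 * C with hD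
  have hD0 : 0 ≤ D := by positivity
  set q : ℝ := Real.exp (-r) with hq
  have hq1 : q < 1 := by rw [hq]; exact Real.exp_lt_one_iff.2 (by linarith)
  have hq0 : 0 < q := Real.exp_pos _
  refine ⟨D / (1 - q) + 1, by have : 0 < 1 - q := by linarith
                              positivity, fun n hn τ => ?_⟩
  have hn' : (0 : ℝ) < n := by exact_mod_cast hn
  have hsn : 0 < √(n : ℝ) := Real.sqrt_pos.2 hn'
  set E := iidExp p (fun a => Real.log (p a)) n with hE
  have hcdf : ∀ t : ℝ, |E (indIic t) - stdCDF ((t + n * H) / (√n * √V))| ≤ C / √n := by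
    intro t
    have := hC n hn ((t + n * H) / (√n * √V))
    rwa [mul_div_cancel₀ _ (mul_pos hsn hsV).ne', neg_add_cancel_comm_assoc] at this
  have hwin : ∀ t : ℝ, E (indIic (t + 1)) - E (indIic (t - 1)) ≤ D / √n := by
    intro t
    have a1 := (abs_le.1 (hcdf (t + 1))).2
    have a2 := (abs_le.1 (hcdf (t - 1))).1
    have a3 := stdCDF_sub_le (x := (t - 1 + n * H) / (√n * √V)) (y := (t + 1 + n * H) / (√n * √V))
      (by gcongr; linarith)
    have a4 : (t + 1 + n * H) / (√n * √V) - (t - 1 + n * H) / (√n * √V) = 2 / √V / √n := by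
      field_simp
      ring
    have a5 : D / √n = 2 / √V / √n + C / √n + C / √n := by rw [hD]; ring
    linarith
  -- Truncating the layers at `J` costs at most `q ^ J`, the source of the `+ 1` in the constant.
  obtain ⟨J, hJ⟩ : ∃ J : ℕ, q ^ J < 1 / √n := exists_pow_lt_of_lt_one (by positivity) hq1
  -- Layer `j = ⌊w - τ⌋` has weight at most `q ^ j`. Its window starts at `τ + j - 1`, since
  -- `indIic` differences are open on the left and would otherwise miss `w = τ + j`.
  have hpt : ∀ w, (if τ ≤ w then Real.exp (-(r * (w - τ))) else 0) ≤
      (∑ j ∈ Finset.range J, q ^ j * (indIic (τ + j + 1) w - indIic (τ + j - 1) w)) + q ^ J := by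
    intro w
    have hnn : ∀ j ∈ Finset.range J,
        0 ≤ q ^ j * (indIic (τ + j + 1) w - indIic (τ + j - 1) w) := by
      intro j _
      refine mul_nonneg (pow_nonneg hq0.le j) (sub_nonneg.2 (indIic_le_indIic fun h => ?_))
      linarith
    split_ifs with hw
    · have hfl := Nat.floor_le (sub_nonneg.2 hw)
      have hfl' := Nat.lt_floor_add_one (w - τ)
      set j := ⌊w - τ⌋₊
      have hexp : Real.exp (-(r * (w - τ))) ≤ q ^ j := by
        rw [hq, ← Real.exp_nat_mul]
        exact Real.exp_le_exp.2 (by nlinarith)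
      rcases lt_or_ge j J with hj | hj
      · have hs := Finset.single_le_sum hnn (Finset.mem_range.2 hj)
        have e1 : indIic (τ + j + 1) w = 1 := if_pos (by linarith)
        have e2 : indIic (τ + j - 1) w = 0 := if_neg (by linarith)
        rw [e1, e2, sub_zero, mul_one] at hs
        have := pow_nonneg hq0.le J
        linarith
      · have := Finset.sum_nonneg hnn
        have h3 := pow_le_pow_of_le_one hq0.le hq1.le hj
        linarith
    · have := Finset.sum_nonneg hnn
      have := pow_nonneg hq0.le J
      linarith
  have hsumE : ∀ J : ℕ, E (fun w => ∑ j ∈ Finset.range J,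
      q ^ j * (indIic (τ + j + 1) w - indIic (τ + j - 1) w)) =
      ∑ j ∈ Finset.range J, q ^ j * (E (indIic (τ + j + 1)) - E (indIic (τ + j - 1))) := by
    intro J
    induction J with
    | zero => simp [hE, iidExp]
    | succ J ih =>
      simp only [Finset.sum_range_succ]
      rw [hE, iidExp_add n (fun w => ∑ j ∈ Finset.range J,
        q ^ j * (indIic (τ + j + 1) w - indIic (τ + j - 1) w)), ← hE, ih, hE,
        iidExp_const_mul n _ fun w => indIic (τ + J + 1) w - indIic (τ + J - 1) w,
        iidExp_sub n (indIic (τ + J + 1))]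
  have hmono := iidExp_mono (x := fun a => Real.log (p a)) hp n hpt
  rw [iidExp_add n (fun w => ∑ j ∈ Finset.range J,
    q ^ j * (indIic (τ + j + 1) w - indIic (τ + j - 1) w)), iidExp_const h1, ← hE, hsumE] at hmono
  refine hmono.trans ?_
  have hb : ∑ j ∈ Finset.range J, q ^ j * (E (indIic (τ + j + 1)) - E (indIic (τ + j - 1))) ≤
      ∑ j ∈ Finset.range J, q ^ j * (D / √n) :=
    Finset.sum_le_sum fun j _ => mul_le_mul_of_nonneg_left (hwin _) (pow_nonneg hq0.le j)
  have hgeo : ∑ j ∈ Finset.range J, q ^ j ≤ 1 / (1 - q) := by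
    rw [geom_sum_eq hq1.ne, ← neg_div_neg_eq, neg_sub, neg_sub]
    have := pow_nonneg hq0.le J
    have h1q : 0 < 1 - q := by linarith
    gcongr
    linarith
  rw [← Finset.sum_mul] at hb
  have h2 := mul_le_mul_of_nonneg_right hgeo (by positivity : 0 ≤ D / √n)
  have e : (D / (1 - q) + 1) / √n = 1 / (1 - q) * (D / √n) + 1 / √n := by ring
  linarith

/-- Where the product law is positive, its logarithm is the sum of the logarithms; sequences of
probability zero, where `Real.log 0 = 0` breaks this, vanish on both sides. -/
theorem sum_filter_prodLaw_eq (hp : ∀ a, 0 ≤ p a) (n : ℕ) (τ : ℝ) (h : ℝ → ℝ) :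
    ∑ s : Fin n → ι with Real.exp τ ≤ prodLaw p s, prodLaw p s * h (Real.log (prodLaw p s)) =
      iidExp p (fun a => Real.log (p a)) n fun w => if τ ≤ w then h w else 0 := by
  rw [Finset.sum_filter, iidExp]
  refine Finset.sum_congr rfl fun s _ => ?_
  change _ = prodLaw p s * _
  rcases (prodLaw_nonneg hp s).eq_or_lt with h0 | h0
  · rw [← h0]
    simp
  · rw [log_prodLaw h0.ne']
    simp only [← Real.le_log_iff_exp_le h0]
    split_ifs <;> simp

/-- Upper bound for the number of large values of a product distribution. -/
theorem card_prodLaw_le (hp : ∀ a, 0 ≤ p a) (h1 : ∑ a, p a = 1) (hV : 0 < varentropy p) :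
    ∃ C : ℝ, 0 < C ∧ ∀ n : ℕ, 0 < n → ∀ τ : ℝ,
      ((Finset.univ.filter fun s : Fin n → ι => Real.exp τ ≤ prodLaw p s).card : ℝ) ≤
        C / √n * Real.exp (-τ) := by
  obtain ⟨C, hC0, hC⟩ := iidExp_exp_window_le hp h1 hV one_pos
  refine ⟨C, hC0, fun n hn τ => ?_⟩
  have h := hC n hn τ
  rw [← sum_filter_prodLaw_eq hp n τ fun w => Real.exp (-(1 * (w - τ)))] at h
  -- Each index counts as `1 = λ · e^{-(log λ - τ)} · e^{-τ}`, so the exponential moment with rate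
  -- `1` controls the cardinality.
  have e : ((Finset.univ.filter fun s : Fin n → ι => Real.exp τ ≤ prodLaw p s).card : ℝ) =
      (∑ s : Fin n → ι with Real.exp τ ≤ prodLaw p s,
        prodLaw p s * Real.exp (-(1 * (Real.log (prodLaw p s) - τ)))) * Real.exp (-τ) := by
    rw [Finset.card_eq_sum_ones, Finset.sum_mul]
    push_cast
    refine Finset.sum_congr rfl fun s hs => ?_
    have hpos : 0 < prodLaw p s := (Real.exp_pos τ).trans_le (Finset.mem_filter.1 hs).2
    rw [mul_assoc, ← Real.exp_add, show -(1 * (Real.log (prodLaw p s) - τ)) + -τ =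
      -Real.log (prodLaw p s) by ring, Real.exp_neg, Real.exp_log hpos, mul_inv_cancel₀ hpos.ne']
  rw [e]
  exact mul_le_mul_of_nonneg_right h (Real.exp_pos _).le

/-- Upper bound for the sum of the square roots of the large values of a product distribution. -/
theorem sum_sqrt_prodLaw_le (hp : ∀ a, 0 ≤ p a) (h1 : ∑ a, p a = 1) (hV : 0 < varentropy p) :
    ∃ C : ℝ, 0 < C ∧ ∀ n : ℕ, 0 < n → ∀ τ : ℝ,
      ∑ s : Fin n → ι with Real.exp τ ≤ prodLaw p s, √(prodLaw p s) ≤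
        C / √n * Real.exp (-τ / 2) := by
  obtain ⟨C, hC0, hC⟩ := iidExp_exp_window_le hp h1 hV (r := 1 / 2) (by norm_num)
  refine ⟨C, hC0, fun n hn τ => ?_⟩
  have h := hC n hn τ
  rw [← sum_filter_prodLaw_eq hp n τ fun w => Real.exp (-(1 / 2 * (w - τ)))] at h
  -- The same change of measure with rate `1/2`: `√λ = λ · e^{-(log λ - τ)/2} · e^{-τ/2}`.
  have e : ∑ s : Fin n → ι with Real.exp τ ≤ prodLaw p s, √(prodLaw p s) =
      (∑ s : Fin n → ι with Real.exp τ ≤ prodLaw p s,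
        prodLaw p s * Real.exp (-(1 / 2 * (Real.log (prodLaw p s) - τ)))) * Real.exp (-τ / 2) := by
    rw [Finset.sum_mul]
    refine Finset.sum_congr rfl fun s hs => ?_
    have hpos : 0 < prodLaw p s := (Real.exp_pos τ).trans_le (Finset.mem_filter.1 hs).2
    rw [mul_assoc, ← Real.exp_add, show -(1 / 2 * (Real.log (prodLaw p s) - τ)) + -τ / 2 =
      -(Real.log (prodLaw p s) / 2) by ring, Real.exp_neg, Real.exp_half, Real.exp_log hpos,
      ← div_eq_mul_inv, Real.div_sqrt]
  rw [e]
  exact mul_le_mul_of_nonneg_right h (Real.exp_pos _).le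

/-- `√n √V q - n H`, the second order expansion of the `ε`-quantile of the logarithm of a product
distribution. -/
def logThreshold (p : ι → ℝ) (ε : ℝ) (n : ℕ) : ℝ :=
  -(n * shannon p) + √n * √(varentropy p) * normalQuantile ε

/-- The values above the quantile, shifted upwards by a constant, have total mass below
`1 - ε - 2/√n`. -/
theorem exists_mass_le (hp : ∀ a, 0 ≤ p a) (h1 : ∑ a, p a = 1) (hV : 0 < varentropy p)
    {ε : ℝ} (hε0 : 0 < ε) (hε1 : ε < 1) :
    ∃ K : ℝ, ∀ᶠ n : ℕ in atTop,
      ∑ s : Fin n → ι with Real.exp (logThreshold p ε n + K) < prodLaw p s, prodLaw p s ≤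
        1 - ε - 2 / √n := by
  obtain ⟨C, hC0, hC⟩ := abs_iidExp_log_sub_le hp h1 hV
  set V := varentropy p
  have hsV : 0 < √V := Real.sqrt_pos.2 hV
  set q := normalQuantile ε with hq
  set φ := stdPDF (|q| + 1) with hφ
  have hφ0 : 0 < φ := stdPDF_pos _
  -- Moving the argument of `Φ` by `k/√n` gains at least `(C + 2)/√n`: `C/√n` pays for the
  -- Berry–Esseen error, `2/√n` is the margin. On the log scale the move is `√V · k`.
  set k : ℝ := (C + 2) / φ with hk
  have hk0 : 0 < k := by positivity
  have hlim : Tendsto (fun n : ℕ => k / √(n : ℝ)) atTop (nhds 0) :=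
    (Real.tendsto_sqrt_atTop.comp tendsto_natCast_atTop_atTop).const_div_atTop k
  refine ⟨√V * k, ?_⟩
  filter_upwards [hlim.eventually (gt_mem_nhds one_pos), eventually_gt_atTop 0] with n hn1 hn
  have hn' : (0 : ℝ) < n := by exact_mod_cast hn
  have hsn : 0 < √(n : ℝ) := Real.sqrt_pos.2 hn'
  have hb := (abs_le.1 (hC n hn (q + k / √n))).1
  have hc := stdCDF_sub_ge q (x := q) (y := q + k / √n) (by linarith) (by linarith)
    (by have := div_pos hk0 hsn; linarith)
  rw [hq, stdCDF_normalQuantile hε0 hε1, ← hq, ← hφ] at hc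
  have e1 : φ * (q + k / √n - q) = (C + 2) / √n := by
    rw [hk]
    field_simp
    ring
  have e2 : -(n * shannon p) + √n * √V * (q + k / √n) = logThreshold p ε n + √V * k := by
    rw [logThreshold, ← hq]
    field_simp
    ring
  rw [e2] at hb
  have e3 : ∑ s : Fin n → ι with Real.exp (logThreshold p ε n + √V * k) < prodLaw p s, prodLaw p s
      = 1 - iidExp p (fun a => Real.log (p a)) n (indIic (logThreshold p ε n + √V * k)) := by
    rw [← sum_prodLaw h1 n, iidExp, ← Finset.sum_sub_distrib, Finset.sum_filter]
    refine Finset.sum_congr rfl fun s _ => ?_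
    change _ = prodLaw p s - prodLaw p s * _
    rcases (prodLaw_nonneg hp s).eq_or_lt with h0 | h0
    · rw [← h0]
      simp
    · rw [log_prodLaw h0.ne', indIic]
      simp only [← Real.lt_log_iff_exp_lt h0]
      by_cases h : Real.log (prodLaw p s) ≤ logThreshold p ε n + √V * k
      · rw [if_neg (not_lt.2 h), if_pos h]
        ring
      · rw [if_pos (not_le.1 h), if_neg h]
        ring
  rw [e3]
  have e4 : (C + 2) / √n = C / √n + 2 / √n := by ring
  linarith

/-- The values above the quantile, shifted downwards by a constant, have total mass above
`1 - ε + 1/√n`. -/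
theorem exists_le_mass (hp : ∀ a, 0 ≤ p a) (h1 : ∑ a, p a = 1) (hV : 0 < varentropy p)
    {ε : ℝ} (hε0 : 0 < ε) (hε1 : ε < 1) :
    ∃ K : ℝ, ∀ᶠ n : ℕ in atTop, 1 - ε + 1 / √n ≤
      ∑ s : Fin n → ι with Real.exp (logThreshold p ε n - K) ≤ prodLaw p s, prodLaw p s := by
  obtain ⟨C, hC0, hC⟩ := abs_iidExp_log_sub_le hp h1 hV
  set V := varentropy p
  have hsV : 0 < √V := Real.sqrt_pos.2 hV
  set q := normalQuantile ε with hq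
  set φ := stdPDF (|q| + 1) with hφ
  have hφ0 : 0 < φ := stdPDF_pos _
  -- As above, with a margin of `1/√n`.
  set k : ℝ := (C + 1) / φ with hk
  have hk0 : 0 < k := by positivity
  have hlim : Tendsto (fun n : ℕ => k / √(n : ℝ)) atTop (nhds 0) :=
    (Real.tendsto_sqrt_atTop.comp tendsto_natCast_atTop_atTop).const_div_atTop k
  refine ⟨√V * k, ?_⟩
  filter_upwards [hlim.eventually (gt_mem_nhds one_pos), eventually_gt_atTop 0] with n hn1 hn
  have hn' : (0 : ℝ) < n := by exact_mod_cast hn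
  have hsn : 0 < √(n : ℝ) := Real.sqrt_pos.2 hn'
  have hb := (abs_le.1 (hC n hn (q - k / √n))).2
  have hc := stdCDF_sub_ge q (x := q - k / √n) (y := q) (by linarith) (by linarith)
    (by have := div_pos hk0 hsn; linarith)
  rw [hq, stdCDF_normalQuantile hε0 hε1, ← hq, ← hφ] at hc
  have e1 : φ * (q - (q - k / √n)) = (C + 1) / √n := by
    rw [hk]
    field_simp
    ring
  have e2 : -(n * shannon p) + √n * √V * (q - k / √n) = logThreshold p ε n - √V * k := by
    rw [logThreshold, ← hq]
    field_simp
    ring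
  rw [e2] at hb
  have e3 : 1 - iidExp p (fun a => Real.log (p a)) n (indIic (logThreshold p ε n - √V * k)) ≤
      ∑ s : Fin n → ι with Real.exp (logThreshold p ε n - √V * k) ≤ prodLaw p s, prodLaw p s := by
    rw [← sum_prodLaw h1 n, iidExp, ← Finset.sum_sub_distrib, Finset.sum_filter]
    refine Finset.sum_le_sum fun s _ => ?_
    change prodLaw p s - prodLaw p s * _ ≤ _
    rcases (prodLaw_nonneg hp s).eq_or_lt with h0 | h0
    · rw [← h0]
      simp
    · rw [log_prodLaw h0.ne', indIic]
      simp only [← Real.le_log_iff_exp_le h0]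
      by_cases h : Real.log (prodLaw p s) ≤ logThreshold p ε n - √V * k
      · rw [if_pos h]
        split_ifs <;> linarith
      · rw [if_pos (not_le.1 h).le, if_neg h]
        linarith
  have e4 : (C + 1) / √n = C / √n + 1 / √n := by ring
  linarith

/-- The sum of the powers `3/2` of a product distribution decays exponentially. -/
theorem eventually_sum_mul_sqrt_le (hp : ∀ a, 0 ≤ p a) (h1 : ∑ a, p a = 1)
    (hV : 0 < varentropy p) {κ : ℝ} (hκ : 0 < κ) :
    ∀ᶠ n : ℕ in atTop, ∑ s : Fin n → ι, prodLaw p s * √(prodLaw p s) ≤ κ / √n := by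
  have hle1 : ∀ a, p a ≤ 1 := fun a => by
    rw [← h1]
    exact Finset.single_le_sum (fun a _ => hp a) (Finset.mem_univ a)
  set r : ℝ := ∑ a, p a * √(p a) with hr
  have hr0 : 0 ≤ r := Finset.sum_nonneg fun a _ => mul_nonneg (hp a) (Real.sqrt_nonneg _)
  -- Equality would force every `p a` to be `0` or `1`, and then the varentropy would vanish.
  have hr1 : r < 1 := by
    rw [← h1]
    refine Finset.sum_lt_sum (fun a _ => ?_) ?_
    · exact mul_le_of_le_one_right (hp a) (Real.sqrt_le_one.2 (hle1 a))
    · by_contra hne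
      push Not at hne
      have h01 : ∀ a, p a = 0 ∨ p a = 1 := by
        intro a
        by_contra hcon
        push Not at hcon
        have h0 : 0 < p a := lt_of_le_of_ne (hp a) (Ne.symm hcon.1)
        have h1' : p a < 1 := lt_of_le_of_ne (hle1 a) hcon.2
        have := hne a (Finset.mem_univ a)
        have h3 : √(p a) < 1 := by rwa [Real.sqrt_lt' one_pos, one_pow]
        nlinarith
      have hlog : ∀ a, Real.log (p a) = 0 := fun a => by rcases h01 a with h | h <;> simp [h]
      have : varentropy p = 0 := by simp [varentropy, shannon, Real.negMulLog, hlog]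
      linarith
  have hpow : ∀ n : ℕ, ∑ s : Fin n → ι, prodLaw p s * √(prodLaw p s) = r ^ n := by
    intro n
    have e : r ^ n = ∏ _k : Fin n, ∑ a, p a * √(p a) := by simp [hr]
    rw [e, Fintype.prod_sum]
    refine Finset.sum_congr rfl fun s _ => ?_
    rw [prodLaw, Real.sqrt_prod _ (fun k _ => hp (s k)), Finset.prod_mul_distrib]
  have hlim : Tendsto (fun n : ℕ => (n : ℝ) * r ^ n) atTop (nhds 0) :=
    tendsto_self_mul_const_pow_of_lt_one hr0 hr1
  filter_upwards [hlim.eventually (gt_mem_nhds hκ), eventually_gt_atTop 0] with n h hn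
  have hn' : (1 : ℝ) ≤ n := by exact_mod_cast hn
  have hsn : 0 < √(n : ℝ) := Real.sqrt_pos.2 (by linarith)
  rw [hpow, le_div_iff₀ hsn]
  have h2 : √(n : ℝ) ≤ n := by
    rw [Real.sqrt_le_left (by linarith)]
    nlinarith
  have := mul_le_mul_of_nonneg_left h2 (pow_nonneg hr0 n)
  linarith

end Spectrum

/-! ### Separable operators and LOCC -/

open scoped MatrixOrder in
theorem exists_eq_conjTranspose_mul_self {S : Type} [Fintype S] [DecidableEq S]
    {M : Matrix S S ℂ} (h : M.PosSemidef) : ∃ C : Matrix S S ℂ, M = C.conjTranspose * C :=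
  CStarAlgebra.nonneg_iff_eq_star_mul_self.mp h.nonneg

section Kronecker

variable {A B C : Type}

theorem swapOp_kronecker (E : Matrix A A ℂ) (F : Matrix B B ℂ) : swapOp (F ⊗ₖ E) = E ⊗ₖ F := by
  ext p q
  simp [swapOp, Matrix.kroneckerMap_apply, mul_comm]

theorem swapOp_sum {I : Type} (s : Finset I) (R : I → Matrix (B × A) (B × A) ℂ) :
    swapOp (∑ i ∈ s, R i) = ∑ i ∈ s, swapOp (R i) := by
  ext p q
  simp [swapOp, Matrix.sum_apply]

theorem sum_kronecker {I : Type} (s : Finset I) (E : I → Matrix A A ℂ) (F : Matrix B B ℂ) :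
    (∑ i ∈ s, E i) ⊗ₖ F = ∑ i ∈ s, E i ⊗ₖ F := by
  ext p q
  simp [Matrix.kroneckerMap_apply, Matrix.sum_apply, Finset.sum_mul]

theorem kraus_kronecker [Fintype B] [Fintype C] [DecidableEq B] (K : Matrix C A ℂ) (E : Matrix C C ℂ)
    (F : Matrix B B ℂ) :
    (K ⊗ₖ (1 : Matrix B B ℂ)).conjTranspose * (E ⊗ₖ F) * (K ⊗ₖ (1 : Matrix B B ℂ)) =
      (K.conjTranspose * E * K) ⊗ₖ F := by
  rw [Matrix.conjTranspose_kronecker, ← Matrix.mul_kronecker_mul, ← Matrix.mul_kronecker_mul]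
  simp

variable [Fintype A] [Fintype B] [Fintype C]

theorem isSeparableOp_kronecker {E : Matrix A A ℂ} {F : Matrix B B ℂ} (hE : E.PosSemidef)
    (hF : F.PosSemidef) : IsSeparableOp (E ⊗ₖ F) :=
  ⟨1, fun _ => E, fun _ => F, fun _ => hE, fun _ => hF, by simp⟩

theorem isSeparableOp_sum {I : Type} [Fintype I] {S : I → Matrix (A × B) (A × B) ℂ}
    (h : ∀ i, IsSeparableOp (S i)) : IsSeparableOp (∑ i, S i) := by
  choose m E F hE hF hS using h
  let e := Fintype.equivFin (Σ i : I, Fin (m i))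
  refine ⟨Fintype.card (Σ i : I, Fin (m i)), fun k => E (e.symm k).1 (e.symm k).2,
    fun k => F (e.symm k).1 (e.symm k).2, fun k => hE _ _, fun k => hF _ _, ?_⟩
  rw [e.symm.sum_comp fun k : (Σ i : I, Fin (m i)) => E k.1 k.2 ⊗ₖ F k.1 k.2, Fintype.sum_sigma]
  exact Finset.sum_congr rfl fun i _ => hS i

theorem IsSeparableOp.posSemidef {S : Matrix (A × B) (A × B) ℂ} (h : IsSeparableOp S) :
    S.PosSemidef := by
  classical
  obtain ⟨m, E, F, hE, hF, rfl⟩ := h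
  exact Matrix.posSemidef_sum _ fun i _ => (hE i).kronecker (hF i)

theorem IsSeparableOp.swap {S : Matrix (B × A) (B × A) ℂ} (h : IsSeparableOp S) :
    IsSeparableOp (swapOp S) := by
  obtain ⟨m, E, F, hE, hF, rfl⟩ := h
  refine ⟨m, F, E, hF, hE, ?_⟩
  rw [swapOp_sum]
  exact Finset.sum_congr rfl fun i _ => swapOp_kronecker _ _

theorem IsSeparableOp.kraus [DecidableEq B] {S : Matrix (C × B) (C × B) ℂ} (h : IsSeparableOp S)
    (K : Matrix C A ℂ) :
    IsSeparableOp ((K ⊗ₖ (1 : Matrix B B ℂ)).conjTranspose * S * (K ⊗ₖ (1 : Matrix B B ℂ))) := by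
  obtain ⟨m, E, F, hE, hF, rfl⟩ := h
  refine ⟨m, fun i => K.conjTranspose * E i * K, F,
    fun i => (hE i).conjTranspose_mul_mul_same K, hF, ?_⟩
  rw [Matrix.mul_sum, Matrix.sum_mul]
  exact Finset.sum_congr rfl fun i _ => kraus_kronecker _ _ _

end Kronecker

section LOCC

variable {X : Type} [Fintype X]

theorem IsPOVM.le_one {S : Type} [Fintype S] [DecidableEq S] {M : X → Matrix S S ℂ}
    (h : IsPOVM M) (x : X) : (1 - M x).PosSemidef := by
  classical
  rw [← h.2, ← Finset.sum_erase_eq_sub (Finset.mem_univ x)]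
  exact Matrix.posSemidef_sum _ fun y _ => h.1 y

/-- LOCC POVMs are separable. -/
theorem IsLOCC.separable {k : ℕ} {A B : Type} [Fintype A] [DecidableEq A] [Fintype B]
    [DecidableEq B] {M : X → Matrix (A × B) (A × B) ℂ} (h : IsLOCC X k A B M) :
    IsPOVM M ∧ ∀ x, IsSeparableOp (M x) := by
  induction k generalizing A B with
  | zero =>
    obtain ⟨E, hE, hM⟩ := h
    have hs : ∀ x, IsSeparableOp (M x) := fun x => by
      rw [hM x]
      exact isSeparableOp_kronecker (hE.1 x) Matrix.PosSemidef.one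
    refine ⟨⟨fun x => (hs x).posSemidef, ?_⟩, hs⟩
    simp only [hM]
    rw [← sum_kronecker, hE.2, Matrix.one_kronecker_one]
  | succ k ih =>
    obtain ⟨m, r, a, K, R, hK, hR, hM⟩ := h
    have hs : ∀ x, IsSeparableOp (M x) := fun x => by
      rw [hM x]
      exact isSeparableOp_sum fun i => isSeparableOp_sum fun j => ((ih (hR i)).2 x).swap.kraus _
    refine ⟨⟨fun x => (hs x).posSemidef, ?_⟩, hs⟩
    have hone : ∀ i, ∑ x, swapOp (R i x) = 1 := by
      intro i
      rw [← swapOp_sum, (ih (hR i)).1.2, ← Matrix.one_kronecker_one, swapOp_kronecker,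
        Matrix.one_kronecker_one]
    simp only [hM]
    rw [Finset.sum_comm]
    have e : ∀ i, ∑ x, ∑ j, (K i j ⊗ₖ (1 : Matrix B B ℂ)).conjTranspose * swapOp (R i x) *
        (K i j ⊗ₖ (1 : Matrix B B ℂ)) = ∑ j, ((K i j).conjTranspose * K i j) ⊗ₖ 1 := by
      intro i
      rw [Finset.sum_comm]
      refine Finset.sum_congr rfl fun j _ => ?_
      rw [← Matrix.sum_mul, ← Matrix.mul_sum, hone i, ← Matrix.one_kronecker_one, kraus_kronecker,
        Matrix.mul_one]
    simp only [e, ← sum_kronecker]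
    rw [hK, Matrix.one_kronecker_one]

/-- The structure of one-way LOCC POVMs. -/
theorem IsLOCC.oneWay {A B : Type} [Fintype A] [DecidableEq A] [Fintype B]
    [DecidableEq B] {M : X → Matrix (A × B) (A × B) ℂ} (h : IsLOCC X 1 A B M) :
    ∃ (m : ℕ) (E : Fin m → Matrix A A ℂ) (F : Fin m → X → Matrix B B ℂ),
      IsPOVM E ∧ (∀ i, IsPOVM (F i)) ∧ ∀ x, M x = ∑ i, E i ⊗ₖ F i x := by
  obtain ⟨m, r, a, K, R, hK, hR, hM⟩ := h
  choose F hF hRF using hR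
  refine ⟨m, fun i => ∑ j, (K i j).conjTranspose * K i j, F, ⟨fun i => ?_, hK⟩, hF, fun x => ?_⟩
  · exact Matrix.posSemidef_sum _ fun j _ => Matrix.posSemidef_conjTranspose_mul_self _
  · rw [hM x]
    refine Finset.sum_congr rfl fun i _ => ?_
    rw [sum_kronecker]
    refine Finset.sum_congr rfl fun j _ => ?_
    rw [hRF, swapOp_kronecker, kraus_kronecker, Matrix.mul_one]

variable {A B : Type} [Fintype A] [DecidableEq A] [Fintype B] [DecidableEq B]

/-- Alice measures, and Bob measures according to her outcome. -/
theorem isLOCC_one {I : Type} [Fintype I] {E : I → Matrix A A ℂ} (hE : IsPOVM E)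
    {F : I → X → Matrix B B ℂ} (hF : ∀ i, IsPOVM (F i)) :
    IsLOCC X 1 A B fun x => ∑ i, E i ⊗ₖ F i x := by
  have hC : ∀ i, ∃ C : Matrix A A ℂ, E i = C.conjTranspose * C := fun i =>
    exists_eq_conjTranspose_mul_self (hE.1 i)
  choose C hC using hC
  let e := Fintype.equivFin I
  -- Each outcome has a single Kraus operator, a square root of `E i`; `σ` relabels its output space
  -- as `Fin (card A)`, as the definition of a protocol requires.
  let σ := Fintype.equivFin A
  have hK : ∀ i, ((C i).submatrix σ.symm id).conjTranspose * (C i).submatrix σ.symm id = E i := by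
    intro i
    rw [Matrix.conjTranspose_submatrix, Matrix.submatrix_mul_equiv, ← hC]
    rfl
  refine ⟨Fintype.card I, 1, fun _ => Fintype.card A,
    fun i _ => (C (e.symm i)).submatrix σ.symm id, fun i x => F (e.symm i) x ⊗ₖ 1, ?_,
    fun i => ⟨F (e.symm i), hF _, fun x => rfl⟩, fun x => ?_⟩
  · simp only [hK, Finset.univ_unique, Finset.sum_singleton]
    rw [e.symm.sum_comp E, hE.2]
  · simp only [swapOp_kronecker, kraus_kronecker, Matrix.mul_one, hK, Finset.univ_unique,
      Finset.sum_singleton]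
    rw [e.symm.sum_comp fun i => E i ⊗ₖ F i x]

theorem IsPOVM.submatrix {S S' : Type} [Fintype S] [DecidableEq S] [Fintype S'] [DecidableEq S']
    {M : X → Matrix S S ℂ} (h : IsPOVM M) (σ : S' ≃ S) :
    IsPOVM fun x => (M x).submatrix σ σ := by
  refine ⟨fun x => (h.1 x).submatrix σ, ?_⟩
  have : ∑ x, (M x).submatrix σ σ = (∑ x, M x).submatrix σ σ := by
    ext p q
    simp [Matrix.sum_apply]
  rw [this, h.2, Matrix.submatrix_one_equiv]

/-- Alice applies an instrument, Bob measures according to her outcome, and Alice measures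
according to both outcomes. -/
theorem isLOCC_two {I J : Type} [Fintype I] [Fintype J] {K : I → Matrix A A ℂ}
    (hK : ∑ i, (K i).conjTranspose * K i = 1) {F : I → J → Matrix B B ℂ}
    (hF : ∀ i, IsPOVM (F i)) {G : I → J → X → Matrix A A ℂ} (hG : ∀ i j, IsPOVM (G i j)) :
    IsLOCC X 2 A B fun x => ∑ i, ∑ j, ((K i).conjTranspose * G i j x * K i) ⊗ₖ F i j := by
  let e := Fintype.equivFin I
  let σ := Fintype.equivFin A
  have hKK : ∀ i (N : Matrix A A ℂ), ((K i).submatrix σ.symm id).conjTranspose *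
      N.submatrix σ.symm σ.symm * (K i).submatrix σ.symm id = (K i).conjTranspose * N * K i := by
    intro i N
    rw [Matrix.conjTranspose_submatrix, Matrix.submatrix_mul_equiv, Matrix.submatrix_mul_equiv]
    rfl
  refine ⟨Fintype.card I, 1, fun _ => Fintype.card A,
    fun i _ => (K (e.symm i)).submatrix σ.symm id,
    fun i x => ∑ j, F (e.symm i) j ⊗ₖ (G (e.symm i) j x).submatrix σ.symm σ.symm, ?_,
    fun i => isLOCC_one (hF _) fun j => (hG _ j).submatrix σ.symm, fun x => ?_⟩
  · have h1 : ∀ i, ((K i).submatrix σ.symm id).conjTranspose * (K i).submatrix σ.symm id =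
        (K i).conjTranspose * K i := by
      intro i
      have := hKK i 1
      rwa [Matrix.submatrix_one_equiv, Matrix.mul_one, Matrix.mul_one] at this
    simp only [h1, Finset.univ_unique, Finset.sum_singleton]
    rw [e.symm.sum_comp fun i => (K i).conjTranspose * K i, hK]
  · simp only [swapOp_sum, swapOp_kronecker, Matrix.mul_sum, Matrix.sum_mul, kraus_kronecker, hKK,
      Finset.univ_unique, Finset.sum_singleton]
    rw [e.symm.sum_comp fun i => ∑ j, ((K i).conjTranspose * G i j x * K i) ⊗ₖ F i j]

end LOCC

/-! ### Quadratic forms -/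

section QuadForm

variable {S : Type} [Fintype S]

/-- The expectation `⟨φ|M|φ⟩`. -/
def quadForm (M : Matrix S S ℂ) (φ : S → ℂ) : ℝ := (star φ ⬝ᵥ M.mulVec φ).re

theorem quadForm_nonneg {M : Matrix S S ℂ} (h : M.PosSemidef) (φ : S → ℂ) : 0 ≤ quadForm M φ :=
  (Complex.le_def.1 (h.dotProduct_mulVec_nonneg φ)).1

theorem quadForm_sub (M N : Matrix S S ℂ) (φ : S → ℂ) :
    quadForm (M - N) φ = quadForm M φ - quadForm N φ := by
  simp [quadForm, Matrix.sub_mulVec]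

theorem quadForm_smul (t : ℝ) (M : Matrix S S ℂ) (φ : S → ℂ) :
    quadForm ((t : ℂ) • M) φ = t * quadForm M φ := by
  simp [quadForm, Matrix.smul_mulVec]

theorem quadForm_sum {I : Type} (s : Finset I) (M : I → Matrix S S ℂ) (φ : S → ℂ) :
    quadForm (∑ i ∈ s, M i) φ = ∑ i ∈ s, quadForm (M i) φ := by
  simp [quadForm, Matrix.sum_mulVec, dotProduct_sum]

theorem quadForm_vecMulVec (v φ : S → ℂ) :
    quadForm (Matrix.vecMulVec v (star v)) φ = Complex.normSq (star v ⬝ᵥ φ) := by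
  have h : star φ ⬝ᵥ (Matrix.vecMulVec v (star v)).mulVec φ =
      star (star v ⬝ᵥ φ) * (star v ⬝ᵥ φ) := by
    rw [Matrix.vecMulVec_mulVec, dotProduct_smul, Matrix.star_dotProduct, star_star,
      MulOpposite.smul_eq_mul_unop, MulOpposite.unop_op]
  rw [quadForm, h, Complex.star_def, ← Complex.normSq_eq_conj_mul_self, Complex.ofReal_re]

theorem trace_vecMulVec_mul (v : S → ℂ) (M : Matrix S S ℂ) :
    (Matrix.vecMulVec v (star v) * M).trace = star v ⬝ᵥ M.mulVec v := by
  rw [Matrix.trace_mul_comm, Matrix.mul_vecMulVec, Matrix.trace_vecMulVec, dotProduct_comm]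

/-- The weighted triangle inequality for the seminorm of a positive operator. -/
theorem quadForm_add_le {M : Matrix S S ℂ} (h : M.PosSemidef) {η : ℝ} (hη : 0 < η)
    (x y : S → ℂ) :
    quadForm M (x + y) ≤ (1 + η) * quadForm M x + (1 + η⁻¹) * quadForm M y := by
  have h0 := quadForm_nonneg h ((η : ℂ) • x - y)
  -- The defect in the inequality is exactly this nonnegative square.
  have e : quadForm M (x + y) + η⁻¹ * quadForm M ((η : ℂ) • x - y) =
      (1 + η) * quadForm M x + (1 + η⁻¹) * quadForm M y := by
    simp only [quadForm, star_add, star_sub, star_smul, Matrix.mulVec_add, Matrix.mulVec_sub,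
      Matrix.mulVec_smul, dotProduct_add, add_dotProduct, sub_dotProduct, dotProduct_sub,
      smul_dotProduct, dotProduct_smul, Complex.add_re, Complex.sub_re, smul_eq_mul,
      Complex.star_def, Complex.conj_ofReal, Complex.re_ofReal_mul]
    field_simp
    ring
  have := mul_nonneg (inv_nonneg.2 hη.le) h0
  linarith

/-- A positive operator is bounded by its trace. -/
theorem trace_sub_posSemidef [DecidableEq S] {F : Matrix S S ℂ} (hF : F.PosSemidef) :
    (((F.trace.re : ℝ) : ℂ) • (1 : Matrix S S ℂ) - F).PosSemidef := by
  have hU : (hF.1.eigenvectorUnitary : Matrix S S ℂ) *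
      (hF.1.eigenvectorUnitary : Matrix S S ℂ).conjTranspose = 1 :=
    Unitary.mul_star_self_of_mem hF.1.eigenvectorUnitary.2
  have hs := hF.1.spectral_theorem
  rw [Unitary.conjStarAlgAut_apply] at hs
  have ht : F.trace.re = ∑ i, hF.1.eigenvalues i := by
    rw [hF.1.trace_eq_sum_eigenvalues]
    simp
  have e : ((F.trace.re : ℝ) : ℂ) • (1 : Matrix S S ℂ) - F =
      (hF.1.eigenvectorUnitary : Matrix S S ℂ) *
        (((F.trace.re : ℝ) : ℂ) • (1 : Matrix S S ℂ) -
          Matrix.diagonal (RCLike.ofReal ∘ hF.1.eigenvalues)) *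
        (hF.1.eigenvectorUnitary : Matrix S S ℂ).conjTranspose := by
    rw [Matrix.mul_sub, Matrix.sub_mul, Matrix.mul_smul, Matrix.smul_mul, Matrix.mul_one, hU]
    congr 1
  rw [e]
  refine Matrix.PosSemidef.mul_mul_conjTranspose_same ?_ _
  rw [← Matrix.diagonal_one, ← Matrix.diagonal_smul, Matrix.diagonal_sub]
  refine Matrix.PosSemidef.diagonal fun i => ?_
  have hle : hF.1.eigenvalues i ≤ F.trace.re := by
    rw [ht]
    exact Finset.single_le_sum (fun j _ => hF.eigenvalues_nonneg j) (Finset.mem_univ i)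
  simp only [Pi.zero_apply, Pi.smul_apply, smul_eq_mul, mul_one, Function.comp]
  rw [sub_nonneg]
  exact Complex.real_le_real.2 hle

end QuadForm

/-! ### Lower bounds for the trace of separable and one-way tests. -/

section Converse

/-- The vector in `ℂ^A ⊗ ℂ^B` with the given matrix of coefficients. -/
def vecOf {A B : Type} (M : Matrix A B ℂ) : A × B → ℂ := fun p => M p.1 p.2

/-- The coefficient matrix of `∑ i ∈ Q, u_i ⊗ w_i`, where the `u_i` are the columns of `U` and the
`w_i` are the rows of `W`. -/
def schmidtPart {A B : Type} [Fintype A] [DecidableEq A] (U : Matrix A A ℂ) (W : Matrix A B ℂ)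
    (Q : Finset A) : Matrix A B ℂ :=
  U * Matrix.diagonal (fun i => if i ∈ Q then 1 else 0) * W

theorem schmidtPart_univ {A B : Type} [Fintype A] [DecidableEq A] (U : Matrix A A ℂ)
    (W : Matrix A B ℂ) :
    schmidtPart U W Finset.univ = U * W := by
  simp [schmidtPart]

theorem vecOf_schmidtPart_add {A B : Type} [Fintype A] [DecidableEq A] (U : Matrix A A ℂ)
    (W : Matrix A B ℂ) (Q : Finset A) :
    vecOf (schmidtPart U W Q) + vecOf (schmidtPart U W Qᶜ) = vecOf (U * W) := by
  have : schmidtPart U W Q + schmidtPart U W Qᶜ = U * W := by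
    rw [schmidtPart, schmidtPart, ← Matrix.add_mul, ← Matrix.mul_add, Matrix.diagonal_add]
    have e : (fun i => (if i ∈ Q then (1 : ℂ) else 0) + if i ∈ Qᶜ then 1 else 0) = 1 := by
      funext i
      by_cases h : i ∈ Q <;> simp [h]
    rw [e, Matrix.diagonal_one', Matrix.mul_one]
  rw [← this]
  rfl

variable {A B : Type} [Fintype A] [Fintype B]

/-- A measurement of Alice alone sees only her reduced operator `M M†`. -/
theorem quadForm_kronecker_one [DecidableEq B] (E : Matrix A A ℂ) (M : Matrix A B ℂ) :
    quadForm (E ⊗ₖ (1 : Matrix B B ℂ)) (vecOf M) = (E * (M * M.conjTranspose)).trace.re := by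
  unfold quadForm
  congr 1
  simp only [dotProduct, Matrix.mulVec, Fintype.sum_prod_type, Matrix.trace, Matrix.diag,
    Matrix.mul_apply, Matrix.kroneckerMap_apply, Matrix.one_apply, vecOf, Pi.star_apply,
    Matrix.conjTranspose_apply]
  refine Finset.sum_congr rfl fun a _ => ?_
  simp only [mul_ite, ite_mul, mul_one, mul_zero, zero_mul, Finset.sum_ite_eq, Finset.mem_univ,
    if_true, Finset.mul_sum]
  rw [Finset.sum_comm]
  exact Finset.sum_congr rfl fun a' _ => Finset.sum_congr rfl fun b _ => by ring

/-- Positivity of `E ⊗ (t - F)`. This replaces Bob's part by a scalar, after which only Alice's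
diagonal in the Schmidt basis matters. -/
theorem quadForm_kronecker_le [DecidableEq B] {E : Matrix A A ℂ} {F : Matrix B B ℂ} {t : ℝ}
    (hE : E.PosSemidef) (hF : ((t : ℂ) • (1 : Matrix B B ℂ) - F).PosSemidef) (φ : A × B → ℂ) :
    quadForm (E ⊗ₖ F) φ ≤ t * quadForm (E ⊗ₖ (1 : Matrix B B ℂ)) φ := by
  classical
  have h := quadForm_nonneg (hE.kronecker hF) φ
  have e : E ⊗ₖ ((t : ℂ) • (1 : Matrix B B ℂ) - F) =
      (t : ℂ) • (E ⊗ₖ (1 : Matrix B B ℂ)) - E ⊗ₖ F := by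
    ext p q
    simp only [Matrix.kroneckerMap_apply, Matrix.sub_apply, Matrix.smul_apply, smul_eq_mul]
    ring
  rw [e, quadForm_sub, quadForm_smul] at h
  linarith

theorem diag_conj_nonneg {E : Matrix A A ℂ} (hE : E.PosSemidef) (U : Matrix A A ℂ) (i : A) :
    0 ≤ ((U.conjTranspose * E * U) i i).re :=
  (Complex.le_def.1 (hE.conjTranspose_mul_mul_same U).diag_nonneg).1

theorem posSemidef_trace_re_nonneg {S : Type} [Fintype S] {E : Matrix S S ℂ}
    (hE : E.PosSemidef) : 0 ≤ E.trace.re :=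
  (Complex.le_def.1 hE.trace_nonneg).1

theorem trace_kronecker_re {E : Matrix A A ℂ} {F : Matrix B B ℂ} (hE : E.PosSemidef) :
    (E ⊗ₖ F).trace.re = E.trace.re * F.trace.re := by
  rw [Matrix.trace_kronecker, Complex.mul_re]
  have : E.trace.im = 0 := ((Complex.le_def.1 hE.trace_nonneg).2).symm
  rw [this]
  ring

variable [DecidableEq A]

variable {U : Matrix A A ℂ} {W : Matrix A B ℂ} {lam : A → ℝ}

theorem trace_conj_unitary (hU : U.conjTranspose * U = 1) (E : Matrix A A ℂ) :
    ∑ i, (U.conjTranspose * E * U) i i = E.trace := by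
  change (U.conjTranspose * E * U).trace = E.trace
  rw [Matrix.trace_mul_cycle, mul_eq_one_comm.1 hU, Matrix.one_mul]

/-- The rows of `W` are orthogonal, so different Schmidt indices do not interfere for an operator
that acts on Alice only. -/
theorem quadForm_schmidtPart [DecidableEq B]
    (hW : W * W.conjTranspose = Matrix.diagonal fun i => (lam i : ℂ)) (E : Matrix A A ℂ)
    (Q : Finset A) :
    quadForm (E ⊗ₖ (1 : Matrix B B ℂ)) (vecOf (schmidtPart U W Q)) =
      ∑ i ∈ Q, lam i * ((U.conjTranspose * E * U) i i).re := by
  rw [quadForm_kronecker_one]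
  set D : Matrix A A ℂ := Matrix.diagonal (fun i => if i ∈ Q then 1 else 0) with hD
  have hDD : D * (Matrix.diagonal fun i => (lam i : ℂ)) * D.conjTranspose =
      Matrix.diagonal fun i => if i ∈ Q then (lam i : ℂ) else 0 := by
    rw [hD, Matrix.diagonal_conjTranspose, Matrix.diagonal_mul_diagonal,
      Matrix.diagonal_mul_diagonal]
    congr 1
    funext i
    by_cases h : i ∈ Q <;> simp [h]
  have e : schmidtPart U W Q * (schmidtPart U W Q).conjTranspose =
      U * (Matrix.diagonal fun i => if i ∈ Q then (lam i : ℂ) else 0) * U.conjTranspose := by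
    rw [schmidtPart, ← hD, Matrix.conjTranspose_mul, Matrix.conjTranspose_mul, ← hDD, ← hW]
    simp only [Matrix.mul_assoc]
  rw [e, ← Matrix.mul_assoc, Matrix.trace_mul_comm, ← Matrix.mul_assoc, ← Matrix.mul_assoc]
  simp only [Matrix.trace, Matrix.diag, Matrix.mul_diagonal, mul_ite, mul_zero]
  rw [Complex.re_sum]
  rw [← Finset.sum_filter_add_sum_filter_not Finset.univ (· ∈ Q)]
  have z : ∑ i ∈ Finset.univ.filter (fun i => i ∉ Q),
      (if i ∈ Q then (U.conjTranspose * E * U) i i * (lam i : ℂ) else 0).re = 0 := by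
    refine Finset.sum_eq_zero fun i hi => ?_
    rw [if_neg (Finset.mem_filter.1 hi).2, Complex.zero_re]
  rw [z, add_zero, Finset.filter_univ_mem]
  refine Finset.sum_congr rfl fun i hi => ?_
  rw [if_pos hi, Complex.re_mul_ofReal, mul_comm]

variable [DecidableEq B]

/-- A separable operator has a small expectation in a vector with small Schmidt coefficients. -/
theorem IsSeparableOp.quadForm_le {S : Matrix (A × B) (A × B) ℂ} (hS : IsSeparableOp S)
    (hU : U.conjTranspose * U = 1)
    (hW : W * W.conjTranspose = Matrix.diagonal fun i => (lam i : ℂ)) {Q : Finset A} {c : ℝ}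
    (hc : 0 ≤ c) (hQ : ∀ i ∈ Q, lam i ≤ c) :
    quadForm S (vecOf (schmidtPart U W Q)) ≤ c * S.trace.re := by
  obtain ⟨m, E, F, hE, hF, rfl⟩ := hS
  rw [quadForm_sum, Matrix.trace_sum, Complex.re_sum, Finset.mul_sum]
  refine Finset.sum_le_sum fun k _ => ?_
  -- Uses `F ≤ Tr F`; the remaining local expectation is at most `c Tr E`, and the product of the
  -- two traces is the trace of `E ⊗ F`.
  have h1 := quadForm_kronecker_le (hE k) (trace_sub_posSemidef (hF k))
    (vecOf (schmidtPart U W Q))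
  rw [quadForm_schmidtPart hW] at h1
  have h2 : ∑ i ∈ Q, lam i * ((U.conjTranspose * E k * U) i i).re ≤ c * (E k).trace.re := by
    rw [← trace_conj_unitary hU (E k), Complex.re_sum, Finset.mul_sum]
    refine (Finset.sum_le_sum fun i hi =>
      mul_le_mul_of_nonneg_right (hQ i hi) (diag_conj_nonneg (hE k) U i)).trans ?_
    exact Finset.sum_le_sum_of_subset_of_nonneg (Finset.subset_univ Q) fun i _ _ =>
      mul_nonneg hc (diag_conj_nonneg (hE k) U i)
  have h3 := mul_le_mul_of_nonneg_left h2 (posSemidef_trace_re_nonneg (hF k))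
  rw [trace_kronecker_re (hE k)]
  linarith

/-- Lower bound for the trace of an acceptance operator that is small on vectors with small
Schmidt coefficients. -/
theorem trace_ge_of_quadForm_le {S : Matrix (A × B) (A × B) ℂ} (hS : S.PosSemidef)
    (hS1 : (1 - S).PosSemidef) (hU : U.conjTranspose * U = 1)
    (hW : W * W.conjTranspose = Matrix.diagonal fun i => (lam i : ℂ)) {Q : Finset A} {c ε η : ℝ}
    (hη0 : 0 < η) (hη1 : η ≤ 1) (hQ : ∑ i ∈ Q, lam i ≤ 1 - ε - 2 * η) (hε : 0 ≤ ε)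
    (hsmall : quadForm S (vecOf (schmidtPart U W Qᶜ)) ≤ c * S.trace.re)
    (hacc : 1 - ε ≤ quadForm S (vecOf (U * W))) :
    η ^ 2 / 2 ≤ c * S.trace.re := by
  have h1 := quadForm_add_le hS hη0 (vecOf (schmidtPart U W Q)) (vecOf (schmidtPart U W Qᶜ))
  rw [vecOf_schmidtPart_add] at h1
  have h2 : quadForm S (vecOf (schmidtPart U W Q)) ≤ ∑ i ∈ Q, lam i := by
    have h3 := quadForm_nonneg hS1 (vecOf (schmidtPart U W Q))
    have h4 := quadForm_schmidtPart (U := U) hW (1 : Matrix A A ℂ) Q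
    rw [Matrix.one_kronecker_one, Matrix.mul_one, hU] at h4
    simp only [Matrix.one_apply_eq, Complex.one_re, mul_one] at h4
    rw [quadForm_sub, h4] at h3
    linarith
  set a := quadForm S (vecOf (schmidtPart U W Q))
  set b := quadForm S (vecOf (schmidtPart U W Qᶜ))
  -- The large part falls short of `1 - ε` by `2η`; inflating it by `1 + η` uses up at most one `η`.
  -- The other `η` must come from the small part, whose factor `1 + η⁻¹` turns it into order `η²`.
  have h5 : (1 + η) * a ≤ 1 - ε - η := by nlinarith
  have h6 : η ≤ (1 + η⁻¹) * b := by linarith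
  have h7 : η * η ≤ (η + 1) * b := by
    have := mul_le_mul_of_nonneg_left h6 hη0.le
    rwa [← mul_assoc, mul_add, mul_one, mul_inv_cancel₀ hη0.ne'] at this
  have hb : 0 ≤ b := quadForm_nonneg hS _
  nlinarith

/-- Lower bound for the trace of the acceptance operator of a one-way LOCC test. -/
theorem IsLOCC.trace_ge_of_oneWay {X : Type} [Fintype X] {M : X → Matrix (A × B) (A × B) ℂ}
    (hM : IsLOCC X 1 A B M) (x : X) (hU : U.conjTranspose * U = 1)
    (hW : W * W.conjTranspose = Matrix.diagonal fun i => (lam i : ℂ)) (hlam : ∀ i, 0 ≤ lam i)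
    {Q : Finset A} {c ε η : ℝ} (hc : 0 ≤ c) (hQc : ∀ i ∉ Q, lam i ≤ c)
    (hQ : ∑ i ∈ Q, lam i ≤ 1 - ε - η) (hacc : 1 - ε ≤ quadForm (M x) (vecOf (U * W))) :
    η ≤ c * (M x).trace.re := by
  obtain ⟨m, E, F, hE, hF, hEF⟩ := hM.oneWay
  -- The best scalar bound on Bob's element that is available here: `F ≤ 1` makes the dominating
  -- operator a test, and `F ≤ Tr F` keeps its trace below that of `M x`.
  set t : Fin m → ℝ := fun k => min 1 (F k x).trace.re with ht
  have ht0 : ∀ k, 0 ≤ t k := fun k =>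
    le_min zero_le_one (posSemidef_trace_re_nonneg ((hF k).1 x))
  have hFt : ∀ k, (((t k : ℝ) : ℂ) • (1 : Matrix B B ℂ) - F k x).PosSemidef := by
    intro k
    rcases le_total 1 (F k x).trace.re with h | h
    · simp only [ht, min_eq_left h, Complex.ofReal_one, one_smul]
      exact (hF k).le_one x
    · simp only [ht, min_eq_right h]
      exact trace_sub_posSemidef ((hF k).1 x)
  -- The diagonal of Alice's operator `∑ t_k E_k` in the Schmidt basis. With `0 ≤ g ≤ 1` and `∑ g ≤
  -- Tr (M x)` the problem becomes classical, as in the Neyman–Pearson lemma. The bound `g ≤ 1`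
  -- relies on Alice's operators summing to the identity.
  set g : A → ℝ := fun i => ∑ k, t k * ((U.conjTranspose * E k * U) i i).re with hg
  have hg0 : ∀ i, 0 ≤ g i := fun i =>
    Finset.sum_nonneg fun k _ => mul_nonneg (ht0 k) (diag_conj_nonneg (hE.1 k) U i)
  have hg1 : ∀ i, g i ≤ 1 := by
    intro i
    have h1 : g i ≤ ∑ k, ((U.conjTranspose * E k * U) i i).re :=
      Finset.sum_le_sum fun k _ =>
        mul_le_of_le_one_left (diag_conj_nonneg (hE.1 k) U i) (min_le_left _ _)
    refine h1.trans (le_of_eq ?_)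
    rw [← Complex.re_sum, ← Matrix.sum_apply, ← Matrix.sum_mul, ← Matrix.mul_sum, hE.2,
      Matrix.mul_one, hU, Matrix.one_apply_eq, Complex.one_re]
  have hquad : quadForm (M x) (vecOf (U * W)) ≤ ∑ i, lam i * g i := by
    rw [hEF x, quadForm_sum, ← schmidtPart_univ]
    have : ∑ i, lam i * g i =
        ∑ k, t k * ∑ i ∈ Finset.univ, lam i * ((U.conjTranspose * E k * U) i i).re := by
      simp only [hg, Finset.mul_sum]
      rw [Finset.sum_comm]
      exact Finset.sum_congr rfl fun k _ => Finset.sum_congr rfl fun i _ => by ring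
    rw [this]
    refine Finset.sum_le_sum fun k _ => ?_
    have := quadForm_kronecker_le (hE.1 k) (hFt k) (vecOf (schmidtPart U W Finset.univ))
    rwa [quadForm_schmidtPart hW] at this
  have htr : ∑ i, g i ≤ (M x).trace.re := by
    rw [hEF x, Matrix.trace_sum, Complex.re_sum]
    simp only [hg]
    rw [Finset.sum_comm]
    refine Finset.sum_le_sum fun k _ => ?_
    rw [← Finset.mul_sum, ← Complex.re_sum, trace_conj_unitary hU, trace_kronecker_re (hE.1 k),
      mul_comm]
    exact mul_le_mul_of_nonneg_left (min_le_right _ _) (posSemidef_trace_re_nonneg (hE.1 k))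
  have hsplit : ∑ i, lam i * g i ≤ ∑ i ∈ Q, lam i + c * ∑ i, g i := by
    rw [← Finset.sum_add_sum_compl Q, Finset.mul_sum]
    refine add_le_add (Finset.sum_le_sum fun i _ => mul_le_of_le_one_right (hlam i) (hg1 i)) ?_
    refine (Finset.sum_le_sum fun i hi =>
      mul_le_mul_of_nonneg_right (hQc i (Finset.mem_compl.1 hi)) (hg0 i)).trans ?_
    exact Finset.sum_le_sum_of_subset_of_nonneg (Finset.subset_univ _) fun i _ _ =>
      mul_nonneg hc (hg0 i)
  have := mul_le_mul_of_nonneg_left htr hc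
  linarith

end Converse

/-! ### Random subsets -/

section RandomSubset

variable {A : Type} [Fintype A] [DecidableEq A]

/-- The probability of `s` if every `i` is selected independently with the probability `q i`. -/
def subsetWeight (q : A → ℝ) (s : Finset A) : ℝ := (∏ i ∈ s, q i) * ∏ i ∈ sᶜ, (1 - q i)

theorem subsetWeight_nonneg {q : A → ℝ} (h0 : ∀ i, 0 ≤ q i) (h1 : ∀ i, q i ≤ 1) (s : Finset A) :
    0 ≤ subsetWeight q s :=
  mul_nonneg (Finset.prod_nonneg fun i _ => h0 i)
    (Finset.prod_nonneg fun i _ => sub_nonneg.2 (h1 i))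

/-- In the expansion of `∏ (q i + (1 - q i))`, replacing `1 - q i` by `0` for `i ∈ T` removes
exactly the subsets that do not contain `T`. The cases of one and two points give the first and
second moments. -/
theorem sum_subsetWeight_superset (q : A → ℝ) (T : Finset A) :
    ∑ s : Finset A, (if T ⊆ s then subsetWeight q s else 0) = ∏ i ∈ T, q i := by
  have h := Finset.prod_add q (fun i => if i ∈ T then 0 else 1 - q i) Finset.univ
  rw [Finset.powerset_univ] at h
  have hl : ∏ i, (q i + if i ∈ T then 0 else 1 - q i) = ∏ i ∈ T, q i := by
    rw [← Finset.prod_subset (Finset.subset_univ T)]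
    · exact Finset.prod_congr rfl fun i hi => by simp [hi]
    · intro i _ hi
      simp [hi]
  rw [← hl, h]
  refine Finset.sum_congr rfl fun s _ => ?_
  rw [← Finset.compl_eq_univ_sdiff]
  split_ifs with hT
  · rw [subsetWeight]
    congr 1
    refine Finset.prod_congr rfl fun i hi => ?_
    rw [if_neg fun h => Finset.mem_compl.1 hi (hT h)]
  · obtain ⟨i, hi, his⟩ := Finset.not_subset.1 hT
    have h0 : ∏ i ∈ sᶜ, (if i ∈ T then 0 else 1 - q i) = 0 :=
      Finset.prod_eq_zero (Finset.mem_compl.2 his) (if_pos hi)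
    rw [h0, mul_zero]

theorem sum_subsetWeight (q : A → ℝ) : ∑ s : Finset A, subsetWeight q s = 1 := by
  simpa using sum_subsetWeight_superset q ∅

theorem sum_subsetWeight_mem (q : A → ℝ) (i : A) :
    ∑ s : Finset A, (if i ∈ s then subsetWeight q s else 0) = q i := by
  simpa using sum_subsetWeight_superset q {i}

theorem sum_subsetWeight_mul_sum (q x : A → ℝ) (P : Finset A) :
    ∑ s : Finset A, subsetWeight q s * ∑ i ∈ s ∩ P, x i = ∑ i ∈ P, q i * x i := by
  have : ∀ s : Finset A, subsetWeight q s * ∑ i ∈ s ∩ P, x i =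
      ∑ i ∈ P, (if i ∈ s then subsetWeight q s else 0) * x i := by
    intro s
    rw [Finset.inter_comm, ← Finset.filter_mem_eq_inter, Finset.sum_filter, Finset.mul_sum]
    exact Finset.sum_congr rfl fun i _ => by split_ifs <;> simp
  simp only [this]
  rw [Finset.sum_comm]
  refine Finset.sum_congr rfl fun i _ => ?_
  rw [← Finset.sum_mul, sum_subsetWeight_mem]

/-- Distinct memberships are independent, so off-diagonal terms are products of means. On the
diagonal the square of the mean is added, which makes this an inequality. -/
theorem sum_subsetWeight_mul_sum_sq_le (q x : A → ℝ)
    (P : Finset A) :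
    ∑ s : Finset A, subsetWeight q s * (∑ i ∈ s ∩ P, x i) ^ 2 ≤
      (∑ i ∈ P, q i * x i) ^ 2 + ∑ i ∈ P, q i * x i ^ 2 := by
  have e : ∀ s : Finset A, subsetWeight q s * (∑ i ∈ s ∩ P, x i) ^ 2 =
      ∑ i ∈ P, ∑ j ∈ P, (if {i, j} ⊆ s then subsetWeight q s else 0) * (x i * x j) := by
    intro s
    have e1 : ∑ i ∈ s ∩ P, x i = ∑ i ∈ P, if i ∈ s then x i else 0 := by
      rw [Finset.inter_comm, ← Finset.filter_mem_eq_inter, Finset.sum_filter]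
    rw [e1, pow_two, Finset.sum_mul_sum, Finset.mul_sum]
    refine Finset.sum_congr rfl fun i _ => ?_
    rw [Finset.mul_sum]
    refine Finset.sum_congr rfl fun j _ => ?_
    by_cases hi : i ∈ s <;> by_cases hj : j ∈ s <;> simp [hi, hj, Finset.insert_subset_iff]
  simp only [e]
  rw [Finset.sum_comm]
  have e2 : ∀ i ∈ P, ∑ s : Finset A, ∑ j ∈ P,
      (if {i, j} ⊆ s then subsetWeight q s else 0) * (x i * x j) ≤
        ∑ j ∈ P, (q i * x i) * (q j * x j) + q i * x i ^ 2 := by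
    intro i hi
    rw [Finset.sum_comm]
    have e3 : ∀ j ∈ P, ∑ s : Finset A,
        (if {i, j} ⊆ s then subsetWeight q s else 0) * (x i * x j) ≤
          (q i * x i) * (q j * x j) + if j = i then q i * x i ^ 2 else 0 := by
      intro j _
      rw [← Finset.sum_mul, sum_subsetWeight_superset]
      by_cases hij : j = i
      · subst hij
        simp only [Finset.pair_eq_singleton, Finset.prod_singleton, if_true]
        nlinarith [mul_self_nonneg (q j * x j)]
      · rw [Finset.prod_pair (Ne.symm hij), if_neg hij]
        exact le_of_eq (by ring)
    refine (Finset.sum_le_sum e3).trans (le_of_eq ?_)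
    rw [Finset.sum_add_distrib, Finset.sum_ite_eq', if_pos hi]
  refine (Finset.sum_le_sum e2).trans (le_of_eq ?_)
  rw [Finset.sum_add_distrib, pow_two, Finset.sum_mul_sum]

end RandomSubset

/-! ### Signs -/

/-- Distinct coordinates of a uniformly random sign vector are uncorrelated. -/
theorem sum_signs_mul {A : Type} [Fintype A] [DecidableEq A] (i j : A) :
    ∑ ε : A → ℤˣ, (((ε i : ℤ) : ℂ) * ((ε j : ℤ) : ℂ)) =
      if i = j then (Fintype.card (A → ℤˣ) : ℂ) else 0 := by
  split_ifs with hij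
  · subst hij
    have : ∀ ε : A → ℤˣ, ((ε i : ℤ) : ℂ) * ((ε i : ℤ) : ℂ) = 1 := fun ε => by
      rw [← Int.cast_mul, ← Units.val_mul, Int.units_mul_self]
      simp
    simp [this]
  -- Flipping the `i`-th sign is a bijection that negates the sum.
  · have h := Equiv.sum_comp (Equiv.mulRight (Pi.mulSingle i (-1) : A → ℤˣ))
      fun ε : A → ℤˣ => (((ε i : ℤ) : ℂ) * ((ε j : ℤ) : ℂ))
    simp only [Equiv.coe_mulRight, Pi.mul_apply, Pi.mulSingle_eq_same,
      Pi.mulSingle_eq_of_ne (Ne.symm hij), mul_one, mul_neg, Units.val_neg, Int.cast_neg,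
      neg_mul, Finset.sum_neg_distrib] at h
    linear_combination (-1 / 2 : ℂ) * h

/-! ### Tests that attain the bounds -/

section Achievability

theorem one_sub_posSemidef {S : Type} [Fintype S] [DecidableEq S] {Q : Matrix S S ℂ}
    (h1 : Q.conjTranspose = Q) (h2 : Q * Q = Q) : (1 - Q).PosSemidef := by
  have : (1 - Q) = (1 - Q).conjTranspose * (1 - Q) := by
    rw [Matrix.conjTranspose_sub, Matrix.conjTranspose_one, h1, Matrix.sub_mul, Matrix.mul_sub,
      Matrix.mul_sub, h2]
    simp
  rw [this]
  exact Matrix.posSemidef_conjTranspose_mul_self _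

theorem one_sub_vecMulVec_posSemidef {S : Type} [Fintype S] [DecidableEq S] {v : S → ℂ}
    (h : star v ⬝ᵥ v = 1) : (1 - Matrix.vecMulVec v (star v)).PosSemidef := by
  refine one_sub_posSemidef ?_ ?_
  · rw [Matrix.conjTranspose_vecMulVec, star_star]
  · rw [Matrix.vecMulVec_mul_vecMulVec, h]
    simp

/-- The two-valued measurement that accepts the unit vector `v`. -/
theorem isPOVM_rankOne {S : Type} [Fintype S] [DecidableEq S] {v : S → ℂ}
    (h : star v ⬝ᵥ v = 1) :
    IsPOVM ![1 - Matrix.vecMulVec v (star v), Matrix.vecMulVec v (star v)] := by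
  refine ⟨fun x => ?_, by simp⟩
  fin_cases x
  · exact one_sub_vecMulVec_posSemidef h
  · exact Matrix.posSemidef_vecMulVec_self_star v

theorem isPOVM_reject {S : Type} [Fintype S] [DecidableEq S] :
    IsPOVM ![(1 : Matrix S S ℂ), 0] := by
  refine ⟨fun x => ?_, by simp⟩
  fin_cases x
  · exact Matrix.PosSemidef.one
  · exact Matrix.PosSemidef.zero

/-- The product vector `a ⊗ b`. -/
def prodVec {A B : Type} (a : A → ℂ) (b : B → ℂ) : A × B → ℂ := fun p => a p.1 * b p.2

theorem vecMulVec_kronecker {A B : Type} (a : A → ℂ) (b : B → ℂ) :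
    Matrix.vecMulVec a (star a) ⊗ₖ Matrix.vecMulVec b (star b) =
      Matrix.vecMulVec (prodVec a b) (star (prodVec a b)) := by
  ext p q
  simp only [Matrix.kroneckerMap_apply, Matrix.vecMulVec_apply, prodVec, Pi.star_apply, star_mul']
  ring

variable {A B : Type} [Fintype A] [DecidableEq A] [Fintype B]
  {U : Matrix A A ℂ} {W : Matrix A B ℂ} {lam : A → ℝ}

/-- The isometry on Bob's side that sends the basis vector `i ∈ t` to the Schmidt vector of `i`. -/
def bobIso (W : Matrix A B ℂ) (lam : A → ℝ) (t : Finset A) : Matrix B A ℂ :=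
  W.transpose * Matrix.diagonal fun i => if i ∈ t then ((√(lam i))⁻¹ : ℂ) else 0

/-- The factors `λ_i^{-1/2}` normalize the orthogonal rows of `W`; positivity on `t` is what allows
the division. -/
theorem bobIso_conjTranspose_mul
    (hW : W * W.conjTranspose = Matrix.diagonal fun i => (lam i : ℂ)) {t : Finset A}
    (ht : ∀ i ∈ t, 0 < lam i) :
    (bobIso W lam t).conjTranspose * bobIso W lam t =
      Matrix.diagonal fun i => if i ∈ t then 1 else 0 := by
  have hWt : W.transpose.conjTranspose * W.transpose = Matrix.diagonal fun i => (lam i : ℂ) := by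
    have := congrArg Matrix.transpose hW
    rw [Matrix.transpose_mul, Matrix.diagonal_transpose] at this
    rw [← this]
    rfl
  rw [bobIso, Matrix.conjTranspose_mul, Matrix.mul_assoc, ← Matrix.mul_assoc _ W.transpose, hWt,
    Matrix.diagonal_conjTranspose, Matrix.diagonal_mul_diagonal, Matrix.diagonal_mul_diagonal]
  congr 1
  funext i
  by_cases h : i ∈ t
  · have hp := ht i h
    have hs : (√(lam i) : ℂ) ≠ 0 := by exact_mod_cast (Real.sqrt_pos.2 hp).ne'
    have hsq : (lam i : ℂ) = (√(lam i) : ℂ) * (√(lam i) : ℂ) := by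
      exact_mod_cast (Real.mul_self_sqrt hp.le).symm
    simp only [h, if_true, Pi.star_apply, star_inv₀, Complex.star_def, Complex.conj_ofReal]
    rw [hsq]
    field_simp
  · simp [h]

/-- The overlap of a product vector with the bipartite state. -/
theorem overlap_eq (hU : U.conjTranspose * U = 1)
    (hW : W * W.conjTranspose = Matrix.diagonal fun i => (lam i : ℂ)) {t : Finset A}
    (ht : ∀ i ∈ t, 0 < lam i) (α β : A → ℂ) :
    star (prodVec (U.mulVec α) ((bobIso W lam t).mulVec β)) ⬝ᵥ vecOf (U * W) =
      ∑ i ∈ t, star (α i) * (√(lam i) : ℂ) * star (β i) := by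
  have e1 : ∀ (a : A → ℂ) (b : B → ℂ) (M : Matrix A B ℂ),
      star (prodVec a b) ⬝ᵥ vecOf M = star a ⬝ᵥ M.mulVec (star b) := by
    intro a b M
    simp only [dotProduct, Fintype.sum_prod_type, prodVec, vecOf, Matrix.mulVec, Pi.star_apply,
      star_mul', Finset.mul_sum]
    exact Finset.sum_congr rfl fun i _ => Finset.sum_congr rfl fun j _ => by ring
  have e2 : star ((bobIso W lam t).mulVec β) = W.conjTranspose.mulVec
      ((Matrix.diagonal fun i => if i ∈ t then ((√(lam i))⁻¹ : ℂ) else 0).mulVec (star β)) := by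
    have : star ((bobIso W lam t).mulVec β) = ((bobIso W lam t).map star).mulVec (star β) := by
      funext b
      simp [Matrix.mulVec, dotProduct, mul_comm]
    rw [this, Matrix.mulVec_mulVec, bobIso]
    congr 1
    ext b i
    simp only [Matrix.map_apply, Matrix.mul_diagonal, Matrix.transpose_apply,
      Matrix.conjTranspose_apply, star_mul']
    split_ifs <;> simp
  rw [e1, e2, Matrix.mulVec_mulVec, Matrix.mul_assoc, hW, ← Matrix.mulVec_mulVec,
    Matrix.star_mulVec, Matrix.dotProduct_mulVec, Matrix.vecMul_vecMul, hU, Matrix.vecMul_one,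
    Matrix.mulVec_mulVec, Matrix.diagonal_mul_diagonal]
  simp only [dotProduct, Matrix.mulVec_diagonal, Pi.star_apply]
  rw [← Finset.sum_subset (Finset.subset_univ t)]
  · refine Finset.sum_congr rfl fun i hi => ?_
    have hp := ht i hi
    have hs : (√(lam i) : ℂ) ≠ 0 := by exact_mod_cast (Real.sqrt_pos.2 hp).ne'
    have hsq : (lam i : ℂ) = (√(lam i) : ℂ) * (√(lam i) : ℂ) := by
      exact_mod_cast (Real.mul_self_sqrt hp.le).symm
    rw [if_pos hi, hsq]
    field_simp
  · intro i _ hi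
    simp [hi]

theorem star_mulVec_dotProduct_mulVec {S S' : Type} [Fintype S] [Fintype S']
    (V : Matrix S S' ℂ) (x : S' → ℂ) :
    star (V.mulVec x) ⬝ᵥ V.mulVec x = star x ⬝ᵥ (V.conjTranspose * V).mulVec x := by
  rw [Matrix.star_mulVec, Matrix.dotProduct_mulVec, Matrix.vecMul_vecMul, ← Matrix.dotProduct_mulVec]

variable [DecidableEq B]

/-- Both parties measure in their Schmidt bases, and they accept if they find the same index in
`P`. -/
theorem exists_oneWay_test (hU : U.conjTranspose * U = 1)
    (hW : W * W.conjTranspose = Matrix.diagonal fun i => (lam i : ℂ)) {P : Finset A}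
    (hP : ∀ i ∈ P, 0 < lam i) :
    ∃ M : Fin 2 → Matrix (A × B) (A × B) ℂ, IsLOCC (Fin 2) 1 A B M ∧
      quadForm (M 1) (vecOf (U * W)) = ∑ i ∈ P, lam i ∧ (M 1).trace.re = P.card := by
  set u : A → A → ℂ := fun i => U.mulVec (Pi.single i 1) with hu
  set f : A → B → ℂ := fun i => (bobIso W lam P).mulVec (Pi.single i 1) with hf
  have hu1 : ∀ i, star (u i) ⬝ᵥ u i = 1 := by
    intro i
    rw [hu, star_mulVec_dotProduct_mulVec, hU]
    simp [dotProduct, Pi.single_apply]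
  have hf1 : ∀ i ∈ P, star (f i) ⬝ᵥ f i = 1 := by
    intro i hi
    rw [hf, star_mulVec_dotProduct_mulVec, bobIso_conjTranspose_mul hW hP]
    simp [dotProduct, Pi.single_apply, Matrix.mulVec_diagonal, hi]
  have hE : IsPOVM fun i => Matrix.vecMulVec (u i) (star (u i)) := by
    refine ⟨fun i => Matrix.posSemidef_vecMulVec_self_star _, ?_⟩
    rw [← mul_eq_one_comm.1 hU]
    ext a b
    simp [Matrix.sum_apply, Matrix.mul_apply, Matrix.vecMulVec_apply, hu]
  set F : A → Fin 2 → Matrix B B ℂ := fun i =>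
    if i ∈ P then ![1 - Matrix.vecMulVec (f i) (star (f i)), Matrix.vecMulVec (f i) (star (f i))]
    else ![1, 0] with hFdef
  have hF : ∀ i, IsPOVM (F i) := by
    intro i
    by_cases h : i ∈ P
    · simp only [hFdef, if_pos h]
      exact isPOVM_rankOne (hf1 i h)
    · simp only [hFdef, if_neg h]
      exact isPOVM_reject
  refine ⟨_, isLOCC_one hE hF, ?_⟩
  have hS : ∑ i, Matrix.vecMulVec (u i) (star (u i)) ⊗ₖ F i 1 =
      ∑ i ∈ P, Matrix.vecMulVec (prodVec (u i) (f i)) (star (prodVec (u i) (f i))) := by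
    rw [← Finset.sum_subset (Finset.subset_univ P)]
    · refine Finset.sum_congr rfl fun i hi => ?_
      rw [← vecMulVec_kronecker]
      simp [hFdef, hi]
    · intro i _ hi
      simp [hFdef, hi]
  simp only [hS]
  constructor
  · rw [quadForm_sum]
    refine Finset.sum_congr rfl fun i hi => ?_
    rw [quadForm_vecMulVec, hu, hf, overlap_eq hU hW hP]
    simp [Pi.single_apply, hi, Complex.normSq_ofReal, Real.mul_self_sqrt (hP i hi).le]
  · rw [Matrix.trace_sum, Complex.re_sum]
    have : ∀ i ∈ P, (Matrix.vecMulVec (prodVec (u i) (f i))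
        (star (prodVec (u i) (f i)))).trace.re = 1 := by
      intro i hi
      rw [← vecMulVec_kronecker, Matrix.trace_kronecker, Matrix.trace_vecMulVec,
        Matrix.trace_vecMulVec, dotProduct_comm, hu1, dotProduct_comm, hf1 i hi]
      simp
    rw [Finset.sum_congr rfl this]
    simp

end Achievability

/-! ### The two-round test: random subsets, random signs and a final projection. -/

section TwoRounds

theorem mul_vecMulVec_mul_conjTranspose {S S' : Type} [Fintype S'] (V : Matrix S S' ℂ)
    (x : S' → ℂ) :
    V * Matrix.vecMulVec x (star x) * V.conjTranspose =
      Matrix.vecMulVec (V.mulVec x) (star (V.mulVec x)) := by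
  rw [Matrix.mul_vecMulVec, Matrix.vecMulVec_mul, Matrix.star_mulVec]

/-- A sign vector as a complex vector. -/
def signVec {A : Type} (ε : A → ℤˣ) : A → ℂ := fun i => ((ε i : ℤ) : ℂ)

theorem star_signVec_mul {A : Type} (ε : A → ℤˣ) (i : A) :
    star (signVec ε i) * signVec ε i = 1 := by
  rw [signVec, star_intCast, ← Int.cast_mul, ← Units.val_mul, Int.units_mul_self]
  simp

theorem star_signVec {A : Type} (ε : A → ℤˣ) (i : A) : star (signVec ε i) = signVec ε i := by
  rw [signVec, star_intCast]

variable {A : Type} [Fintype A] [DecidableEq A]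

/-- Averaging over signs removes the off-diagonal entries. Sign vectors thus resolve the identity by
vectors that are flat in the Schmidt basis, so Bob's outcome reveals nothing about the index. -/
theorem sum_vecMulVec_signVec :
    ∑ ε : A → ℤˣ, ((Fintype.card (A → ℤˣ) : ℂ)⁻¹) •
      Matrix.vecMulVec (signVec ε) (star (signVec ε)) = 1 := by
  ext i j
  have h := sum_signs_mul i j
  have e : ∀ ε : A → ℤˣ, signVec ε i * star (signVec ε j) = ((ε i : ℤ) : ℂ) * ((ε j : ℤ) : ℂ) :=
    fun ε => by rw [star_signVec]; rfl
  rw [← Finset.smul_sum, Matrix.smul_apply, Matrix.sum_apply]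
  simp only [Matrix.vecMulVec_apply, Pi.star_apply, e]
  rw [h, Matrix.one_apply]
  split_ifs
  · rw [smul_eq_mul, inv_mul_cancel₀]
    exact Nat.cast_ne_zero.2 Fintype.card_ne_zero
  · simp

variable {B : Type} [Fintype B] [DecidableEq B]
  {U : Matrix A A ℂ} {W : Matrix A B ℂ} {lam : A → ℝ}

/-- Bob's measurement: random signs in the span of the Schmidt vectors in `t`. -/
def bobPOVM (W : Matrix A B ℂ) (lam : A → ℝ) (t : Finset A) :
    Option (A → ℤˣ) → Matrix B B ℂ
  | some ε => ((Fintype.card (A → ℤˣ) : ℂ)⁻¹) •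
      Matrix.vecMulVec ((bobIso W lam t).mulVec (signVec ε))
        (star ((bobIso W lam t).mulVec (signVec ε)))
  | none => 1 - bobIso W lam t * (bobIso W lam t).conjTranspose

/-- The sign outcomes add up to the projection `V V†` onto the chosen span; `none` is its
complement. -/
theorem isPOVM_bobPOVM
    (hW : W * W.conjTranspose = Matrix.diagonal fun i => (lam i : ℂ)) {t : Finset A}
    (ht : ∀ i ∈ t, 0 < lam i) : IsPOVM (bobPOVM W lam t) := by
  have hV := bobIso_conjTranspose_mul hW ht
  set V := bobIso W lam t with hVdef
  have hVV : V * (V.conjTranspose * V) = V := by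
    rw [hV, hVdef, bobIso, Matrix.mul_assoc, Matrix.diagonal_mul_diagonal]
    congr 2
    funext i
    by_cases h : i ∈ t <;> simp [h]
  refine ⟨fun j => ?_, ?_⟩
  · cases j with
    | some ε =>
      refine (Matrix.posSemidef_vecMulVec_self_star _).smul ?_
      rw [← Complex.ofReal_natCast, ← Complex.ofReal_inv]
      exact Complex.zero_le_real.2 (by positivity)
    | none =>
      refine one_sub_posSemidef ?_ ?_
      · rw [Matrix.conjTranspose_mul, Matrix.conjTranspose_conjTranspose]
      · rw [Matrix.mul_assoc, ← Matrix.mul_assoc V.conjTranspose, ← Matrix.mul_assoc, hVV]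
  · rw [Fintype.sum_option]
    simp only [bobPOVM, ← hVdef, ← mul_vecMulVec_mul_conjTranspose]
    have : ∀ ε : A → ℤˣ, ((Fintype.card (A → ℤˣ) : ℂ)⁻¹) •
        (V * Matrix.vecMulVec (signVec ε) (star (signVec ε)) * V.conjTranspose) =
        V * (((Fintype.card (A → ℤˣ) : ℂ)⁻¹) • Matrix.vecMulVec (signVec ε) (star (signVec ε))) *
          V.conjTranspose := fun ε => by
      rw [Matrix.mul_smul, Matrix.smul_mul]
    simp only [this]
    rw [← Matrix.sum_mul, ← Matrix.mul_sum, sum_vecMulVec_signVec, Matrix.mul_one]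
    simp

/-- The state that Alice expects in the last step. -/
def aliceVec (lam : A → ℝ) (t : Finset A) (ε : A → ℤˣ) : A → ℂ := fun i =>
  if i ∈ t then ((√(√(lam i) / ∑ k ∈ t, √(lam k)) : ℝ) : ℂ) * signVec ε i else 0

theorem aliceVec_unit {t : Finset A} (hX : 0 < ∑ k ∈ t, √(lam k)) (ε : A → ℤˣ) :
    star (aliceVec lam t ε) ⬝ᵥ aliceVec lam t ε = 1 := by
  have e : ∀ i, star (aliceVec lam t ε i) * aliceVec lam t ε i =
      if i ∈ t then ((√(lam i) / ∑ k ∈ t, √(lam k) : ℝ) : ℂ) else 0 := by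
    intro i
    unfold aliceVec
    split_ifs with h
    · rw [star_mul', mul_mul_mul_comm, star_signVec_mul, mul_one, Complex.star_def,
        Complex.conj_ofReal, ← Complex.ofReal_mul, Real.mul_self_sqrt]
      exact div_nonneg (Real.sqrt_nonneg _) hX.le
    · simp
  simp only [dotProduct, Pi.star_apply, e]
  rw [Finset.sum_ite_mem, Finset.univ_inter, ← Complex.ofReal_sum, ← Finset.sum_div,
    div_self hX.ne', Complex.ofReal_one]

/-- Alice applies a filter to a random subset of her Schmidt basis, Bob measures random signs in the
corresponding subspace, and Alice checks whether her state is the one that remains of the bipartite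
state. -/
theorem exists_twoRound_test (hU : U.conjTranspose * U = 1)
    (hW : W * W.conjTranspose = Matrix.diagonal fun i => (lam i : ℂ)) (hlam1 : ∀ i, lam i ≤ 1)
    {P : Finset A} (hP : ∀ i ∈ P, 0 < lam i) {m : ℝ} (hm : ∑ i ∈ P, lam i = m) (hm0 : 0 < m) :
    ∃ M : Fin 2 → Matrix (A × B) (A × B) ℂ, IsLOCC (Fin 2) 2 A B M ∧
      m - 2 / m * ∑ i ∈ P, lam i * √(lam i) ≤ quadForm (M 1) (vecOf (U * W)) ∧
      (M 1).trace.re ≤ 2 / m * ((∑ i ∈ P, √(lam i)) ^ 2 + ∑ i ∈ P, √(lam i)) := by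
  -- Selecting `i` with probability `√λ_i` makes the mean of `X = ∑_{i ∈ s ∩ P} √λ_i` equal to `m`
  -- and the mean size of `s ∩ P` equal to `∑ √λ_i`. Outside `P` any positive value would do; those
  -- indices are discarded by Bob.
  set q : A → ℝ := fun i => if i ∈ P then √(lam i) else 1 with hq
  have hq0 : ∀ i, 0 < q i := by
    intro i
    simp only [hq]
    split_ifs with h
    · exact Real.sqrt_pos.2 (hP i h)
    · exact one_pos
  have hq1 : ∀ i, q i ≤ 1 := by
    intro i
    simp only [hq]
    split_ifs with h
    · exact Real.sqrt_le_one.2 (hlam1 i)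
    · exact le_rfl
  have hqP : ∀ i ∈ P, q i = √(lam i) := fun i hi => if_pos hi
  set w : Finset A → ℝ := subsetWeight q with hw
  have hw0 : ∀ s, 0 ≤ w s := subsetWeight_nonneg (fun i => (hq0 i).le) hq1
  set X : Finset A → ℝ := fun s => ∑ i ∈ s ∩ P, √(lam i) with hX
  have hlamt : ∀ s : Finset A, ∀ i ∈ s ∩ P, 0 < lam i := fun s i hi =>
    hP i (Finset.mem_inter.1 hi).2
  -- Dividing by `q i` makes the filters add up to the identity. On `s ∩ P` a filter turns the
  -- amplitude `λ_i^{1/2}` into `√w · λ_i^{1/4}`.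
  set g : Finset A → A → ℝ := fun s i => if i ∈ s then w s / q i else 0 with hg
  have hg0 : ∀ s i, 0 ≤ g s i := by
    intro s i
    simp only [hg]
    split_ifs
    · exact div_nonneg (hw0 s) (hq0 i).le
    · exact le_rfl
  set D : Finset A → Matrix A A ℂ := fun s => Matrix.diagonal fun i => ((√(g s i) : ℝ) : ℂ) with hD
  have hDD : ∀ s, (D s).conjTranspose * D s = Matrix.diagonal fun i => (g s i : ℂ) := by
    intro s
    rw [hD, Matrix.diagonal_conjTranspose, Matrix.diagonal_mul_diagonal]
    congr 1
    funext i
    rw [Pi.star_apply, Complex.star_def, Complex.conj_ofReal, ← Complex.ofReal_mul,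
      Real.mul_self_sqrt (hg0 s i)]
  set K : Finset A → Matrix A A ℂ := fun s => D s * U.conjTranspose with hK
  have hKsum : ∑ s, (K s).conjTranspose * K s = 1 := by
    have e : ∀ s, (K s).conjTranspose * K s =
        U * (Matrix.diagonal fun i => (g s i : ℂ)) * U.conjTranspose := by
      intro s
      rw [← hDD s, hK, Matrix.conjTranspose_mul, Matrix.conjTranspose_conjTranspose]
      simp only [Matrix.mul_assoc]
    simp only [e]
    rw [← Matrix.sum_mul, ← Matrix.mul_sum]
    have e2 : ∑ s, (Matrix.diagonal fun i => (g s i : ℂ)) = (1 : Matrix A A ℂ) := by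
      ext i j
      rw [Matrix.sum_apply, Matrix.one_apply]
      by_cases hij : i = j
      · subst hij
        simp only [Matrix.diagonal_apply_eq, if_true]
        rw [← Complex.ofReal_sum]
        have : ∑ s, g s i = (∑ s, if i ∈ s then w s else 0) / q i := by
          rw [Finset.sum_div]
          refine Finset.sum_congr rfl fun s _ => ?_
          simp only [hg]
          split_ifs <;> simp
        rw [this, hw, sum_subsetWeight_mem, div_self (hq0 i).ne', Complex.ofReal_one]
      · simp [hij]
    rw [e2, Matrix.mul_one, mul_eq_one_comm.1 hU]
  -- Subsets with atypically small `X` are rejected, so that `1/X` stays below `2/m` in the trace.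
  -- Bob's outcome `none` is rejected as well.
  set G : Finset A → Option (A → ℤˣ) → Fin 2 → Matrix A A ℂ := fun s j =>
    j.elim ![1, 0] fun ε => if m / 2 ≤ X s then
      ![1 - Matrix.vecMulVec (aliceVec lam (s ∩ P) ε) (star (aliceVec lam (s ∩ P) ε)),
        Matrix.vecMulVec (aliceVec lam (s ∩ P) ε) (star (aliceVec lam (s ∩ P) ε))]
      else ![1, 0] with hG
  have hGP : ∀ s j, IsPOVM (G s j) := by
    intro s j
    cases j with
    | none => exact isPOVM_reject
    | some ε =>
      simp only [hG, Option.elim_some]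
      split_ifs with h
      · exact isPOVM_rankOne (aliceVec_unit (lt_of_lt_of_le (half_pos hm0) h) ε)
      · exact isPOVM_reject
  refine ⟨_, isLOCC_two hKsum (fun s => isPOVM_bobPOVM hW (hlamt s)) hGP, ?_⟩
  set N : ℂ := (Fintype.card (A → ℤˣ) : ℂ)⁻¹ with hN
  set a : Finset A → (A → ℤˣ) → A → ℂ := fun s ε => U.mulVec fun i =>
    if i ∈ s ∩ P then ((√(w s / X s) : ℝ) : ℂ) * signVec ε i else 0 with ha
  set b : Finset A → (A → ℤˣ) → B → ℂ := fun s ε =>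
    (bobIso W lam (s ∩ P)).mulVec (signVec ε) with hb
  -- Pulled back through the filter, the factors `λ_i^{±1/4}` cancel: Alice's effective vector is
  -- flat on `s ∩ P`.
  have hKa : ∀ s ε, (K s).conjTranspose.mulVec (aliceVec lam (s ∩ P) ε) = a s ε := by
    intro s ε
    rw [hK, Matrix.conjTranspose_mul, Matrix.conjTranspose_conjTranspose, ← Matrix.mulVec_mulVec,
      ha, hD, Matrix.diagonal_conjTranspose]
    congr 1
    funext i
    rw [Matrix.mulVec_diagonal, aliceVec, Pi.star_apply, Complex.star_def, Complex.conj_ofReal]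
    by_cases h : i ∈ s ∩ P
    · have his := (Finset.mem_inter.1 h).1
      have hiP := (Finset.mem_inter.1 h).2
      have hl : 0 < √(lam i) := Real.sqrt_pos.2 (hP i hiP)
      rw [if_pos h, if_pos h, ← mul_assoc, ← Complex.ofReal_mul, ← Real.sqrt_mul (hg0 s i)]
      congr 3
      simp only [hg, if_pos his, hqP i hiP, hX]
      field_simp
    · rw [if_neg h, if_neg h, mul_zero]
  have hacc : ∀ s, ∑ j, ((K s).conjTranspose * G s j 1 * K s) ⊗ₖ bobPOVM W lam (s ∩ P) j =
      if m / 2 ≤ X s then ∑ ε : A → ℤˣ,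
        N • Matrix.vecMulVec (prodVec (a s ε) (b s ε)) (star (prodVec (a s ε) (b s ε))) else 0 := by
    intro s
    rw [Fintype.sum_option]
    have h0 : G s none 1 = 0 := rfl
    rw [h0, Matrix.mul_zero, Matrix.zero_mul, Matrix.zero_kronecker, zero_add]
    split_ifs with h
    · refine Finset.sum_congr rfl fun ε _ => ?_
      have h1 : G s (some ε) 1 = Matrix.vecMulVec (aliceVec lam (s ∩ P) ε)
          (star (aliceVec lam (s ∩ P) ε)) := by
        simp only [hG, Option.elim_some, if_pos h]
        rfl
      have h2 := mul_vecMulVec_mul_conjTranspose (K s).conjTranspose (aliceVec lam (s ∩ P) ε)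
      rw [Matrix.conjTranspose_conjTranspose, hKa] at h2
      rw [h1, h2, bobPOVM, Matrix.kronecker_smul, vecMulVec_kronecker]
    · refine Finset.sum_eq_zero fun ε _ => ?_
      have h1 : G s (some ε) 1 = 0 := by
        simp only [hG, Option.elim_some, if_neg h]
        rfl
      rw [h1, Matrix.mul_zero, Matrix.zero_mul, Matrix.zero_kronecker]
  have hNr : N = (((Fintype.card (A → ℤˣ) : ℝ)⁻¹ : ℝ) : ℂ) := by
    rw [hN]
    push_cast
    rfl
  have hcard : ∀ c : ℝ, ∑ _ε : A → ℤˣ, (Fintype.card (A → ℤˣ) : ℝ)⁻¹ * c = c := by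
    intro c
    rw [Finset.sum_const, Finset.card_univ, nsmul_eq_mul, ← mul_assoc, mul_inv_cancel₀, one_mul]
    exact Nat.cast_ne_zero.2 Fintype.card_ne_zero
  -- The two signs cancel, so all amplitudes add coherently to `√(w/X) · X`.
  have hquad : ∀ s ε, m / 2 ≤ X s →
      quadForm (Matrix.vecMulVec (prodVec (a s ε) (b s ε)) (star (prodVec (a s ε) (b s ε))))
        (vecOf (U * W)) = w s * X s := by
    intro s ε hs
    have hX0 : 0 < X s := lt_of_lt_of_le (half_pos hm0) hs
    rw [quadForm_vecMulVec, ha, hb, overlap_eq hU hW (hlamt s)]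
    have : ∑ i ∈ s ∩ P, star (if i ∈ s ∩ P then ((√(w s / X s) : ℝ) : ℂ) * signVec ε i else 0) *
        (√(lam i) : ℂ) * star (signVec ε i) = ((√(w s / X s) * X s : ℝ) : ℂ) := by
      rw [hX, Finset.mul_sum, Complex.ofReal_sum]
      refine Finset.sum_congr rfl fun i hi => ?_
      rw [if_pos hi, star_mul', Complex.star_def, Complex.conj_ofReal, ← Complex.star_def]
      have := star_signVec_mul ε i
      rw [star_signVec] at this ⊢
      push_cast
      linear_combination ((√(w s / X s) : ℝ) : ℂ) * (√(lam i) : ℂ) * this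
    rw [this, Complex.normSq_ofReal, mul_mul_mul_comm,
      Real.mul_self_sqrt (div_nonneg (hw0 s) hX0.le)]
    field_simp
  have htrace : ∀ s ε, m / 2 ≤ X s →
      (Matrix.vecMulVec (prodVec (a s ε) (b s ε)) (star (prodVec (a s ε) (b s ε)))).trace =
        ((w s / X s * ((s ∩ P).card : ℝ) ^ 2 : ℝ) : ℂ) := by
    intro s ε hs
    have hX0 : 0 < X s := lt_of_lt_of_le (half_pos hm0) hs
    have t1 : star (a s ε) ⬝ᵥ a s ε = ((w s / X s * ((s ∩ P).card : ℝ) : ℝ) : ℂ) := by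
      rw [ha, star_mulVec_dotProduct_mulVec, hU, Matrix.one_mulVec]
      have e : ∀ i, star (if i ∈ s ∩ P then ((√(w s / X s) : ℝ) : ℂ) * signVec ε i else 0) *
          (if i ∈ s ∩ P then ((√(w s / X s) : ℝ) : ℂ) * signVec ε i else 0) =
          if i ∈ s ∩ P then ((w s / X s : ℝ) : ℂ) else 0 := by
        intro i
        split_ifs with h
        · rw [star_mul', mul_mul_mul_comm, star_signVec_mul, mul_one, Complex.star_def,
            Complex.conj_ofReal, ← Complex.ofReal_mul,
            Real.mul_self_sqrt (div_nonneg (hw0 s) hX0.le)]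
        · simp
      simp only [dotProduct, Pi.star_apply, e]
      rw [Finset.sum_ite_mem, Finset.univ_inter, Finset.sum_const, nsmul_eq_mul]
      push_cast
      ring
    have t2 : star (b s ε) ⬝ᵥ b s ε = (((s ∩ P).card : ℝ) : ℂ) := by
      rw [hb, star_mulVec_dotProduct_mulVec, bobIso_conjTranspose_mul hW (hlamt s)]
      have e : ∀ i, star (signVec ε i) * ((if i ∈ s ∩ P then 1 else 0) * signVec ε i) =
          if i ∈ s ∩ P then 1 else 0 := by
        intro i
        split_ifs
        · rw [one_mul, star_signVec_mul]
        · simp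
      simp only [dotProduct, Pi.star_apply, Matrix.mulVec_diagonal, e]
      rw [Finset.sum_ite_mem, Finset.univ_inter, Finset.sum_const]
      simp
    rw [← vecMulVec_kronecker, Matrix.trace_kronecker, Matrix.trace_vecMulVec,
      Matrix.trace_vecMulVec, dotProduct_comm, t1, dotProduct_comm, t2]
    push_cast
    ring
  simp only [hacc]
  constructor
  · rw [quadForm_sum]
    have e : ∀ s, w s * X s - 2 / m * (w s * (X s - m) ^ 2) ≤ quadForm (if m / 2 ≤ X s then
        ∑ ε : A → ℤˣ, N • Matrix.vecMulVec (prodVec (a s ε) (b s ε))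
          (star (prodVec (a s ε) (b s ε))) else 0) (vecOf (U * W)) := by
      intro s
      have hn : 0 ≤ 2 / m * (w s * (X s - m) ^ 2) :=
        mul_nonneg (by positivity) (mul_nonneg (hw0 s) (sq_nonneg _))
      split_ifs with h
      · rw [quadForm_sum]
        simp only [hNr, quadForm_smul, hquad s _ h, hcard]
        linarith
      · have hz : quadForm (0 : Matrix (A × B) (A × B) ℂ) (vecOf (U * W)) = 0 := by
          simp [quadForm]
        rw [hz]
        push Not at h
        -- If `X < m/2` then `(X - m)² > m²/4`. Thus the probability lost on rejected subsets is
        -- bounded by the variance of `X`.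
        have h2 : X s ≤ 2 / m * (X s - m) ^ 2 := by
          rw [div_mul_eq_mul_div, le_div_iff₀ hm0]
          nlinarith [sq_nonneg (X s), mul_pos hm0 hm0]
        have := mul_le_mul_of_nonneg_left h2 (hw0 s)
        linarith
    refine le_trans ?_ (Finset.sum_le_sum fun s _ => e s)
    rw [Finset.sum_sub_distrib, ← Finset.mul_sum]
    have m1 : ∑ s, w s * X s = m := by
      rw [hw, hX, sum_subsetWeight_mul_sum q (fun i => √(lam i)) P, ← hm]
      refine Finset.sum_congr rfl fun i hi => ?_
      rw [hqP i hi, Real.mul_self_sqrt (hP i hi).le]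
    have m2 : ∑ s, w s * X s ^ 2 ≤ m ^ 2 + ∑ i ∈ P, lam i * √(lam i) := by
      have := sum_subsetWeight_mul_sum_sq_le q (fun i => √(lam i)) P
      have e1 : ∑ i ∈ P, q i * √(lam i) = m := by
        rw [← hm]
        refine Finset.sum_congr rfl fun i hi => ?_
        rw [hqP i hi, Real.mul_self_sqrt (hP i hi).le]
      have e2 : ∑ i ∈ P, q i * √(lam i) ^ 2 = ∑ i ∈ P, lam i * √(lam i) := by
        refine Finset.sum_congr rfl fun i hi => ?_
        rw [hqP i hi, Real.sq_sqrt (hP i hi).le, mul_comm]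
      rwa [e1, e2] at this
    have m3 : ∑ s, w s * (X s - m) ^ 2 ≤ ∑ i ∈ P, lam i * √(lam i) := by
      have e3 : ∑ s, w s * (X s - m) ^ 2 =
          ∑ s, w s * X s ^ 2 - 2 * m * ∑ s, w s * X s + m ^ 2 * ∑ s, w s := by
        rw [Finset.mul_sum, Finset.mul_sum, ← Finset.sum_sub_distrib, ← Finset.sum_add_distrib]
        exact Finset.sum_congr rfl fun s _ => by ring
      rw [e3, m1, hw, sum_subsetWeight, ← hw]
      nlinarith
    rw [m1]
    have := mul_le_mul_of_nonneg_left m3 (by positivity : 0 ≤ 2 / m)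
    linarith
  · rw [Matrix.trace_sum, Complex.re_sum]
    have e : ∀ s, (if m / 2 ≤ X s then
        ∑ ε : A → ℤˣ, N • Matrix.vecMulVec (prodVec (a s ε) (b s ε))
          (star (prodVec (a s ε) (b s ε))) else 0).trace.re ≤
        2 / m * (w s * (∑ _i ∈ s ∩ P, (1 : ℝ)) ^ 2) := by
      intro s
      rw [Finset.sum_const, nsmul_eq_mul, mul_one]
      split_ifs with h
      · have hX0 : 0 < X s := lt_of_lt_of_le (half_pos hm0) h
        rw [Matrix.trace_sum, Complex.re_sum]
        simp only [Matrix.trace_smul, htrace s _ h, hNr, smul_eq_mul, ← Complex.ofReal_mul,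
          Complex.ofReal_re, hcard]
        have hinv : w s / X s ≤ 2 / m * w s := by
          rw [div_le_iff₀ hX0]
          have : 1 ≤ 2 / m * X s := by
            rw [div_mul_eq_mul_div, le_div_iff₀ hm0]
            linarith
          nlinarith [hw0 s]
        have := mul_le_mul_of_nonneg_right hinv (sq_nonneg ((s ∩ P).card : ℝ))
        linarith
      · rw [Matrix.trace_zero, Complex.zero_re]
        exact mul_nonneg (by positivity) (mul_nonneg (hw0 s) (sq_nonneg _))
    refine (Finset.sum_le_sum fun s _ => e s).trans ?_
    rw [← Finset.mul_sum]
    refine mul_le_mul_of_nonneg_left ?_ (by positivity)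
    -- With unit summands this is the second moment of the size of `s ∩ P`.
    refine (sum_subsetWeight_mul_sum_sq_le q (fun _ => 1) P).trans (le_of_eq ?_)
    have e1 : ∑ i ∈ P, q i * 1 = ∑ i ∈ P, √(lam i) :=
      Finset.sum_congr rfl fun i hi => by rw [hqP i hi, mul_one]
    simp only [one_pow, e1]

end TwoRounds

/-! ### Tensor powers -/

section Powers

/-- The `n`-fold tensor power of a matrix. -/
def piMat {A B : Type} (n : ℕ) (M : Matrix A B ℂ) : Matrix (Fin n → A) (Fin n → B) ℂ :=
  fun x y => ∏ k, M (x k) (y k)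

theorem piMat_mul {A B C : Type} [Fintype B] (n : ℕ) (M : Matrix A B ℂ) (N : Matrix B C ℂ) :
    piMat n M * piMat n N = piMat n (M * N) := by
  ext x y
  simp only [piMat, Matrix.mul_apply]
  rw [Fintype.prod_sum]
  exact Finset.sum_congr rfl fun z _ => Finset.prod_mul_distrib.symm

theorem piMat_conjTranspose {A B : Type} (n : ℕ) (M : Matrix A B ℂ) :
    (piMat n M).conjTranspose = piMat n M.conjTranspose := by
  ext x y
  simp [piMat]

theorem piMat_diagonal {A : Type} [DecidableEq A] (n : ℕ) (d : A → ℂ) :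
    piMat n (Matrix.diagonal d) = Matrix.diagonal fun x : Fin n → A => ∏ k, d (x k) := by
  ext x y
  by_cases h : x = y
  · subst h
    simp [piMat]
  · rw [Matrix.diagonal_apply_ne _ h, piMat]
    obtain ⟨k, hk⟩ := Function.ne_iff.1 h
    exact Finset.prod_eq_zero (Finset.mem_univ k) (Matrix.diagonal_apply_ne _ hk)

theorem piMat_one {A : Type} [DecidableEq A] (n : ℕ) : piMat n (1 : Matrix A A ℂ) = 1 := by
  rw [← Matrix.diagonal_one, piMat_diagonal]
  simp

end Powers

/-! ### The Schmidt decomposition -/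

section Schmidt

variable {A B : Type} [Fintype A] [DecidableEq A] [Fintype B] (Ψ : EuclideanSpace ℂ (A × B))

/-- The matrix of coefficients of a bipartite vector. -/
def coeffMat {A B : Type} (Ψ : EuclideanSpace ℂ (A × B)) : Matrix A B ℂ := fun a b => Ψ (a, b)

theorem reducedState_eq {A B : Type} [Fintype B] (Ψ : EuclideanSpace ℂ (A × B)) :
    reducedState Ψ = coeffMat Ψ * (coeffMat Ψ).conjTranspose := by
  ext x x'
  simp [reducedState, pureState, Matrix.vecMulVec_apply, Matrix.mul_apply, coeffMat]

/-- The unitary whose columns are Alice's Schmidt vectors. -/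
def schmidtU : Matrix A A ℂ := ((reducedState_isHermitian Ψ).eigenvectorUnitary : Matrix A A ℂ)

/-- The matrix whose rows are Bob's unnormalized Schmidt vectors. -/
def schmidtW : Matrix A B ℂ := (schmidtU Ψ).conjTranspose * coeffMat Ψ

theorem schmidtU_unitary : (schmidtU Ψ).conjTranspose * schmidtU Ψ = 1 :=
  Unitary.star_mul_self_of_mem (reducedState_isHermitian Ψ).eigenvectorUnitary.2

theorem schmidtU_mul_schmidtW : schmidtU Ψ * schmidtW Ψ = coeffMat Ψ := by
  rw [schmidtW, ← Matrix.mul_assoc, mul_eq_one_comm.1 (schmidtU_unitary Ψ), Matrix.one_mul]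

theorem schmidtW_mul_conjTranspose :
    schmidtW Ψ * (schmidtW Ψ).conjTranspose = Matrix.diagonal fun i => (schmidt Ψ i : ℂ) := by
  have hs := (reducedState_isHermitian Ψ).spectral_theorem
  rw [Unitary.conjStarAlgAut_apply] at hs
  have hU := schmidtU_unitary Ψ
  have e : schmidtW Ψ * (schmidtW Ψ).conjTranspose =
      (schmidtU Ψ).conjTranspose * reducedState Ψ * schmidtU Ψ := by
    rw [schmidtW, Matrix.conjTranspose_mul, Matrix.conjTranspose_conjTranspose, reducedState_eq]
    simp only [Matrix.mul_assoc]
  rw [e, hs]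
  change (schmidtU Ψ).conjTranspose * (schmidtU Ψ * _ * (schmidtU Ψ).conjTranspose) * schmidtU Ψ = _
  rw [Matrix.mul_assoc, Matrix.mul_assoc, Matrix.mul_assoc, hU, Matrix.mul_one, ← Matrix.mul_assoc,
    hU, Matrix.one_mul]
  rfl

theorem schmidt_nonneg (i : A) : 0 ≤ schmidt Ψ i := by
  have h : (reducedState Ψ).PosSemidef := by
    rw [reducedState_eq]
    exact Matrix.posSemidef_self_mul_conjTranspose _
  exact h.eigenvalues_nonneg i

variable {Ψ}

theorem sum_schmidt (hΨ : ‖Ψ‖ = 1) : ∑ i, schmidt Ψ i = 1 := by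
  have h := (reducedState_isHermitian Ψ).trace_eq_sum_eigenvalues
  have h2 : (reducedState Ψ).trace = ((∑ p, ‖Ψ p‖ ^ 2 : ℝ) : ℂ) := by
    rw [Fintype.sum_prod_type]
    push_cast
    refine Finset.sum_congr rfl fun a _ => Finset.sum_congr rfl fun b _ => ?_
    rw [pureState, Matrix.vecMulVec_apply, Complex.star_def, Complex.mul_conj']
  rw [← EuclideanSpace.norm_sq_eq, hΨ, one_pow] at h2
  rw [h2] at h
  have h3 : ((1 : ℝ) : ℂ) = ((∑ i, schmidt Ψ i : ℝ) : ℂ) := by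
    rw [h]
    push_cast
    rfl
  exact (Complex.ofReal_injective h3).symm

/-- The `n`-fold tensor power of a bipartite vector. -/
def powVec {A B : Type} (n : ℕ) (Ψ : EuclideanSpace ℂ (A × B)) :
    (Fin n → A) × (Fin n → B) → ℂ :=
  vecOf (piMat n (coeffMat Ψ))

theorem piMat_schmidt (n : ℕ) (Ψ : EuclideanSpace ℂ (A × B)) :
    vecOf (piMat n (schmidtU Ψ) * piMat n (schmidtW Ψ)) = powVec n Ψ := by
  rw [piMat_mul, schmidtU_mul_schmidtW, powVec]

theorem piMat_schmidtU (n : ℕ) (Ψ : EuclideanSpace ℂ (A × B)) :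
    (piMat n (schmidtU Ψ)).conjTranspose * piMat n (schmidtU Ψ) = 1 := by
  rw [piMat_conjTranspose, piMat_mul, schmidtU_unitary, piMat_one]

theorem piMat_schmidtW (n : ℕ) (Ψ : EuclideanSpace ℂ (A × B)) :
    piMat n (schmidtW Ψ) * (piMat n (schmidtW Ψ)).conjTranspose =
      Matrix.diagonal fun x => (prodLaw (schmidt Ψ) x : ℂ) := by
  rw [piMat_conjTranspose, piMat_mul, schmidtW_mul_conjTranspose, piMat_diagonal]
  simp [prodLaw]

end Schmidt

/-! ### The type-2 error -/

section Errors

variable {A B : Type} [Fintype A] [DecidableEq A] [Fintype B] [DecidableEq B]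
  {Ψ : EuclideanSpace ℂ (A × B)} {n : ℕ}

theorem copies_pureState {A B : Type} (n : ℕ) (Ψ : EuclideanSpace ℂ (A × B)) :
    copies n (pureState Ψ) = Matrix.vecMulVec (powVec n Ψ) (star (powVec n Ψ)) := by
  ext p q
  simp [copies, pureState, Matrix.vecMulVec_apply, powVec, vecOf, piMat, coeffMat,
    Finset.prod_mul_distrib]

theorem copies_mixedState (A B : Type) [Fintype A] [DecidableEq A] [Fintype B] [DecidableEq B]
    (n : ℕ) :
    copies n (mixedState A B) =
      ((((Fintype.card A : ℝ) * (Fintype.card B : ℝ))⁻¹ ^ n : ℝ) : ℂ) • 1 := by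
  have e : ∀ p q : (Fin n → A) × (Fin n → B), copies n (mixedState A B) p q =
      (((Fintype.card A : ℂ) * (Fintype.card B : ℂ))⁻¹) ^ n *
        (piMat n (1 : Matrix A A ℂ) p.1 q.1 * piMat n (1 : Matrix B B ℂ) p.2 q.2) := by
    intro p q
    simp only [copies, mixedState, Matrix.smul_apply, smul_eq_mul, Finset.prod_mul_distrib,
      Finset.prod_const, Finset.card_univ, Fintype.card_fin, ← Matrix.one_kronecker_one,
      Matrix.kroneckerMap_apply, piMat]
  ext p q
  rw [e, piMat_one, piMat_one, Matrix.smul_apply, ← Matrix.one_kronecker_one,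
    Matrix.kroneckerMap_apply, smul_eq_mul]
  push_cast
  rfl

theorem quadForm_one_powVec (hΨ : ‖Ψ‖ = 1) (n : ℕ) : quadForm 1 (powVec n Ψ) = 1 := by
  rw [← piMat_schmidt, ← schmidtPart_univ, ← Matrix.one_kronecker_one,
    quadForm_schmidtPart (piMat_schmidtW n Ψ), Matrix.mul_one, piMat_schmidtU]
  simp only [Matrix.one_apply_eq, Complex.one_re, mul_one]
  exact sum_prodLaw (sum_schmidt hΨ) n

theorem trace_pureState_mul_le_iff (hΨ : ‖Ψ‖ = 1) {ε : ℝ}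
    (T : Matrix ((Fin n → A) × (Fin n → B)) ((Fin n → A) × (Fin n → B)) ℂ) :
    (copies n (pureState Ψ) * T).trace.re ≤ ε ↔ 1 - ε ≤ quadForm (1 - T) (powVec n Ψ) := by
  rw [copies_pureState, trace_vecMulVec_mul, quadForm_sub, quadForm_one_powVec hΨ]
  change quadForm T (powVec n Ψ) ≤ ε ↔ _
  constructor <;> intro h <;> linarith

theorem trace_mixedState_mul
    (S : Matrix ((Fin n → A) × (Fin n → B)) ((Fin n → A) × (Fin n → B)) ℂ) :
    (copies n (mixedState A B) * S).trace.re =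
      ((Fintype.card A : ℝ) * (Fintype.card B : ℝ))⁻¹ ^ n * S.trace.re := by
  rw [copies_mixedState, Matrix.smul_mul, Matrix.one_mul, Matrix.trace_smul, smul_eq_mul,
    Complex.re_ofReal_mul]

theorem IsPOVM.eq_cons {S : Type} [Fintype S] [DecidableEq S] {M : Fin 2 → Matrix S S ℂ}
    (h : IsPOVM M) : ![M 0, 1 - M 0] = M ∧ 1 - M 0 = M 1 := by
  have h2 : M 0 + M 1 = 1 := by rw [← h.2, Fin.sum_univ_two]
  have h1 : 1 - M 0 = M 1 := by rw [← h2, add_sub_cancel_left]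
  refine ⟨?_, h1⟩
  rw [h1]
  ext x : 1
  fin_cases x <;> rfl

/-- The optimal type-2 error is squeezed between the values of a test and a bound for all tests. -/
theorem betaErr_mem_Icc (hΨ : ‖Ψ‖ = 1) {ε l u : ℝ}
    {C : Set (Fin 2 → Matrix ((Fin n → A) × (Fin n → B)) ((Fin n → A) × (Fin n → B)) ℂ)}
    (hl : ∀ M ∈ C, 1 - ε ≤ quadForm (M 1) (powVec n Ψ) → l ≤ (M 1).trace.re)
    {M : Fin 2 → Matrix ((Fin n → A) × (Fin n → B)) ((Fin n → A) × (Fin n → B)) ℂ}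
    (hM : M ∈ C) (hMP : IsPOVM M) (hMacc : 1 - ε ≤ quadForm (M 1) (powVec n Ψ))
    (hMu : (M 1).trace.re ≤ u) :
    ((Fintype.card A : ℝ) * (Fintype.card B : ℝ))⁻¹ ^ n * l ≤ betaErr n C ε Ψ ∧
      betaErr n C ε Ψ ≤ ((Fintype.card A : ℝ) * (Fintype.card B : ℝ))⁻¹ ^ n * u := by
  have hD : 0 ≤ ((Fintype.card A : ℝ) * (Fintype.card B : ℝ))⁻¹ ^ n := by positivity
  have hlow : ∀ b ∈ {b : ℝ | ∃ T, ![T, 1 - T] ∈ C ∧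
      (copies n (pureState Ψ) * T).trace.re ≤ ε ∧
      b = (copies n (mixedState A B) * (1 - T)).trace.re},
      ((Fintype.card A : ℝ) * (Fintype.card B : ℝ))⁻¹ ^ n * l ≤ b := by
    rintro b ⟨T, hT, hε, rfl⟩
    rw [trace_mixedState_mul]
    exact mul_le_mul_of_nonneg_left
      (hl _ hT ((trace_pureState_mul_le_iff hΨ T).1 hε)) hD
  obtain ⟨e1, e2⟩ := hMP.eq_cons
  have hmem : (copies n (mixedState A B) * M 1).trace.re ∈ {b : ℝ | ∃ T, ![T, 1 - T] ∈ C ∧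
      (copies n (pureState Ψ) * T).trace.re ≤ ε ∧
      b = (copies n (mixedState A B) * (1 - T)).trace.re} := by
    -- The rejecting element is outcome `0`; acceptance is outcome `1`.
    refine ⟨M 0, by rwa [e1], ?_, by rw [e2]⟩
    rw [trace_pureState_mul_le_iff hΨ, e2]
    exact hMacc
  refine ⟨le_csInf ⟨_, hmem⟩ hlow, (csInf_le ⟨_, hlow⟩ hmem).trans ?_⟩
  rw [trace_mixedState_mul]
  exact mul_le_mul_of_nonneg_left hMu hD

theorem isClosed_posSemidef (S : Type) [Fintype S] :
    IsClosed {M : Matrix S S ℂ | M.PosSemidef} := by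
  have e : {M : Matrix S S ℂ | M.PosSemidef} =
      {M | M.conjTranspose = M} ∩ ⋂ x : S → ℂ, {M | 0 ≤ star x ⬝ᵥ M.mulVec x} := by
    ext M
    simp only [Set.mem_ofPred_eq, Set.mem_inter_iff, Set.mem_iInter]
    exact ⟨fun h => ⟨h.1, h.dotProduct_mulVec_nonneg⟩,
      fun h => Matrix.PosSemidef.of_dotProduct_mulVec_nonneg h.1 h.2⟩
  rw [e]
  refine (isClosed_eq continuous_id.matrix_conjTranspose continuous_id).inter
    (isClosed_iInter fun x => isClosed_le continuous_const ?_)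
  exact continuous_const.dotProduct (continuous_id.matrix_mulVec continuous_const)

theorem isClosed_isPOVM (S : Type) [Fintype S] [DecidableEq S] :
    IsClosed {M : Fin 2 → Matrix S S ℂ | IsPOVM M} := by
  have e : {M : Fin 2 → Matrix S S ℂ | IsPOVM M} =
      (⋂ x, (fun M : Fin 2 → Matrix S S ℂ => M x) ⁻¹' {M | M.PosSemidef}) ∩
        {M | ∑ x, M x = 1} := by
    ext M
    simp [IsPOVM]
  rw [e]
  refine (isClosed_iInter fun x => (isClosed_posSemidef S).preimage (continuous_apply x)).inter
    (isClosed_eq ?_ continuous_const)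
  exact continuous_finsetSum _ fun x _ => continuous_apply x

/-- The bound for separable operators extends to limits of LOCC POVMs. -/
theorem twoWayLOCC_subset {A B : Type} [Fintype A] [DecidableEq A] [Fintype B] [DecidableEq B]
    {φ : A × B → ℂ} {c : ℝ} (h : ∀ S, IsSeparableOp S → quadForm S φ ≤ c * S.trace.re) :
    twoWayLOCC A B ⊆ {M | IsPOVM M ∧ quadForm (M 1) φ ≤ c * (M 1).trace.re} := by
  -- The POVM conditions and the linear inequality are closed conditions, so no closedness of the
  -- separable cone is required.
  refine closure_minimal ?_ ?_
  · refine Set.iUnion_subset fun k M hM => ?_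
    obtain ⟨h1, h2⟩ := IsLOCC.separable hM
    exact ⟨h1, h _ (h2 1)⟩
  · have e : {M : Fin 2 → Matrix (A × B) (A × B) ℂ |
        IsPOVM M ∧ quadForm (M 1) φ ≤ c * (M 1).trace.re} =
        {M | IsPOVM M} ∩ {M | quadForm (M 1) φ ≤ c * (M 1).trace.re} := by
      ext M
      rfl
    rw [e]
    refine (isClosed_isPOVM _).inter (isClosed_le ?_ ?_)
    · exact Complex.continuous_re.comp (continuous_const.dotProduct
        ((continuous_apply 1).matrix_mulVec continuous_const))
    · exact continuous_const.mul (Complex.continuous_re.comp (continuous_apply 1).matrix_trace)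

end Errors

/-! ### Asymptotics -/

section Asymptotic

/-- Multiplicative two-sided bounds give an additive error `O(1)` of the logarithm. -/
theorem log_sub_log_isBigO {β R : ℕ → ℝ} {κ₁ κ₂ : ℝ} (h₁ : 0 < κ₁)
    (h : ∀ᶠ n in atTop, 0 < R n ∧ κ₁ * R n ≤ β n ∧ β n ≤ κ₂ * R n) :
    (fun n => Real.log (β n) - Real.log (R n)) =O[atTop] fun _ => (1 : ℝ) := by
  refine IsBigO.of_bound (|Real.log κ₁| + |Real.log κ₂|) ?_
  filter_upwards [h] with n hn
  obtain ⟨hR, hl, hu⟩ := hn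
  have hβ : 0 < β n := (mul_pos h₁ hR).trans_le hl
  have h₂ : 0 < κ₂ := pos_of_mul_pos_left (hβ.trans_le hu) hR.le
  have l1 := Real.log_le_log (mul_pos h₁ hR) hl
  have l2 := Real.log_le_log hβ hu
  rw [Real.log_mul h₁.ne' hR.ne'] at l1
  rw [Real.log_mul h₂.ne' hR.ne'] at l2
  rw [Real.norm_eq_abs, norm_one, mul_one, abs_le]
  constructor
  · linarith [neg_abs_le (Real.log κ₁), abs_nonneg (Real.log κ₂)]
  · linarith [le_abs_self (Real.log κ₂), abs_nonneg (Real.log κ₁)]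

theorem card_pos_of_norm_eq_one {A B : Type} [Fintype A] [Fintype B]
    {Ψ : EuclideanSpace ℂ (A × B)} (hΨ : ‖Ψ‖ = 1) :
    0 < (Fintype.card A : ℝ) * (Fintype.card B : ℝ) := by
  have : Nonempty (A × B) := by
    by_contra hne
    rw [not_nonempty_iff] at hne
    have : Ψ = 0 := by
      ext p
      exact hne.elim p
    rw [this, norm_zero] at hΨ
    exact zero_ne_one hΨ
  obtain ⟨a, b⟩ := this
  have ha : 0 < Fintype.card A := Fintype.card_pos_iff.2 ⟨a⟩
  have hb : 0 < Fintype.card B := Fintype.card_pos_iff.2 ⟨b⟩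
  positivity

theorem prodLaw_schmidt_le_one {A B : Type} [Fintype A] [DecidableEq A] [Fintype B]
    {Ψ : EuclideanSpace ℂ (A × B)} (hΨ : ‖Ψ‖ = 1) {n : ℕ} (x : Fin n → A) :
    prodLaw (schmidt Ψ) x ≤ 1 := by
  rw [← sum_prodLaw (sum_schmidt hΨ) n]
  exact Finset.single_le_sum (f := fun x : Fin n → A => prodLaw (schmidt Ψ) x)
    (fun y _ => prodLaw_nonneg (schmidt_nonneg Ψ) y) (Finset.mem_univ x)

variable {A B : Type} [Fintype A] [DecidableEq A] [Fintype B]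
  {Ψ : EuclideanSpace ℂ (A × B)} {ε : ℝ}

/-- `D⁻ⁿ exp(-τ) / r n`, where `τ` is the quantile of the log-spectrum. -/
def errScale (Ψ : EuclideanSpace ℂ (A × B)) (ε : ℝ) (r : ℕ → ℝ) (n : ℕ) : ℝ :=
  ((Fintype.card A : ℝ) * (Fintype.card B : ℝ))⁻¹ ^ n *
    (Real.exp (-logThreshold (schmidt Ψ) ε n) / r n)

theorem errScale_pos (hΨ : ‖Ψ‖ = 1) {r : ℕ → ℝ} {n : ℕ} (hr : 0 < r n) :
    0 < errScale Ψ ε r n := by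
  have := card_pos_of_norm_eq_one hΨ
  have := Real.exp_pos (-logThreshold (schmidt Ψ) ε n)
  unfold errScale
  positivity

theorem log_errScale (hΨ : ‖Ψ‖ = 1) {r : ℕ → ℝ} {n : ℕ} (hr : 0 < r n) :
    Real.log (errScale Ψ ε r n) = secondOrder Ψ ε n - Real.log (r n) := by
  have hD := card_pos_of_norm_eq_one hΨ
  rw [errScale, Real.log_mul (pow_pos (inv_pos.2 hD) n).ne' (div_pos (Real.exp_pos _) hr).ne',
    Real.log_div (Real.exp_pos _).ne' hr.ne', Real.log_exp, Real.log_pow, Real.log_inv,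
    secondOrder, logThreshold]
  change _ = -(n : ℝ) * (_ - shannon (schmidt Ψ)) - √n * √(varentropy (schmidt Ψ)) * _ - _
  ring

variable [DecidableEq B]

/-- The expansion of the optimal error from a bound for all tests and from a family of tests. -/
theorem log_betaErr_isBigO (hΨ : ‖Ψ‖ = 1)
    (C : ∀ n : ℕ, Set (Fin 2 → Matrix ((Fin n → A) × (Fin n → B)) ((Fin n → A) × (Fin n → B)) ℂ))
    {r : ℕ → ℝ} (hr : ∀ᶠ n in atTop, 0 < r n) {κ₁ κ₂ : ℝ} (h₁ : 0 < κ₁)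
    (hl : ∀ᶠ n in atTop, ∀ M ∈ C n, 1 - ε ≤ quadForm (M 1) (powVec n Ψ) →
      κ₁ * (Real.exp (-logThreshold (schmidt Ψ) ε n) / r n) ≤ (M 1).trace.re)
    (hu : ∀ᶠ n in atTop, ∃ M ∈ C n, IsPOVM M ∧ 1 - ε ≤ quadForm (M 1) (powVec n Ψ) ∧
      (M 1).trace.re ≤ κ₂ * (Real.exp (-logThreshold (schmidt Ψ) ε n) / r n)) :
    (fun n => Real.log (betaErr n (C n) ε Ψ) - (secondOrder Ψ ε n - Real.log (r n)))
      =O[atTop] fun _ => (1 : ℝ) := by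
  have h := log_sub_log_isBigO (β := fun n => betaErr n (C n) ε Ψ)
    (R := errScale Ψ ε r) (κ₂ := κ₂) h₁ ?_
  · refine h.congr' ?_ EventuallyEq.rfl
    filter_upwards [hr] with n hn
    rw [log_errScale hΨ hn]
  · filter_upwards [hr, hl, hu] with n hn hl hu
    obtain ⟨M, hM, hMP, hacc, htr⟩ := hu
    obtain ⟨b1, b2⟩ := betaErr_mem_Icc hΨ hl hM hMP hacc htr
    refine ⟨errScale_pos hΨ hn, ?_, ?_⟩
    · rw [errScale, mul_left_comm]
      exact b1
    · rw [errScale, mul_left_comm]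
      exact b2

theorem le_of_mul_exp_le {a K τ t : ℝ} (h : a ≤ Real.exp (τ + K) * t) :
    a * Real.exp (-K) * Real.exp (-τ) ≤ t := by
  have := mul_le_mul_of_nonneg_right h (Real.exp_pos (-(τ + K))).le
  rw [mul_right_comm, ← Real.exp_add, add_neg_cancel, Real.exp_zero, one_mul] at this
  rwa [mul_assoc, ← Real.exp_add, show -K + -τ = -(τ + K) by ring]

/-- The margin `2/√n` of `exists_mass_le` has to be covered linearly by the coefficients below
`e^{τ+K}`. -/
theorem oneWay_lower (hΨ : ‖Ψ‖ = 1) (hV : 0 < varianceV Ψ) (hε0 : 0 < ε) (hε1 : ε < 1) :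
    ∃ κ : ℝ, 0 < κ ∧ ∀ᶠ n : ℕ in atTop, ∀ M ∈ oneWayLOCC (Fin n → A) (Fin n → B),
      1 - ε ≤ quadForm (M 1) (powVec n Ψ) →
        κ * (Real.exp (-logThreshold (schmidt Ψ) ε n) / √n) ≤ (M 1).trace.re := by
  obtain ⟨K, hK⟩ := exists_mass_le (schmidt_nonneg Ψ) (sum_schmidt hΨ) hV hε0 hε1
  refine ⟨2 * Real.exp (-K), by positivity, ?_⟩
  filter_upwards [hK] with n hn M hM hacc
  rw [← piMat_schmidt] at hacc
  have := IsLOCC.trace_ge_of_oneWay hM 1 (piMat_schmidtU n Ψ) (piMat_schmidtW n Ψ)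
    (prodLaw_nonneg (schmidt_nonneg Ψ)) (Real.exp_pos (logThreshold (schmidt Ψ) ε n + K)).le
    (fun x hx => not_lt.1 fun h => hx (Finset.mem_filter.2 ⟨Finset.mem_univ x, h⟩)) hn hacc
  refine le_trans (le_of_eq ?_) (le_of_mul_exp_le this)
  ring

/-- The vector `φ`, the part of `Ψ^{⊗n}` with small coefficients, and the constant `c` are exposed
because the inequality between them survives limits. One bound then serves the two-round, two-way
and separable classes. -/
theorem lower_of_quadForm_le (hΨ : ‖Ψ‖ = 1) (hV : 0 < varianceV Ψ) (hε0 : 0 < ε) (hε1 : ε < 1) :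
    ∃ κ : ℝ, 0 < κ ∧ ∀ᶠ n : ℕ in atTop,
      ∃ (φ : (Fin n → A) × (Fin n → B) → ℂ) (c : ℝ),
        (∀ S, IsSeparableOp S → quadForm S φ ≤ c * S.trace.re) ∧
        ∀ M : Fin 2 → Matrix ((Fin n → A) × (Fin n → B)) ((Fin n → A) × (Fin n → B)) ℂ,
          IsPOVM M → quadForm (M 1) φ ≤ c * (M 1).trace.re →
          1 - ε ≤ quadForm (M 1) (powVec n Ψ) →
          κ * (Real.exp (-logThreshold (schmidt Ψ) ε n) / n) ≤ (M 1).trace.re := by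
  obtain ⟨K, hK⟩ := exists_mass_le (schmidt_nonneg Ψ) (sum_schmidt hΨ) hV hε0 hε1
  refine ⟨Real.exp (-K) / 2, by positivity, ?_⟩
  filter_upwards [hK, eventually_gt_atTop 0] with n hn hn0
  have hn1 : (1 : ℝ) ≤ n := by exact_mod_cast hn0
  have hsn : 1 ≤ √(n : ℝ) := Real.one_le_sqrt.2 hn1
  set Q : Finset (Fin n → A) := Finset.univ.filter fun x =>
    Real.exp (logThreshold (schmidt Ψ) ε n + K) < prodLaw (schmidt Ψ) x with hQ
  refine ⟨vecOf (schmidtPart (piMat n (schmidtU Ψ)) (piMat n (schmidtW Ψ)) Qᶜ),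
    Real.exp (logThreshold (schmidt Ψ) ε n + K), fun S hS => ?_, fun M hM hsm hacc => ?_⟩
  · refine hS.quadForm_le (piMat_schmidtU n Ψ) (piMat_schmidtW n Ψ) (Real.exp_pos _).le ?_
    intro x hx
    exact not_lt.1 fun h => Finset.mem_compl.1 hx (Finset.mem_filter.2 ⟨Finset.mem_univ x, h⟩)
  · rw [← piMat_schmidt] at hacc
    -- With `η = 1/√n` the mass margin is exactly `2η`, and `η²/2` yields the order `1/n`.
    have := trace_ge_of_quadForm_le (hM.1 1) (hM.le_one 1) (piMat_schmidtU n Ψ)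
      (piMat_schmidtW n Ψ) (Q := Q) (η := 1 / √n) (ε := ε) (by positivity)
      (by rw [div_le_one (by positivity)]; exact hsn) (by rw [mul_one_div]; exact hn) hε0.le hsm hacc
    refine le_trans (le_of_eq ?_) (le_of_mul_exp_le this)
    rw [div_pow, Real.sq_sqrt (by positivity)]
    ring

theorem oneWay_upper (hΨ : ‖Ψ‖ = 1) (hV : 0 < varianceV Ψ) (hε0 : 0 < ε) (hε1 : ε < 1) :
    ∃ κ : ℝ, ∀ᶠ n : ℕ in atTop, ∃ M ∈ oneWayLOCC (Fin n → A) (Fin n → B), IsPOVM M ∧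
      1 - ε ≤ quadForm (M 1) (powVec n Ψ) ∧
        (M 1).trace.re ≤ κ * (Real.exp (-logThreshold (schmidt Ψ) ε n) / √n) := by
  obtain ⟨K, hK⟩ := exists_le_mass (schmidt_nonneg Ψ) (sum_schmidt hΨ) hV hε0 hε1
  obtain ⟨C, hC0, hC⟩ := card_prodLaw_le (schmidt_nonneg Ψ) (sum_schmidt hΨ) hV
  refine ⟨C * Real.exp K, ?_⟩
  filter_upwards [hK, eventually_gt_atTop 0] with n hn hn0
  obtain ⟨M, hM, hq, ht⟩ := exists_oneWay_test (B := Fin n → B) (piMat_schmidtU n Ψ)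
    (piMat_schmidtW n Ψ) (P := Finset.univ.filter fun x =>
      Real.exp (logThreshold (schmidt Ψ) ε n - K) ≤ prodLaw (schmidt Ψ) x)
    (fun x hx => (Real.exp_pos _).trans_le (Finset.mem_filter.1 hx).2)
  rw [piMat_schmidt] at hq
  refine ⟨M, hM, (IsLOCC.separable hM).1, ?_, ?_⟩
  · rw [hq]
    have : 0 ≤ 1 / √(n : ℝ) := by positivity
    linarith
  · rw [ht]
    refine (hC n hn0 _).trans (le_of_eq ?_)
    rw [neg_sub, sub_eq_add_neg, Real.exp_add]
    ring

/-- The mass above `e^{τ-K}` exceeds `1 - ε` by `1/√n`, while the test loses only a multiple of `∑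
λ^{3/2}`, which is exponentially small. The trace is governed by the square of `∑ √λ`. -/
theorem twoRound_upper (hΨ : ‖Ψ‖ = 1) (hV : 0 < varianceV Ψ) (hε0 : 0 < ε) (hε1 : ε < 1) :
    ∃ κ : ℝ, ∀ᶠ n : ℕ in atTop, ∃ M ∈ loccRounds (Fin n → A) (Fin n → B) 2, IsPOVM M ∧
      1 - ε ≤ quadForm (M 1) (powVec n Ψ) ∧
        (M 1).trace.re ≤ κ * (Real.exp (-logThreshold (schmidt Ψ) ε n) / n) := by
  obtain ⟨K, hK⟩ := exists_le_mass (schmidt_nonneg Ψ) (sum_schmidt hΨ) hV hε0 hε1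
  obtain ⟨C, hC0, hC⟩ := sum_sqrt_prodLaw_le (schmidt_nonneg Ψ) (sum_schmidt hΨ) hV
  set δ : ℝ := 1 - ε with hδ
  have hδ0 : 0 < δ := by rw [hδ]; linarith
  have hsm := eventually_sum_mul_sqrt_le (schmidt_nonneg Ψ) (sum_schmidt hΨ) hV (half_pos hδ0)
  refine ⟨2 / δ * (1 + 1 / δ) * (C ^ 2 * Real.exp K), ?_⟩
  filter_upwards [hK, hsm, eventually_gt_atTop 0] with n hn hs hn0
  have hn' : (0 : ℝ) < n := by exact_mod_cast hn0
  set lam : (Fin n → A) → ℝ := fun x => prodLaw (schmidt Ψ) x with hlam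
  have hlam0 : ∀ x, 0 ≤ lam x := prodLaw_nonneg (schmidt_nonneg Ψ)
  have hlam1 : ∀ x, lam x ≤ 1 := prodLaw_schmidt_le_one hΨ
  set P : Finset (Fin n → A) := Finset.univ.filter fun x =>
    Real.exp (logThreshold (schmidt Ψ) ε n - K) ≤ lam x with hP
  set m : ℝ := ∑ x ∈ P, lam x with hm
  set Z : ℝ := ∑ x ∈ P, √(lam x) with hZ
  have h1n : 0 ≤ 1 / √(n : ℝ) := by positivity
  have hmδ : δ ≤ m := by linarith
  have hm0 : 0 < m := hδ0.trans_le hmδ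
  have hmZ : m ≤ Z := Finset.sum_le_sum fun x _ => by
    refine Real.le_sqrt_of_sq_le ?_
    nlinarith [hlam0 x, hlam1 x]
  obtain ⟨M, hM, hq, ht⟩ := exists_twoRound_test (B := Fin n → B) (piMat_schmidtU n Ψ)
    (piMat_schmidtW n Ψ) hlam1 (P := P)
    (fun x hx => (Real.exp_pos _).trans_le (Finset.mem_filter.1 hx).2) hm.symm hm0
  rw [piMat_schmidt] at hq
  refine ⟨M, hM, (IsLOCC.separable hM).1, ?_, ?_⟩
  · have hloss : 2 / m * ∑ x ∈ P, lam x * √(lam x) ≤ 1 / √n := by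
      have a1 : ∑ x ∈ P, lam x * √(lam x) ≤ δ / 2 / √n :=
        (Finset.sum_le_sum_of_subset_of_nonneg (Finset.subset_univ P) fun x _ _ =>
          mul_nonneg (hlam0 x) (Real.sqrt_nonneg _)).trans hs
      have a2 : 2 / m ≤ 2 / δ := by gcongr
      calc 2 / m * ∑ x ∈ P, lam x * √(lam x) ≤ 2 / δ * (δ / 2 / √n) :=
            mul_le_mul a2 a1 (Finset.sum_nonneg fun x _ =>
              mul_nonneg (hlam0 x) (Real.sqrt_nonneg _)) (by positivity)
        _ = 1 / √n := by field_simp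
    linarith
  · have hZ0 : 0 < Z := hm0.trans_le hmZ
    -- `Z` is at least the accepted mass, hence at least `δ`, so the linear term of the trace bound
    -- is absorbed by the quadratic one.
    have b1 : Z ≤ 1 / δ * Z ^ 2 := by
      rw [div_mul_eq_mul_div, one_mul, le_div_iff₀ hδ0, pow_two]
      exact mul_le_mul_of_nonneg_left (hmδ.trans hmZ) hZ0.le
    have b2 : Z ^ 2 + Z ≤ (1 + 1 / δ) * Z ^ 2 := by linarith
    have b3 : Z ^ 2 ≤ C ^ 2 * Real.exp K * (Real.exp (-logThreshold (schmidt Ψ) ε n) / n) := by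
      have := pow_le_pow_left₀ hZ0.le (hC n hn0 (logThreshold (schmidt Ψ) ε n - K)) 2
      refine this.trans (le_of_eq ?_)
      rw [mul_pow, div_pow, Real.sq_sqrt hn'.le, ← Real.exp_nat_mul,
        show ((2 : ℕ) : ℝ) * (-(logThreshold (schmidt Ψ) ε n - K) / 2) =
          K + -logThreshold (schmidt Ψ) ε n by push_cast; ring, Real.exp_add]
      ring
    calc (M 1).trace.re ≤ 2 / m * (Z ^ 2 + Z) := ht
      _ ≤ 2 / δ * ((1 + 1 / δ) *
          (C ^ 2 * Real.exp K * (Real.exp (-logThreshold (schmidt Ψ) ε n) / n))) := by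
        refine mul_le_mul (by gcongr) (b2.trans ?_) (by positivity) (by positivity)
        exact mul_le_mul_of_nonneg_left b3 (by positivity)
      _ = _ := by ring

end Asymptotic

end LocalTest

end

/-! ### The expansions for the four classes of tests. -/

theorem theorem1 (dA dB : ℕ) (Ψ : EuclideanSpace ℂ (Fin dA × Fin dB)) (hΨ : ‖Ψ‖ = 1)
    (hV : 0 < varianceV Ψ) (ε : ℝ) (hε0 : 0 < ε) (hε1 : ε < 1) :
    ((fun n : ℕ =>
        Real.log (betaErr n (oneWayLOCC (Fin n → Fin dA) (Fin n → Fin dB)) ε Ψ)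
          - (secondOrder Ψ ε n - 1 / 2 * Real.log n)) =O[atTop] fun _ => (1 : ℝ)) ∧
    ((fun n : ℕ =>
        Real.log (betaErr n (loccRounds (Fin n → Fin dA) (Fin n → Fin dB) 2) ε Ψ)
          - Real.log (betaErr n (twoWayLOCC (Fin n → Fin dA) (Fin n → Fin dB)) ε Ψ))
        =O[atTop] fun _ => (1 : ℝ)) ∧
    ((fun n : ℕ =>
        Real.log (betaErr n (twoWayLOCC (Fin n → Fin dA) (Fin n → Fin dB)) ε Ψ)
          - Real.log (betaErr n (separablePOVM (Fin n → Fin dA) (Fin n → Fin dB)) ε Ψ))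
        =O[atTop] fun _ => (1 : ℝ)) ∧
    ((fun n : ℕ =>
        Real.log (betaErr n (separablePOVM (Fin n → Fin dA) (Fin n → Fin dB)) ε Ψ)
          - (secondOrder Ψ ε n - Real.log n)) =O[atTop] fun _ => (1 : ℝ)) := by
  have hpos : ∀ᶠ n : ℕ in atTop, (0 : ℝ) < n := by
    filter_upwards [eventually_gt_atTop 0] with n hn
    exact_mod_cast hn
  obtain ⟨κ₁, hκ₁, hl₁⟩ := oneWay_lower hΨ hV hε0 hε1
  obtain ⟨κ₂, hu₁⟩ := oneWay_upper hΨ hV hε0 hε1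
  obtain ⟨κ₃, hκ₃, hl⟩ := lower_of_quadForm_le hΨ hV hε0 hε1
  obtain ⟨κ₄, hu⟩ := twoRound_upper hΨ hV hε0 hε1
  have hone := log_betaErr_isBigO hΨ (fun n => oneWayLOCC (Fin n → Fin dA) (Fin n → Fin dB))
    (r := fun n => √n) (hpos.mono fun n h => Real.sqrt_pos.2 h) hκ₁ hl₁ hu₁
  have htwo := log_betaErr_isBigO hΨ (fun n => loccRounds (Fin n → Fin dA) (Fin n → Fin dB) 2)
    (r := fun n => n) hpos hκ₃ (hl.mono fun n h M hM hacc => by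
      obtain ⟨φ, c, h1, h2⟩ := h
      obtain ⟨hP, hs⟩ := IsLOCC.separable hM
      exact h2 M hP (h1 _ (hs 1)) hacc) hu
  have hcl := log_betaErr_isBigO hΨ (fun n => twoWayLOCC (Fin n → Fin dA) (Fin n → Fin dB))
    (r := fun n => n) hpos hκ₃ (hl.mono fun n h M hM hacc => by
      obtain ⟨φ, c, h1, h2⟩ := h
      obtain ⟨hP, hs⟩ := twoWayLOCC_subset h1 hM
      exact h2 M hP hs hacc) (hu.mono fun n h => by
      obtain ⟨M, hM, h⟩ := h
      exact ⟨M, subset_closure (Set.mem_iUnion.2 ⟨2, hM⟩), h⟩)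
  have hsep := log_betaErr_isBigO hΨ (fun n => separablePOVM (Fin n → Fin dA) (Fin n → Fin dB))
    (r := fun n => n) hpos hκ₃ (hl.mono fun n h M hM hacc => by
      obtain ⟨φ, c, h1, h2⟩ := h
      exact h2 M hM.1 (h1 _ (hM.2 1)) hacc) (hu.mono fun n h => by
      obtain ⟨M, hM, h⟩ := h
      exact ⟨M, IsLOCC.separable hM, h⟩)
  refine ⟨?_, ?_, ?_, hsep⟩
  · refine hone.congr_left fun n => ?_
    rw [Real.log_sqrt (Nat.cast_nonneg n)]
    ring
  · refine (htwo.sub hcl).congr_left fun n => ?_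
    ring
  · refine (hcl.sub hsep).congr_left fun n => ?_
    ring
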